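/- **Setting.** Let $\Lambda_\circ$, $\Gamma$, $\Lambda_\bullet$ be even positive definite lattices of the same finite rank and let $\pi_\circ\colon\Gamma\to\Lambda_\circ$, $\pi_\bullet\colon\Gamma\to\Lambda_\bullet$ be form-preserving (hence injective) homomorphisms. Put $\mathfrak t_{\circ/\bullet}=\Lambda_{\circ/\bullet}\otimes\mathbb R$, $\mathfrak h=\Gamma\otimes\mathbb R$, $T_{\circ/\bullet}=\mathfrak t_{\circ/\bullet}/\Lambda_{\circ/\bullet}$, $H=\mathfrak h/\Gamma$. Identify $\mathfrak t_{\circ/\bullet}$ with $\mathfrak h$ through the isometries induced by $\pi_{\circ/\bullet}$, so that $\Gamma\subseteq\Lambda_\circ\cap\Lambda_\bullet$ and $\Lambda_\circ,\Lambda_\bullet\subseteq\Lambda_\circ-\Lambda_\bullet:=\{a-b: a\in\Lambda_\circ,\ b\in\Lambda_\bullet\}\subseteq\Gamma^\vee\subseteq\mathfrak h$; elements of the dual lattice $\Gamma^\vee$ are the characters $\exp_H x\mapsto e^{2\pi i\langle l,x\rangle}$ of $H$. Let $n$ be the smallest positive integer with $n(\Lambda_\circ-\Lambda_\bullet)\subseteq\Gamma$.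 Let $\epsilon$ be a normalised $\mathbb T$-valued $2$-cocycle on $\Lambda_\circ-\Lambda_\bullet$ with $\epsilon(\lambda,\mu)\epsilon(\mu,\lambda)^{-1}=e^{\pi i\langle\mu,\lambda\rangle}e^{2\pi i\langle\mu,\lambda_\bullet\rangle}$ whenever $\lambda=\lambda_\circ-\lambda_\bullet$ with $\lambda_{\circ/\bullet}\in\Lambda_{\circ/\bullet}$. *Loop group.* Write the circle as $[0,1]/(0\sim1)$ with points $q=0=1$, $p=1/2$. The group $L(T_\circ,H,T_\bullet)$ consists of the triples $\gamma=(\gamma_\circ,(\gamma_{\mathrm m}(p),\gamma_{\mathrm m}(q)),\gamma_\bullet)$ with $\gamma_\circ\colon[\tfrac12,1]\to T_\circ$, $\gamma_\bullet\colon[0,\tfrac12]\to T_\bullet$ smooth and $\gamma_{\mathrm m}(p),\gamma_{\mathrm m}(q)\in H$, such that at $p$ and at $q$ the values of $\gamma_\circ$ and $\gamma_\bullet$ are the images of $\gamma_{\mathrm m}$ and all their derivatives of order $\ge1$ agree in $\mathfrak h$. Every $\gamma$ has a lift $\Xi$, unique up to adding an element of $\Gamma$: a smooth $\Xi\colon\mathbb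 R\to\mathfrak h$ with $\Xi(t+1)=\Xi(t)+\Delta'_\gamma$ for some $\Delta'_\gamma\in\Lambda_\circ-\Lambda_\bullet$, which lifts $\gamma_\bullet$ on $[0,\frac12]$, $\gamma_\circ$ on $[\frac12,1]$, and with $\exp_H\Xi(\frac12)=\gamma_{\mathrm m}(p)$. The path $\operatorname{Pth}\gamma$ is $\exp_H\circ\,\Xi$ and $\Delta'(\operatorname{Pth}\gamma)=\Delta'_\gamma$. The central extension $\widetilde L(T_\circ,H,T_\bullet)=L(T_\circ,H,T_\bullet)\times\mathbb T$ has product $(\gamma,z)(\rho,w)=(\gamma+\rho,\,zw\,c(\gamma,\rho))$ with $$c(\gamma,\rho)=\epsilon(\Delta'_\gamma,\Delta'_\rho)\exp 2\pi i\Bigl(\tfrac12\int_0^1\langle\Xi',\mathrm H\rangle\,dt+\tfrac12\langle\Delta'_\gamma,\mathrm H(0)\rangle\Bigr)$$ for lifts $\Xi,\mathrm H$ of $\gamma,\rho$; $\widetilde\ker(\Delta'\circ\operatorname{Pth})$ is its normal subgroup of all $(\gamma,z)$ with $\Delta'_\gamma=0$. For a positive multiple $m$ of $n$, $\operatorname{Rot}^{(m)}(S^1)=\mathbb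 R/m\mathbb Z$ acts by $[\Phi_\theta]\cdot(\gamma,z)=(\gamma^\theta,\,e^{\pi i\langle\Xi(-\theta)-\Xi(0),\Delta'_\gamma\rangle}z)$, where $\gamma^\theta$ has the lift $\Xi(\cdot-\theta)$ and $\gamma^\theta_{\mathrm m}(q)=\gamma_{\mathrm m}(q)+\exp_H(\Xi(-\theta)-\Xi(0))$. *Representations.* Let $V\mathfrak h$ be the space of smooth $1$-periodic $\mathfrak h$-valued functions of mean $0$, with $S(\xi,\eta)=\frac12\int_0^1\langle\xi',\eta\rangle$, and $\mathcal S$ the Fock space of its completion for the Hermitian form $2\pi(S(\xi,J\eta)+iS(\xi,\eta))$, where $J$ is the Hilbert transform, with signs such that this form is positive definite. It carries the Weyl operators $W(\xi,z)$, with $W(\xi,z)W(\eta,w)=W(\xi+\eta,zwe^{2\pi iS(\xi,\eta)})$, and the rotation operators $R(\theta)$, second quantised from $\xi\mapsto\xi(\cdot-\theta)$. For a character $\chi$ of $(\Lambda_\circ\cap\Lambda_\bullet)/\Gamma\subseteq H$ and $l\in\Gamma^\vee$, the representation $W_{\chi,l}$ of $\widetilde\ker(\Delta'\circ\operatorname{Pth})$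 on $\mathcal S_{\chi,l}=\mathbb C_\chi\otimes\mathbb C_l\otimes\mathcal S=\mathcal S$ is $$W_{\chi,l}(\gamma,z)=\chi\bigl(\gamma_{\mathrm m}(q)-\exp_H\Xi(1)\bigr)\;e^{2\pi i\langle l,\operatorname{avg}\Xi\rangle}\;W(\Xi-\operatorname{avg}\Xi,\,z),\qquad \operatorname{avg}\Xi=\int_0^1\Xi .$$ When $m>0$, $n\mid m$ and $m\langle l,l\rangle\in2\mathbb Z$, the group $\operatorname{Rot}^{(m)}(S^1)$ acts on $\mathcal S_{\chi,l}$ by $R_{\chi,l}[\Phi_\theta]=e^{\pi i\langle l,l\rangle\theta}R(\theta)$. The induced representation $\operatorname{Ind}W_{\chi,l}$ of $\widetilde L(T_\circ,H,T_\bullet)$ acts on the Hilbert direct sum, over the left cosets $\sigma$ of $\widetilde\ker(\Delta'\circ\operatorname{Pth})$, of the spaces $\mathcal S_{\chi,l}^\sigma$ of classes $[x,v]$ with $x\in\sigma$, $v\in\mathcal S_{\chi,l}$, $[xh,v]=[x,W_{\chi,l}(h)v]$, by $g\,[x,v]=[gx,v]$; and $\operatorname{Rot}^{(m)}(S^1)$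 acts on the same space by $\operatorname{Ind}R_{\chi,l}[\Phi]\,[x,v]=[[\Phi]\cdot x,\,R_{\chi,l}[\Phi]v]$. For $(\lambda_\circ,\lambda_\bullet)\in\Lambda_\circ\oplus\Lambda_\bullet$ let $\gamma_{[\lambda_\circ,\lambda_\bullet]}$ be the element of $L(T_\circ,H,T_\bullet)$ with lift $t\mapsto\lambda_\bullet+t(\lambda_\circ-\lambda_\bullet)$ for $t\in\mathbb R$ and value $0$ at $q$. For $\lambda\in\Lambda_\circ-\Lambda_\bullet$ let $\sigma_\lambda$ be the coset of all $(\gamma,z)$ with $\Delta'_\gamma=\lambda$; it contains $(\gamma_{[\lambda_\circ,\lambda_\bullet]},1)$ whenever $\lambda_\circ-\lambda_\bullet=\lambda$. **Theorem.** Fix $\chi$ and $l$. There is a smallest positive integer $m$ such that $n\mid m$ and $m\langle l,l\rangle\in2\mathbb Z$. For every $\lambda\in\Lambda_\circ-\Lambda_\bullet$ it is also the smallest positive integer such that $n\mid m$ and $m\langle l-\lambda,l-\lambda\rangle\in2\mathbb Z$. Moreover: 1. For every $\lambda\in\Lambda_\circ-\Lambda_\bullet$ and every $(\lambda_\circ,\lambda_\bullet)\in\Lambda_\circ\oplus\Lambda_\bullet$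 with $\lambda_\circ-\lambda_\bullet=\lambda$, the unitary map $$f\colon\mathcal S_{\chi,l}^{\sigma_\lambda}\to\mathcal S_{\chi,l-\lambda},\qquad[(\gamma_{[\lambda_\circ,\lambda_\bullet]},1),v]\mapsto v,$$ intertwines the restriction of $\operatorname{Ind}W_{\chi,l}$ to $\widetilde\ker(\Delta'\circ\operatorname{Pth})$ and to the summand $\mathcal S_{\chi,l}^{\sigma_\lambda}$ (which it preserves) with $W_{\chi,l-\lambda}$, and the restriction of $\operatorname{Ind}R_{\chi,l}$ to this summand (which it also preserves) with $R_{\chi,l-\lambda}$. 2. For every choice of pre-images $(\lambda_\circ,\lambda_\bullet)$ of all $\lambda\in\Lambda_\circ-\Lambda_\bullet$, the maps $f$ form a unitary isomorphism $$\operatorname{Res}\operatorname{Ind}W_{\chi,l}\;\xrightarrow{\ \sim\ }\;\bigoplus_{\lambda\in\Lambda_\circ-\Lambda_\bullet}W_{\chi,l-\lambda}$$ of representations of $\widetilde\ker(\Delta'\circ\operatorname{Pth})\rtimes\operatorname{Rot}^{(m)}(S^1)$, where $\operatorname{Rot}^{(m)}(S^1)$ acts by $\operatorname{Ind}R_{\chi,l}$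 on the left and by $\bigoplus_\lambda R_{\chi,l-\lambda}$ on the right, and the sum is the Hilbert direct sum. -/

import Mathlib

noncomputable section

open scoped RealInnerProductSpace ContDiff

/-! ### Smooth loops in a Euclidean space -/

namespace SmoothLoop

lemma hasSum_of_eq {α : Type*} [AddCommMonoid α] [TopologicalSpace α] {f g : ℕ → α} {a : α}
    (h : ∀ k, f k = g k) (hg : HasSum g a) : HasSum f a := by
  rw [funext h]
  exact hg

section Fourier

variable {E : Type*} [NormedAddCommGroup E] [InnerProductSpace ℝ E]

/-- The `k`-th real cosine Fourier coefficient `2 ∫₀¹ cos (2πkt) ξ(t) dt`. -/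
def cosCoeff (ξ : ℝ → E) (k : ℕ) : E :=
  (2 : ℝ) • ∫ t in (0 : ℝ)..1, Real.cos (2 * Real.pi * k * t) • ξ t

/-- The `k`-th real sine Fourier coefficient `2 ∫₀¹ sin (2πkt) ξ(t) dt`. -/
def sinCoeff (ξ : ℝ → E) (k : ℕ) : E :=
  (2 : ℝ) • ∫ t in (0 : ℝ)..1, Real.sin (2 * Real.pi * k * t) • ξ t

/-- The standard complex structure on loops of zero mean,
`∑ (a k cos (2πkt) + b k sin (2πkt)) ↦ ∑ (b k cos (2πkt) - a k sin (2πkt))`. On complexified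
loops it multiplies `exp (2πikt)` by `i` for `k > 0` and by `-i` for `k < 0`. -/
def hilbertTransform (ξ : ℝ → E) (t : ℝ) : E :=
  ∑' k : ℕ, (Real.cos (2 * Real.pi * (k + 1 : ℕ) * t) • sinCoeff ξ (k + 1)
    - Real.sin (2 * Real.pi * (k + 1 : ℕ) * t) • cosCoeff ξ (k + 1))

/-- The bilinear form `½ ∫₀¹ ⟨ξ'(t), η(t)⟩ dt`. -/
def sympl (ξ η : ℝ → E) : ℝ := (1 / 2) * ∫ t in (0 : ℝ)..1, ⟪deriv ξ t, η t⟫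

/-- The Hermitian form `2π (S(ξ, Jη) + i S(ξ, η))`, complex linear in the first variable. -/
def herm (ξ η : ℝ → E) : ℂ :=
  2 * Real.pi * ((sympl ξ (hilbertTransform η) : ℝ) + Complex.I * (sympl ξ η : ℝ))

lemma cosCoeff_deriv {ξ : ℝ → E} (h : ContDiff ℝ ∞ ξ) (hp : Function.Periodic ξ 1) [CompleteSpace E]
    (k : ℕ) :
    cosCoeff (deriv ξ) k = (2 * Real.pi * k) • sinCoeff ξ k := by
  have hd : ContDiff ℝ ∞ (deriv ξ) := ((contDiff_infty_iff_deriv).1 h).2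
  have h1 : ∀ t : ℝ, HasDerivAt (fun t : ℝ => Real.cos (2 * Real.pi * k * t) • ξ t)
      (Real.cos (2 * Real.pi * k * t) • deriv ξ t -
        (2 * Real.pi * k) • (Real.sin (2 * Real.pi * k * t) • ξ t)) t := by
    intro t
    have hc : HasDerivAt (fun t : ℝ => Real.cos (2 * Real.pi * k * t))
        (-Real.sin (2 * Real.pi * k * t) * (2 * Real.pi * k)) t := by
      simpa using (((hasDerivAt_id t).const_mul (2 * Real.pi * k)).cos)
    have hx : HasDerivAt ξ (deriv ξ t) t :=
      ((h.differentiable (by simp)) t).hasDerivAt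
    refine (hc.smul hx).congr_deriv ?_
    rw [smul_smul, sub_eq_add_neg, ← neg_smul]
    congr 2
    ring
  have hcont := h.continuous
  have hdcont := hd.continuous
  have h2 := intervalIntegral.integral_eq_sub_of_hasDerivAt (a := 0) (b := 1)
    (fun t _ => h1 t) (Continuous.intervalIntegrable (by fun_prop) _ _)
  rw [intervalIntegral.integral_sub (Continuous.intervalIntegrable (by fun_prop) _ _)
    (Continuous.intervalIntegrable (by fun_prop) _ _), intervalIntegral.integral_smul] at h2
  have h3 : ξ 1 = ξ 0 := by simpa using hp 0
  have h4 : Real.cos (2 * Real.pi * k * 1) = 1 := by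
    rw [show 2 * Real.pi * k * 1 = k * (2 * Real.pi) by ring]
    exact Real.cos_nat_mul_two_pi k
  simp only [h3, h4, mul_zero, Real.cos_zero, sub_self] at h2
  rw [cosCoeff, sinCoeff, sub_eq_zero.1 h2, smul_comm]

lemma sinCoeff_deriv {ξ : ℝ → E} (h : ContDiff ℝ ∞ ξ) (_hp : Function.Periodic ξ 1) [CompleteSpace E]
    (k : ℕ) :
    sinCoeff (deriv ξ) k = -((2 * Real.pi * k) • cosCoeff ξ k) := by
  have hd : ContDiff ℝ ∞ (deriv ξ) := ((contDiff_infty_iff_deriv).1 h).2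
  have h1 : ∀ t : ℝ, HasDerivAt (fun t : ℝ => Real.sin (2 * Real.pi * k * t) • ξ t)
      (Real.sin (2 * Real.pi * k * t) • deriv ξ t +
        (2 * Real.pi * k) • (Real.cos (2 * Real.pi * k * t) • ξ t)) t := by
    intro t
    have hc : HasDerivAt (fun t : ℝ => Real.sin (2 * Real.pi * k * t))
        (Real.cos (2 * Real.pi * k * t) * (2 * Real.pi * k)) t := by
      simpa using (((hasDerivAt_id t).const_mul (2 * Real.pi * k)).sin)
    have hx : HasDerivAt ξ (deriv ξ t) t :=
      ((h.differentiable (by simp)) t).hasDerivAt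
    refine (hc.smul hx).congr_deriv ?_
    rw [smul_smul]
    congr 2
    ring
  have hcont := h.continuous
  have hdcont := hd.continuous
  have h2 := intervalIntegral.integral_eq_sub_of_hasDerivAt (a := 0) (b := 1)
    (fun t _ => h1 t) (Continuous.intervalIntegrable (by fun_prop) _ _)
  rw [intervalIntegral.integral_add (Continuous.intervalIntegrable (by fun_prop) _ _)
    (Continuous.intervalIntegrable (by fun_prop) _ _), intervalIntegral.integral_smul] at h2
  have h4 : Real.sin (2 * Real.pi * k * 1) = 0 := by
    rw [show 2 * Real.pi * k * 1 = (2 * k : ℕ) * Real.pi by push_cast; ring]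
    exact Real.sin_nat_mul_pi (2 * k)
  simp only [h4, mul_zero, Real.sin_zero, zero_smul, sub_self] at h2
  rw [cosCoeff, sinCoeff, eq_neg_of_add_eq_zero_left h2, smul_neg, smul_comm]

lemma exists_bound {ξ : ℝ → E} (h : Continuous ξ) : ∃ C : ℝ, 0 ≤ C ∧ ∀ k,
    ‖cosCoeff ξ k‖ ≤ C ∧ ‖sinCoeff ξ k‖ ≤ C := by
  obtain ⟨C, hC⟩ := (isCompact_Icc (a := (0 : ℝ)) (b := 1)).exists_bound_of_continuousOn
    h.continuousOn
  have hC0 : 0 ≤ C := (norm_nonneg _).trans (hC 0 (by simp))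
  have key : ∀ g : ℝ → ℝ, (∀ t, |g t| ≤ 1) →
      ‖(2 : ℝ) • ∫ t in (0 : ℝ)..1, g t • ξ t‖ ≤ 2 * C := by
    intro g hg
    rw [norm_smul, Real.norm_eq_abs, abs_of_pos (by norm_num : (0 : ℝ) < 2)]
    have := intervalIntegral.norm_integral_le_of_norm_le_const (a := 0) (b := 1) (C := C)
      (f := fun t => g t • ξ t) (fun t ht => by
        rw [Set.uIoc_of_le zero_le_one] at ht
        rw [norm_smul]
        calc ‖g t‖ * ‖ξ t‖ ≤ 1 * C := by
              apply mul_le_mul (hg t) (hC t ⟨ht.1.le, ht.2⟩) (norm_nonneg _) zero_le_one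
          _ = C := one_mul C)
    simp at this
    linarith
  exact ⟨2 * C, by positivity, fun k =>
    ⟨key _ fun t => Real.abs_cos_le_one _, key _ fun t => Real.abs_sin_le_one _⟩⟩

lemma periodic_deriv {ξ : ℝ → E} (hp : Function.Periodic ξ 1) :
    Function.Periodic (deriv ξ) 1 := by
  intro t
  have : (fun s => ξ (s + 1)) = ξ := funext hp
  rw [← deriv_comp_add_const, this]

lemma summable_coeff [CompleteSpace E] {ξ : ℝ → E} (h : ContDiff ℝ ∞ ξ)
    (hp : Function.Periodic ξ 1) :
    (Summable fun k : ℕ => ‖cosCoeff ξ (k + 1)‖) ∧ Summable fun k : ℕ => ‖sinCoeff ξ (k + 1)‖ := by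
  have hd : ContDiff ℝ ∞ (deriv ξ) := ((contDiff_infty_iff_deriv).1 h).2
  have hdd : ContDiff ℝ ∞ (deriv (deriv ξ)) := ((contDiff_infty_iff_deriv).1 hd).2
  obtain ⟨C, hC0, hC⟩ := exists_bound hdd.continuous
  have hsum : Summable fun k : ℕ => C * (1 / ((k + 1 : ℕ) : ℝ) ^ 2) :=
    ((summable_nat_add_iff 1).2 (Real.summable_one_div_nat_pow.2 one_lt_two)).mul_left C
  have key : ∀ (k : ℕ) (x y : E), y = -((2 * Real.pi * (k + 1 : ℕ)) ^ 2 • x) → ‖y‖ ≤ C →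
      ‖x‖ ≤ C * (1 / ((k + 1 : ℕ) : ℝ) ^ 2) := by
    intro k x y hxy hy
    rw [hxy, norm_neg, norm_smul, Real.norm_eq_abs, abs_of_nonneg (by positivity)] at hy
    have hk : (0 : ℝ) < ((k + 1 : ℕ) : ℝ) ^ 2 := by positivity
    rw [mul_one_div, le_div_iff₀ hk]
    refine le_trans ?_ hy
    rw [mul_comm]
    apply mul_le_mul_of_nonneg_right _ (norm_nonneg _)
    apply pow_le_pow_left₀ (by positivity)
    have := Real.pi_gt_three
    have hk' : (0 : ℝ) ≤ ((k + 1 : ℕ) : ℝ) := by positivity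
    nlinarith
  constructor
  · refine Summable.of_nonneg_of_le (fun _ => norm_nonneg _) (fun k => ?_) hsum
    refine key k _ (cosCoeff (deriv (deriv ξ)) (k + 1)) ?_ (hC _).1
    rw [cosCoeff_deriv hd (periodic_deriv hp), sinCoeff_deriv h hp, smul_neg, smul_smul, sq]
  · refine Summable.of_nonneg_of_le (fun _ => norm_nonneg _) (fun k => ?_) hsum
    refine key k _ (sinCoeff (deriv (deriv ξ)) (k + 1)) ?_ (hC _).2
    rw [sinCoeff_deriv hd (periodic_deriv hp), cosCoeff_deriv h hp, smul_smul, sq]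

lemma inner_cosCoeff [CompleteSpace E] {ξ : ℝ → E} (h : Continuous ξ) (v : E) (k : ℕ) :
    ⟪v, cosCoeff ξ k⟫ = 2 * ∫ t in (0 : ℝ)..1, Real.cos (2 * Real.pi * k * t) * ⟪v, ξ t⟫ := by
  have := (innerSL ℝ v).intervalIntegral_comp_comm (μ := MeasureTheory.volume) (a := 0) (b := 1)
    (f := fun t => Real.cos (2 * Real.pi * k * t) • ξ t)
    (Continuous.intervalIntegrable (by fun_prop) _ _)
  simp only [innerSL_apply_apply, inner_smul_right] at this
  rw [cosCoeff, inner_smul_right, this]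

lemma inner_sinCoeff [CompleteSpace E] {ξ : ℝ → E} (h : Continuous ξ) (v : E) (k : ℕ) :
    ⟪v, sinCoeff ξ k⟫ = 2 * ∫ t in (0 : ℝ)..1, Real.sin (2 * Real.pi * k * t) * ⟪v, ξ t⟫ := by
  have := (innerSL ℝ v).intervalIntegral_comp_comm (μ := MeasureTheory.volume) (a := 0) (b := 1)
    (f := fun t => Real.sin (2 * Real.pi * k * t) • ξ t)
    (Continuous.intervalIntegrable (by fun_prop) _ _)
  simp only [innerSL_apply_apply, inner_smul_right] at this
  rw [sinCoeff, inner_smul_right, this]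

lemma hasSum_fourier_inner [CompleteSpace E] {ξ : ℝ → E} (h : ContDiff ℝ ∞ ξ)
    (hp : Function.Periodic ξ 1) (h0 : ∫ t in (0 : ℝ)..1, ξ t = 0) (v : E) (t : ℝ) :
    HasSum (fun k : ℕ => Real.cos (2 * Real.pi * (k + 1 : ℕ) * t) * ⟪v, cosCoeff ξ (k + 1)⟫
      + Real.sin (2 * Real.pi * (k + 1 : ℕ) * t) * ⟪v, sinCoeff ξ (k + 1)⟫) ⟪v, ξ t⟫ := by
  have hcont := h.continuous
  have hper : Function.Periodic (fun t => ((⟪v, ξ t⟫ : ℝ) : ℂ)) 1 := fun t => by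
    simp only [hp t]
  let g : C(AddCircle (1 : ℝ), ℂ) :=
    ⟨hper.lift, continuous_coinduced_dom.2 (by
      have : Continuous fun t => ((⟪v, ξ t⟫ : ℝ) : ℂ) := by fun_prop
      exact this)⟩
  have hg : ∀ t : ℝ, g (t : AddCircle (1 : ℝ)) = ((⟪v, ξ t⟫ : ℝ) : ℂ) := fun t => rfl
  have hco : ∀ n : ℤ, fourierCoeff g n =
      ((∫ t in (0 : ℝ)..1, Real.cos (2 * Real.pi * n * t) * ⟪v, ξ t⟫ : ℝ) : ℂ)
      - Complex.I * ((∫ t in (0 : ℝ)..1, Real.sin (2 * Real.pi * n * t) * ⟪v, ξ t⟫ : ℝ) : ℂ) := by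
    intro n
    rw [fourierCoeff_eq_intervalIntegral g n 0, ← intervalIntegral.integral_ofReal,
      ← intervalIntegral.integral_ofReal, ← intervalIntegral.integral_const_mul,
      ← intervalIntegral.integral_sub (Continuous.intervalIntegrable (by fun_prop) _ _)
      (Continuous.intervalIntegrable (by fun_prop) _ _)]
    simp only [zero_add, one_div_one, one_smul]
    refine intervalIntegral.integral_congr fun t _ => ?_
    simp only [hg, fourier_coe_apply, smul_eq_mul]
    have : 2 * (Real.pi : ℂ) * Complex.I * ((-n : ℤ) : ℂ) * t / ((1 : ℝ) : ℂ) =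
      ((-(2 * Real.pi * n * t) : ℝ) : ℂ) * Complex.I := by
      push_cast; ring
    rw [this, Complex.exp_mul_I, ← Complex.ofReal_cos, ← Complex.ofReal_sin, Real.cos_neg,
      Real.sin_neg]
    push_cast
    ring
  have hz : fourierCoeff g 0 = 0 := by
    rw [hco]
    have := (innerSL ℝ v).intervalIntegral_comp_comm (μ := MeasureTheory.volume) (a := 0) (b := 1)
      (f := ξ) (Continuous.intervalIntegrable (by fun_prop) _ _)
    simp only [innerSL_apply_apply, h0, inner_zero_right] at this
    simp [this]
  have hpos : ∀ k : ℕ, fourierCoeff g (k : ℤ) =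
      (1 / 2 : ℂ) * ((⟪v, cosCoeff ξ k⟫ : ℝ) - Complex.I * (⟪v, sinCoeff ξ k⟫ : ℝ)) := by
    intro k
    rw [hco, inner_cosCoeff hcont, inner_sinCoeff hcont]
    push_cast
    ring
  have hneg : ∀ k : ℕ, fourierCoeff g (-(k : ℤ)) =
      (1 / 2 : ℂ) * ((⟪v, cosCoeff ξ k⟫ : ℝ) + Complex.I * (⟪v, sinCoeff ξ k⟫ : ℝ)) := by
    intro k
    rw [hco, inner_cosCoeff hcont, inner_sinCoeff hcont]
    have e1 : ∀ t : ℝ, Real.cos (2 * Real.pi * ((-(k : ℤ) : ℤ) : ℝ) * t)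
        = Real.cos (2 * Real.pi * k * t) := fun t => by
      rw [← Real.cos_neg]; congr 1; push_cast; ring
    have e2 : ∀ t : ℝ, Real.sin (2 * Real.pi * ((-(k : ℤ) : ℤ) : ℝ) * t)
        = -Real.sin (2 * Real.pi * k * t) := fun t => by
      rw [← Real.sin_neg]; congr 1; push_cast; ring
    simp only [e1, e2, neg_mul, intervalIntegral.integral_neg]
    push_cast
    ring
  obtain ⟨s1, s2⟩ := summable_coeff h hp
  have hb : ∀ z : ℂ, ∀ k : ℕ, (z = (1 / 2 : ℂ) * ((⟪v, cosCoeff ξ k⟫ : ℝ) - Complex.I *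
      (⟪v, sinCoeff ξ k⟫ : ℝ)) ∨ z = (1 / 2 : ℂ) * ((⟪v, cosCoeff ξ k⟫ : ℝ) + Complex.I *
      (⟪v, sinCoeff ξ k⟫ : ℝ))) → ‖z‖ ≤ ‖v‖ * (‖cosCoeff ξ k‖ + ‖sinCoeff ξ k‖) := by
    intro z k hz
    have b1 := abs_real_inner_le_norm v (cosCoeff ξ k)
    have b2 := abs_real_inner_le_norm v (sinCoeff ξ k)
    have b3 : ‖z‖ ≤ (1 / 2) * (|⟪v, cosCoeff ξ k⟫| + |⟪v, sinCoeff ξ k⟫|) := by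
      rcases hz with rfl | rfl
      · rw [norm_mul]
        refine mul_le_mul (by simp) ((norm_sub_le _ _).trans (by simp)) (norm_nonneg _) (by norm_num)
      · rw [norm_mul]
        refine mul_le_mul (by simp) ((norm_add_le _ _).trans (by simp)) (norm_nonneg _) (by norm_num)
    have := norm_nonneg v
    have := norm_nonneg (cosCoeff ξ k)
    have := norm_nonneg (sinCoeff ξ k)
    nlinarith [abs_nonneg ⟪v, cosCoeff ξ k⟫, abs_nonneg ⟪v, sinCoeff ξ k⟫]
  have hS : Summable fun k : ℕ => ‖v‖ * (‖cosCoeff ξ (k + 1)‖ + ‖sinCoeff ξ (k + 1)‖) :=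
    (s1.add s2).mul_left _
  have hS' : Summable fun k : ℕ => ‖v‖ * (‖cosCoeff ξ k‖ + ‖sinCoeff ξ k‖) :=
    (summable_nat_add_iff 1).1 hS
  have hsum : Summable (fourierCoeff g) := by
    refine Summable.of_nat_of_neg ?_ ?_
    · exact Summable.of_norm_bounded hS' fun k => hb _ k (Or.inl (hpos k))
    · exact Summable.of_norm_bounded hS' fun k => hb _ k (Or.inr (hneg k))
  have main := (has_pointwise_sum_fourier_series_of_summable hsum (t : AddCircle (1 : ℝ)))
  have main2 := main.nat_add_neg
  rw [hz, zero_smul, add_zero, ← hasSum_nat_add_iff' 1] at main2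
  simp only [Finset.sum_range_one, Nat.cast_zero, neg_zero, hz, zero_smul,
    add_zero, sub_zero, hg] at main2
  rw [← Complex.hasSum_ofReal]
  refine hasSum_of_eq (fun k => ?_) main2
  rw [hpos, hneg]
  simp only [fourier_coe_apply, smul_eq_mul]
  have e1 : 2 * (Real.pi : ℂ) * Complex.I * (((k + 1 : ℕ) : ℤ) : ℂ) * t / ((1 : ℝ) : ℂ) =
    ((2 * Real.pi * (k + 1 : ℕ) * t : ℝ) : ℂ) * Complex.I := by
    push_cast; ring
  have e2 : 2 * (Real.pi : ℂ) * Complex.I * ((-((k + 1 : ℕ) : ℤ) : ℤ) : ℂ) * t / ((1 : ℝ) : ℂ) =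
    ((-(2 * Real.pi * (k + 1 : ℕ) * t) : ℝ) : ℂ) * Complex.I := by
    push_cast; ring
  rw [e1, e2, Complex.exp_mul_I, Complex.exp_mul_I, ← Complex.ofReal_cos, ← Complex.ofReal_sin,
    ← Complex.ofReal_cos, ← Complex.ofReal_sin, Real.cos_neg, Real.sin_neg]
  generalize Real.sin (2 * Real.pi * (k + 1 : ℕ) * t) = sn
  generalize Real.cos (2 * Real.pi * (k + 1 : ℕ) * t) = cs
  push_cast
  linear_combination ((sn : ℂ) * (⟪v, sinCoeff ξ (k + 1)⟫ : ℝ)) * Complex.I_sq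

/-- Termwise integration of `½ ∫₀¹ ⟨ξ'(t), η(t)⟩ dt` against an absolutely convergent trigonometric
series `η`. -/
lemma hasSum_sympl [CompleteSpace E] {ξ : ℝ → E} (h : ContDiff ℝ ∞ ξ)
    (hp : Function.Periodic ξ 1) {η : ℝ → E} {A B : ℕ → E} (hA : Summable fun k => ‖A k‖)
    (hB : Summable fun k => ‖B k‖)
    (hη : ∀ v t, HasSum (fun k : ℕ => Real.cos (2 * Real.pi * (k + 1 : ℕ) * t) * ⟪v, A k⟫
      + Real.sin (2 * Real.pi * (k + 1 : ℕ) * t) * ⟪v, B k⟫) ⟪v, η t⟫) :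
    HasSum (fun k : ℕ => (Real.pi / 2) * (k + 1 : ℕ) *
      (⟪sinCoeff ξ (k + 1), A k⟫ - ⟪cosCoeff ξ (k + 1), B k⟫)) (sympl ξ η) := by
  have hd : ContDiff ℝ ∞ (deriv ξ) := ((contDiff_infty_iff_deriv).1 h).2
  have hdc := hd.continuous
  obtain ⟨C, hC⟩ := (isCompact_Icc (a := (0 : ℝ)) (b := 1)).exists_bound_of_continuousOn
    hdc.continuousOn
  have hC0 : 0 ≤ C := (norm_nonneg _).trans (hC 0 (by simp))
  let f : ℕ → C(ℝ, ℝ) := fun k =>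
    ⟨fun t => Real.cos (2 * Real.pi * (k + 1 : ℕ) * t) * ⟪deriv ξ t, A k⟫
      + Real.sin (2 * Real.pi * (k + 1 : ℕ) * t) * ⟪deriv ξ t, B k⟫, by fun_prop⟩
  have hs : Summable fun k => ‖(f k).restrict
      (⟨Set.uIcc (0 : ℝ) 1, isCompact_uIcc⟩ : TopologicalSpace.Compacts ℝ)‖ := by
    refine Summable.of_nonneg_of_le (fun _ => norm_nonneg _) (fun k => ?_)
      ((hA.add hB).mul_left C)
    refine (ContinuousMap.norm_le _ (by positivity)).2 fun t => ?_
    have ht : (t : ℝ) ∈ Set.Icc (0 : ℝ) 1 := by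
      have := t.2
      rw [← Set.uIcc_of_le (zero_le_one' ℝ)]
      exact this
    have hCt := hC t ht
    have c1 := Real.abs_cos_le_one (2 * Real.pi * (k + 1 : ℕ) * t)
    have c2 := Real.abs_sin_le_one (2 * Real.pi * (k + 1 : ℕ) * t)
    have i1 : |⟪deriv ξ t, A k⟫| ≤ C * ‖A k‖ := (abs_real_inner_le_norm _ _).trans
      (mul_le_mul_of_nonneg_right hCt (norm_nonneg _))
    have i2 : |⟪deriv ξ t, B k⟫| ≤ C * ‖B k‖ := (abs_real_inner_le_norm _ _).trans
      (mul_le_mul_of_nonneg_right hCt (norm_nonneg _))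
    change |Real.cos (2 * Real.pi * (k + 1 : ℕ) * t) * ⟪deriv ξ t, A k⟫
      + Real.sin (2 * Real.pi * (k + 1 : ℕ) * t) * ⟪deriv ξ t, B k⟫| ≤ _
    refine (abs_add_le _ _).trans ?_
    rw [abs_mul, abs_mul, mul_add]
    exact add_le_add
      ((mul_le_of_le_one_left (abs_nonneg _) c1).trans i1)
      ((mul_le_of_le_one_left (abs_nonneg _) c2).trans i2)
  have main := (intervalIntegral.hasSum_intervalIntegral_of_summable_norm hs).mul_left (1 / 2)
  have e : (1 / 2 : ℝ) * ∫ t in (0 : ℝ)..1, ∑' k, f k t = sympl ξ η := by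
    rw [sympl]
    congr 1
    exact intervalIntegral.integral_congr fun t _ => (hη (deriv ξ t) t).tsum_eq
  rw [e] at main
  refine hasSum_of_eq (fun k => ?_) main
  have e2 : ∫ t in (0 : ℝ)..1, f k t =
      (1 / 2) * (⟪A k, cosCoeff (deriv ξ) (k + 1)⟫ + ⟪B k, sinCoeff (deriv ξ) (k + 1)⟫) := by
    rw [inner_cosCoeff hdc, inner_sinCoeff hdc]
    change ∫ t in (0 : ℝ)..1, (Real.cos (2 * Real.pi * (k + 1 : ℕ) * t) * ⟪deriv ξ t, A k⟫
      + Real.sin (2 * Real.pi * (k + 1 : ℕ) * t) * ⟪deriv ξ t, B k⟫) = _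
    rw [intervalIntegral.integral_add (Continuous.intervalIntegrable (by fun_prop) _ _)
      (Continuous.intervalIntegrable (by fun_prop) _ _)]
    simp only [real_inner_comm (deriv ξ _)]
    ring
  rw [e2, cosCoeff_deriv h hp, sinCoeff_deriv h hp, inner_neg_right, inner_smul_right,
    inner_smul_right, real_inner_comm, real_inner_comm (cosCoeff ξ (k + 1))]
  ring

/-- The Fourier expansion of the Hermitian form. -/
lemma hasSum_herm [CompleteSpace E] {ξ η : ℝ → E} (h : ContDiff ℝ ∞ ξ)
    (hp : Function.Periodic ξ 1) (h' : ContDiff ℝ ∞ η)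
    (hp' : Function.Periodic η 1) (h0' : ∫ t in (0 : ℝ)..1, η t = 0) :
    HasSum (fun k : ℕ => ((Real.pi ^ 2 * (k + 1 : ℕ) : ℝ) : ℂ) *
      (((⟪cosCoeff ξ (k + 1), cosCoeff η (k + 1)⟫ + ⟪sinCoeff ξ (k + 1), sinCoeff η (k + 1)⟫ : ℝ) : ℂ)
      + Complex.I * ((⟪sinCoeff ξ (k + 1), cosCoeff η (k + 1)⟫ -
        ⟪cosCoeff ξ (k + 1), sinCoeff η (k + 1)⟫ : ℝ) : ℂ))) (herm ξ η) := by
  obtain ⟨s1, s2⟩ := summable_coeff h' hp'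
  have t1 := hasSum_sympl h hp s1 s2 (hasSum_fourier_inner h' hp' h0')
  have t2 := hasSum_sympl (η := hilbertTransform η) (A := fun k => sinCoeff η (k + 1))
    (B := fun k => -cosCoeff η (k + 1)) h hp s2 (by simpa using s1) (fun v t => by
      have hs : Summable fun k : ℕ =>
          (Real.cos (2 * Real.pi * (k + 1 : ℕ) * t) • sinCoeff η (k + 1)
          - Real.sin (2 * Real.pi * (k + 1 : ℕ) * t) • cosCoeff η (k + 1)) := by
        refine Summable.of_norm_bounded (s2.add s1) fun k => ?_
        refine (norm_sub_le _ _).trans ?_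
        rw [norm_smul, norm_smul]
        exact add_le_add (mul_le_of_le_one_left (norm_nonneg _) (Real.abs_cos_le_one _))
          (mul_le_of_le_one_left (norm_nonneg _) (Real.abs_sin_le_one _))
      have := hs.hasSum.mapL (innerSL ℝ v)
      refine hasSum_of_eq (fun k => ?_) this
      rw [innerSL_apply_apply, inner_sub_right, inner_smul_right, inner_smul_right,
        inner_neg_right]
      ring)
  have t3 := ((Complex.hasSum_ofReal.2 t2).add
    ((Complex.hasSum_ofReal.2 t1).mul_left Complex.I)).mul_left (2 * (Real.pi : ℂ))
  refine hasSum_of_eq (fun k => ?_) t3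
  simp only [inner_neg_right]
  push_cast
  ring

end Fourier

end SmoothLoop
end

noncomputable section

open scoped RealInnerProductSpace ContDiff ComplexOrder

namespace SmoothLoop

variable {E : Type*} [NormedAddCommGroup E] [InnerProductSpace ℝ E]

lemma cosCoeff_add {ξ η : ℝ → E} (h : Continuous ξ) (h' : Continuous η) (k : ℕ) :
    cosCoeff (ξ + η) k = cosCoeff ξ k + cosCoeff η k := by
  simp only [cosCoeff, Pi.add_apply, smul_add]
  rw [intervalIntegral.integral_add (Continuous.intervalIntegrable (by fun_prop) _ _)
    (Continuous.intervalIntegrable (by fun_prop) _ _), smul_add]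

lemma sinCoeff_add {ξ η : ℝ → E} (h : Continuous ξ) (h' : Continuous η) (k : ℕ) :
    sinCoeff (ξ + η) k = sinCoeff ξ k + sinCoeff η k := by
  simp only [sinCoeff, Pi.add_apply, smul_add]
  rw [intervalIntegral.integral_add (Continuous.intervalIntegrable (by fun_prop) _ _)
    (Continuous.intervalIntegrable (by fun_prop) _ _), smul_add]

lemma integral_shift [CompleteSpace E] {F : ℝ → E} (hF : Function.Periodic F 1) (θ : ℝ) :
    ∫ t in (0 : ℝ)..1, F (t - θ) = ∫ t in (0 : ℝ)..1, F t := by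
  rw [intervalIntegral.integral_comp_sub_right]
  have := hF.intervalIntegral_add_eq (0 - θ) 0
  rw [show (0 - θ + 1 : ℝ) = 1 - θ by ring] at this
  simpa using this

lemma coeff_rot [CompleteSpace E] {ξ : ℝ → E} (h : Continuous ξ) (hp : Function.Periodic ξ 1)
    (θ : ℝ) (k : ℕ) :
    cosCoeff (fun t => ξ (t - θ)) k = Real.cos (2 * Real.pi * k * θ) • cosCoeff ξ k
      - Real.sin (2 * Real.pi * k * θ) • sinCoeff ξ k ∧
    sinCoeff (fun t => ξ (t - θ)) k = Real.cos (2 * Real.pi * k * θ) • sinCoeff ξ k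
      + Real.sin (2 * Real.pi * k * θ) • cosCoeff ξ k := by
  have pc : ∀ t : ℝ, Real.cos (2 * Real.pi * k * (t + 1)) = Real.cos (2 * Real.pi * k * t) := by
    intro t
    rw [show 2 * Real.pi * k * (t + 1) = 2 * Real.pi * k * t + k * (2 * Real.pi) by ring]
    exact Real.cos_add_nat_mul_two_pi _ k
  have ps : ∀ t : ℝ, Real.sin (2 * Real.pi * k * (t + 1)) = Real.sin (2 * Real.pi * k * t) := by
    intro t
    rw [show 2 * Real.pi * k * (t + 1) = 2 * Real.pi * k * t + k * (2 * Real.pi) by ring]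
    exact Real.sin_add_nat_mul_two_pi _ k
  have split : ∀ t : ℝ, 2 * Real.pi * k * t = 2 * Real.pi * k * (t - θ) + 2 * Real.pi * k * θ :=
    fun t => by ring
  have key : ∀ G F : ℝ → E, Function.Periodic F 1 → (∀ t, G t = F (t - θ)) →
      ∫ t in (0 : ℝ)..1, G t = ∫ t in (0 : ℝ)..1, F t := fun G F hF e =>
    (intervalIntegral.integral_congr fun t _ => e t).trans (integral_shift hF θ)
  constructor
  · simp only [cosCoeff, sinCoeff]
    rw [key (fun t => Real.cos (2 * Real.pi * k * t) • ξ (t - θ)) (fun s => Real.cos (2 * Real.pi * k * θ) • (Real.cos (2 * Real.pi * k * s) • ξ s)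
          - Real.sin (2 * Real.pi * k * θ) • (Real.sin (2 * Real.pi * k * s) • ξ s))
      (fun t => by simp only [pc, ps, hp t])
      (fun t => by
        rw [split t, Real.cos_add]
        module), intervalIntegral.integral_sub
      (Continuous.intervalIntegrable (by fun_prop) _ _)
      (Continuous.intervalIntegrable (by fun_prop) _ _), intervalIntegral.integral_smul,
      intervalIntegral.integral_smul]
    module
  · simp only [cosCoeff, sinCoeff]
    rw [key (fun t => Real.sin (2 * Real.pi * k * t) • ξ (t - θ)) (fun s => Real.cos (2 * Real.pi * k * θ) • (Real.sin (2 * Real.pi * k * s) • ξ s)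
          + Real.sin (2 * Real.pi * k * θ) • (Real.cos (2 * Real.pi * k * s) • ξ s))
      (fun t => by simp only [pc, ps, hp t])
      (fun t => by
        rw [split t, Real.sin_add]
        module), intervalIntegral.integral_add
      (Continuous.intervalIntegrable (by fun_prop) _ _)
      (Continuous.intervalIntegrable (by fun_prop) _ _), intervalIntegral.integral_smul,
      intervalIntegral.integral_smul]
    module

end SmoothLoop

/-- Smooth loops `ℝ/ℤ → E` of zero mean, as `1`-periodic functions. -/
def ZeroMeanLoop (E : Type*) [NormedAddCommGroup E] [InnerProductSpace ℝ E] :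
    Submodule ℝ (ℝ → E) where
  carrier := {ξ | ContDiff ℝ ∞ ξ ∧ Function.Periodic ξ 1 ∧ ∫ t in (0 : ℝ)..1, ξ t = 0}
  add_mem' := by
    rintro ξ η ⟨h1, h2, h3⟩ ⟨k1, k2, k3⟩
    refine ⟨h1.add k1, h2.add k2, ?_⟩
    have := h1.continuous
    have := k1.continuous
    simp only [Pi.add_apply]
    rw [intervalIntegral.integral_add (Continuous.intervalIntegrable (by fun_prop) _ _)
      (Continuous.intervalIntegrable (by fun_prop) _ _), h3, k3, add_zero]
  zero_mem' := ⟨contDiff_const, fun _ => rfl, by simp⟩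
  smul_mem' := by
    rintro c ξ ⟨h1, h2, h3⟩
    refine ⟨h1.const_smul c, fun t => by simp [h2 t], ?_⟩
    simp only [Pi.smul_apply]
    rw [intervalIntegral.integral_smul, h3, smul_zero]

namespace ZeroMeanLoop

open SmoothLoop

variable {E : Type*} [NormedAddCommGroup E] [InnerProductSpace ℝ E]

section Rot

variable [CompleteSpace E]

/-- Rotation of loops: `(Φ_θ^* ξ)(t) = ξ (t - θ)`. -/
def rot (θ : ℝ) (ξ : ZeroMeanLoop E) : ZeroMeanLoop E :=
  ⟨fun t => ξ.1 (t - θ), ξ.2.1.comp (contDiff_id.sub contDiff_const),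
    fun t => by
      change ξ.1 (t + 1 - θ) = ξ.1 (t - θ)
      have := ξ.2.2.1 (t - θ)
      rwa [show t - θ + 1 = t + 1 - θ by ring] at this,
    by rw [integral_shift ξ.2.2.1, ξ.2.2.2]⟩

@[simp] lemma rot_apply (θ : ℝ) (ξ : ZeroMeanLoop E) (t : ℝ) : (rot θ ξ).1 t = ξ.1 (t - θ) := rfl

lemma rot_zero (ξ : ZeroMeanLoop E) : rot 0 ξ = ξ := by
  ext t; simp

lemma rot_rot (θ θ' : ℝ) (ξ : ZeroMeanLoop E) : rot θ (rot θ' ξ) = rot (θ + θ') ξ := by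
  ext t; simp [sub_sub]

lemma rot_add_loop (θ : ℝ) (ξ η : ZeroMeanLoop E) : rot θ (ξ + η) = rot θ ξ + rot θ η := rfl

/-- Rotation of loops as a permutation. -/
def rotEquiv (θ : ℝ) : Equiv.Perm (ZeroMeanLoop E) where
  toFun := rot θ
  invFun := rot (-θ)
  left_inv ξ := by rw [rot_rot, neg_add_cancel, rot_zero]
  right_inv ξ := by rw [rot_rot, add_neg_cancel, rot_zero]

end Rot

/-- The summands in the Fourier expansion of the Hermitian form. -/
def hermTerm (ξ η : ZeroMeanLoop E) (k : ℕ) : ℂ :=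
  ((Real.pi ^ 2 * (k + 1 : ℕ) : ℝ) : ℂ) *
    (((⟪cosCoeff ξ.1 (k + 1), cosCoeff η.1 (k + 1)⟫ +
        ⟪sinCoeff ξ.1 (k + 1), sinCoeff η.1 (k + 1)⟫ : ℝ) : ℂ)
      + Complex.I * ((⟪sinCoeff ξ.1 (k + 1), cosCoeff η.1 (k + 1)⟫ -
        ⟪cosCoeff ξ.1 (k + 1), sinCoeff η.1 (k + 1)⟫ : ℝ) : ℂ))

section

variable [CompleteSpace E]

lemma hasSum_hermTerm (ξ η : ZeroMeanLoop E) : HasSum (hermTerm ξ η) (herm ξ.1 η.1) :=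
  hasSum_herm ξ.2.1 ξ.2.2.1 η.2.1 η.2.2.1 η.2.2.2

lemma herm_add_left (ξ η κ : ZeroMeanLoop E) :
    herm (ξ + η).1 κ.1 = herm ξ.1 κ.1 + herm η.1 κ.1 := by
  refine (hasSum_hermTerm (ξ + η) κ).unique ?_
  refine hasSum_of_eq (fun k => ?_) ((hasSum_hermTerm ξ κ).add (hasSum_hermTerm η κ))
  simp only [hermTerm, Submodule.coe_add, cosCoeff_add ξ.2.1.continuous η.2.1.continuous,
    sinCoeff_add ξ.2.1.continuous η.2.1.continuous, inner_add_left]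
  push_cast
  ring

lemma herm_conj (ξ η : ZeroMeanLoop E) :
    (starRingEnd ℂ) (herm ξ.1 η.1) = herm η.1 ξ.1 := by
  refine ((Complex.hasSum_conj'.2 (hasSum_hermTerm ξ η))).unique ?_
  refine hasSum_of_eq (fun k => ?_) (hasSum_hermTerm η ξ)
  simp only [hermTerm, map_mul, map_add, Complex.conj_ofReal, Complex.conj_I]
  rw [real_inner_comm (cosCoeff ξ.1 (k + 1)) (cosCoeff η.1 (k + 1)),
    real_inner_comm (sinCoeff ξ.1 (k + 1)) (sinCoeff η.1 (k + 1)),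
    real_inner_comm (cosCoeff ξ.1 (k + 1)) (sinCoeff η.1 (k + 1)),
    real_inner_comm (sinCoeff ξ.1 (k + 1)) (cosCoeff η.1 (k + 1))]
  push_cast
  ring

lemma herm_add_right (ξ η κ : ZeroMeanLoop E) :
    herm ξ.1 (η + κ).1 = herm ξ.1 η.1 + herm ξ.1 κ.1 := by
  rw [← herm_conj, herm_add_left, map_add, herm_conj, herm_conj]

lemma herm_sub_herm (ξ η : ZeroMeanLoop E) :
    herm ξ.1 η.1 - herm η.1 ξ.1 = 2 * (2 * Real.pi * Complex.I * (sympl ξ.1 η.1 : ℝ)) := by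
  rw [← herm_conj ξ η, herm]
  simp only [map_mul, map_add, Complex.conj_ofReal, Complex.conj_I, map_ofNat]
  ring

lemma herm_rot (θ : ℝ) (ξ η : ZeroMeanLoop E) :
    herm (rot θ ξ).1 (rot θ η).1 = herm ξ.1 η.1 := by
  refine (hasSum_hermTerm (rot θ ξ) (rot θ η)).unique ?_
  refine hasSum_of_eq (fun k => ?_) (hasSum_hermTerm ξ η)
  have hξ := coeff_rot ξ.2.1.continuous ξ.2.2.1 θ (k + 1)
  have hη := coeff_rot η.2.1.continuous η.2.2.1 θ (k + 1)
  have cs := Real.cos_sq_add_sin_sq (2 * Real.pi * (k + 1 : ℕ) * θ)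
  simp only [hermTerm]
  rw [show (rot θ ξ).1 = fun t => ξ.1 (t - θ) from rfl,
    show (rot θ η).1 = fun t => η.1 (t - θ) from rfl, hξ.1, hξ.2, hη.1, hη.2]
  generalize Real.cos (2 * Real.pi * (k + 1 : ℕ) * θ) = c at *
  generalize Real.sin (2 * Real.pi * (k + 1 : ℕ) * θ) = s at *
  simp only [inner_add_left, inner_add_right, inner_sub_left, inner_sub_right, inner_smul_left,
    inner_smul_right, RCLike.conj_to_real]
  generalize ⟪cosCoeff ξ.1 (k + 1), cosCoeff η.1 (k + 1)⟫ = A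
  generalize ⟪sinCoeff ξ.1 (k + 1), sinCoeff η.1 (k + 1)⟫ = B
  generalize ⟪sinCoeff ξ.1 (k + 1), cosCoeff η.1 (k + 1)⟫ = C
  generalize ⟪cosCoeff ξ.1 (k + 1), sinCoeff η.1 (k + 1)⟫ = D
  have cs' : (c : ℂ) ^ 2 + (s : ℂ) ^ 2 = 1 := by exact_mod_cast cs
  push_cast
  linear_combination ((Real.pi : ℂ) ^ 2 * (k + 1)) * ((A + B) + Complex.I * (C - D)) * cs'

end

end ZeroMeanLoop

/-! ### The symmetric Fock space -/

lemma posSemidef_of_hasSum {X : Type*} {A : ℕ → Matrix X X ℂ} {B : Matrix X X ℂ}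
    (hA : ∀ n, (A n).PosSemidef) (h : ∀ x y, HasSum (fun n => A n x y) (B x y)) :
    B.PosSemidef := by
  refine ⟨?_, fun x => ?_⟩
  · ext i j
    rw [Matrix.conjTranspose_apply]
    refine ((h j i).star).unique ?_
    refine SmoothLoop.hasSum_of_eq (fun n => ?_) (h i j)
    exact (hA n).isHermitian.apply i j
  · have key : HasSum (fun n => x.sum fun i xi => x.sum fun j xj => star xi * A n i j * xj)
        (x.sum fun i xi => x.sum fun j xj => star xi * B i j * xj) := by
      refine hasSum_sum fun i _ => hasSum_sum fun j _ => ?_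
      exact ((h i j).mul_left _).mul_right _
    exact key.nonneg fun n => (hA n).2 x

lemma posSemidef_gram_infinite {X F : Type*} [NormedAddCommGroup F] [InnerProductSpace ℂ F]
    (v : X → F) : (Matrix.of fun x y => inner ℂ (v x) (v y)).PosSemidef := by
  refine ⟨?_, fun x => ?_⟩
  · ext i j
    simp [Matrix.conjTranspose_apply]
  · have : (x.sum fun i xi => x.sum fun j xj => star xi * inner ℂ (v i) (v j) * xj) =
        inner ℂ (x.sum fun i xi => xi • v i) (x.sum fun i xi => xi • v i) := by
      simp only [Finsupp.sum]
      rw [sum_inner]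
      refine Finset.sum_congr rfl fun i _ => ?_
      rw [inner_sum]
      refine Finset.sum_congr rfl fun j _ => ?_
      rw [inner_smul_left, inner_smul_right, RCLike.star_def]
      ring
    simp only [Matrix.of_apply]
    rw [this, inner_self_eq_norm_sq_to_K]
    have := Complex.zero_le_real.2 (sq_nonneg ‖x.sum fun i xi => xi • v i‖)
    simpa using this

namespace ZeroMeanLoop

open SmoothLoop

variable {E : Type*} [NormedAddCommGroup E] [InnerProductSpace ℝ E] [FiniteDimensional ℝ E]

lemma posSemidef_herm :
    (Matrix.of fun κ ξ : ZeroMeanLoop E => herm ξ.1 κ.1).PosSemidef := by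
  have : CompleteSpace E := FiniteDimensional.complete ℝ E
  refine posSemidef_of_hasSum (A := fun k => Matrix.of fun κ ξ => hermTerm ξ κ k) (fun k => ?_)
    (fun κ ξ => hasSum_hermTerm ξ κ)
  let b := stdOrthonormalBasis ℝ E
  let v : ZeroMeanLoop E → EuclideanSpace ℂ (Fin (Module.finrank ℝ E)) := fun ξ =>
    WithLp.toLp 2 fun i => ((Real.pi * Real.sqrt (k + 1 : ℕ) : ℝ) : ℂ) *
      ((⟪b i, cosCoeff ξ.1 (k + 1)⟫ : ℝ) + Complex.I * (⟪b i, sinCoeff ξ.1 (k + 1)⟫ : ℝ))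
  have e : (Matrix.of fun κ ξ : ZeroMeanLoop E => hermTerm ξ κ k) =
      Matrix.of fun κ ξ => inner ℂ (v κ) (v ξ) := by
    ext κ ξ
    simp only [Matrix.of_apply, PiLp.inner_apply, RCLike.inner_apply, v, map_mul, map_add,
      Complex.conj_ofReal, Complex.conj_I, hermTerm]
    have hs : ((Real.sqrt (k + 1 : ℕ) : ℝ) : ℂ) * ((Real.sqrt (k + 1 : ℕ) : ℝ) : ℂ) = (k + 1 : ℕ) := by
      rw [← Complex.ofReal_mul, Real.mul_self_sqrt (by positivity)]
      simp
    have exp : ∀ x y : E, ((⟪x, y⟫ : ℝ) : ℂ) = ∑ i, ((⟪b i, x⟫ : ℝ) : ℂ) * (⟪b i, y⟫ : ℝ) := by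
      intro x y
      rw [← b.sum_inner_mul_inner x y]
      push_cast
      exact Finset.sum_congr rfl fun i _ => by rw [real_inner_comm]
    rw [Complex.ofReal_add, Complex.ofReal_sub, exp, exp, exp, exp, ← Finset.sum_add_distrib,
      ← Finset.sum_sub_distrib, Finset.mul_sum, ← Finset.sum_add_distrib, Finset.mul_sum]
    refine Finset.sum_congr rfl fun i _ => ?_
    generalize ⟪b i, cosCoeff ξ.1 (k + 1)⟫ = p
    generalize ⟪b i, sinCoeff ξ.1 (k + 1)⟫ = q
    generalize ⟪b i, cosCoeff κ.1 (k + 1)⟫ = r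
    generalize ⟪b i, sinCoeff κ.1 (k + 1)⟫ = s
    rw [Complex.ofReal_mul, Complex.ofReal_mul, Complex.ofReal_pow, Complex.ofReal_natCast, ← hs]
    generalize ((Real.sqrt (k + 1 : ℕ) : ℝ) : ℂ) = w
    linear_combination (q * s * Real.pi ^ 2 * w ^ 2 : ℂ) * Complex.I_sq
  rw [e]
  exact posSemidef_gram_infinite v

lemma posSemidef_exp_herm :
    (Matrix.of fun κ ξ : ZeroMeanLoop E => Complex.exp (herm ξ.1 κ.1)).PosSemidef := by
  have hpow : ∀ n : ℕ, (Matrix.of fun κ ξ : ZeroMeanLoop E => herm ξ.1 κ.1 ^ n).PosSemidef := by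
    intro n
    induction n with
    | zero =>
      have := posSemidef_gram_infinite (fun _ : ZeroMeanLoop E => (1 : ℂ))
      simpa using this
    | succ n ih =>
      have := ih.hadamard posSemidef_herm
      convert! this using 1
  refine posSemidef_of_hasSum (A := fun n => ((n.factorial : ℝ)⁻¹ : ℂ) •
    Matrix.of fun κ ξ : ZeroMeanLoop E => herm ξ.1 κ.1 ^ n) (fun n => ?_) (fun κ ξ => ?_)
  · refine (hpow n).smul ?_
    rw [← Complex.ofReal_inv]
    exact Complex.zero_le_real.2 (by positivity)
  · have := NormedSpace.expSeries_div_hasSum_exp (𝔸 := ℂ) (herm ξ.1 κ.1)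
    rw [← Complex.exp_eq_exp_ℂ] at this
    refine hasSum_of_eq (fun n => ?_) this
    simp [div_eq_inv_mul]

end ZeroMeanLoop
end

noncomputable section

open scoped RealInnerProductSpace ContDiff ComplexOrder

namespace ZeroMeanLoop

open SmoothLoop

variable {E : Type*} [NormedAddCommGroup E] [InnerProductSpace ℝ E] [FiniteDimensional ℝ E]

/-- The coherent-state kernel `exp ⟨ξ, κ⟩` on zero mean loops. -/
def fockKernel (E : Type*) [NormedAddCommGroup E] [InnerProductSpace ℝ E] :
    Matrix (ZeroMeanLoop E) (ZeroMeanLoop E) (ℂ →L[ℂ] ℂ) :=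
  Matrix.of fun κ ξ => Complex.exp (herm ξ.1 κ.1) • ContinuousLinearMap.id ℂ ℂ

lemma posSemidef_fockKernel : (fockKernel E).PosSemidef := by
  have h := posSemidef_exp_herm (E := E)
  refine ((RKHS.posSemidef_tfae (K := fockKernel E)).out 0 2).2 (And.intro ?_ fun x => ?_)
  · ext κ ξ
    have := h.isHermitian.apply κ ξ
    simp only [Matrix.of_apply] at this
    simp only [Matrix.conjTranspose_apply, fockKernel, Matrix.of_apply, star_smul]
    rw [show star (ContinuousLinearMap.id ℂ ℂ) = ContinuousLinearMap.id ℂ ℂ from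
      star_one (ℂ →L[ℂ] ℂ)]
    simp [← this]
  · have := (Complex.nonneg_iff.1 (h.2 x)).1
    rw [Finsupp.sum_comm] at this
    refine this.trans_eq ?_
    simp only [Finsupp.sum]
    rw [RCLike.re_eq_complex_re, ← Complex.conj_re]
    simp only [map_sum]
    congr 1
    refine Finset.sum_congr rfl fun i _ => Finset.sum_congr rfl fun j _ => ?_
    simp [fockKernel]
    ring

instance : Fact (fockKernel E).PosSemidef := ⟨posSemidef_fockKernel⟩

end ZeroMeanLoop

open ZeroMeanLoop SmoothLoop in
/-- The symmetric Fock space of the loops of zero mean: the Hilbert space with total family of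
coherent vectors `e^ξ` satisfying `⟨e^ξ, e^η⟩ = exp ⟨ξ, η⟩`, realised as the reproducing kernel
Hilbert space of that kernel. -/
def Fock (E : Type*) [NormedAddCommGroup E] [InnerProductSpace ℝ E] [FiniteDimensional ℝ E] :=
  RKHS.OfKernel (fockKernel E)

namespace Fock

open ZeroMeanLoop SmoothLoop

variable {E : Type*} [NormedAddCommGroup E] [InnerProductSpace ℝ E] [FiniteDimensional ℝ E]

instance : NormedAddCommGroup (Fock E) :=
  inferInstanceAs (NormedAddCommGroup (RKHS.OfKernel (fockKernel E)))

instance : InnerProductSpace ℂ (Fock E) :=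
  inferInstanceAs (InnerProductSpace ℂ (RKHS.OfKernel (fockKernel E)))

instance : CompleteSpace (Fock E) :=
  inferInstanceAs (CompleteSpace (RKHS.OfKernel (fockKernel E)))

/-- The coherent vector `e^ξ`. -/
def coh (ξ : ZeroMeanLoop E) : Fock E :=
  RKHS.kerFun (RKHS.OfKernel (fockKernel E)) ξ 1

/-- Mathlib's inner product is linear in the second variable, hence the order of the arguments. -/
lemma inner_coh (κ ξ : ZeroMeanLoop E) :
    inner ℂ (coh κ) (coh ξ) = Complex.exp (herm ξ.1 κ.1) := by
  have h1 : inner ℂ (coh κ) (coh ξ) = inner ℂ (RKHS.kerFun (RKHS.OfKernel (fockKernel E)) κ (1 : ℂ))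
    (RKHS.kerFun (RKHS.OfKernel (fockKernel E)) ξ (1 : ℂ)) := rfl
  rw [h1, RKHS.kerFun_inner, RKHS.kerFun_apply, RKHS.OfKernel.kernel_ofKernel]
  simp [fockKernel]

lemma dense_span_coh : DenseRange (Finsupp.linearCombination ℂ (coh (E := E))) := by
  have h := RKHS.kerFun_dense (RKHS.OfKernel (fockKernel E))
  have h2 : (Submodule.span ℂ (Set.range (coh (E := E)))).topologicalClosure = ⊤ := by
    rw [eq_top_iff]
    refine h.symm.le.trans (Submodule.topologicalClosure_mono (Submodule.span_le.2 ?_))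
    rintro _ ⟨ξ, v, rfl⟩
    have := (RKHS.kerFun (RKHS.OfKernel (fockKernel E)) ξ).map_smul v 1
    rw [smul_eq_mul, mul_one] at this
    rw [this]
    exact Submodule.smul_mem (Submodule.span ℂ (Set.range (coh (E := E)))) v
      (Submodule.subset_span ⟨ξ, rfl⟩)
  rw [← Finsupp.range_linearCombination] at h2
  have := (Submodule.dense_iff_topologicalClosure_eq_top).2 h2
  rwa [LinearMap.coe_range] at this

lemma ext_coh {U U' : Fock E ≃ₗᵢ[ℂ] Fock E} (h : ∀ ξ, U (coh ξ) = U' (coh ξ)) : U = U' := by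
  have : (fun x => U x) = fun x => U' x := by
    refine dense_span_coh.equalizer U.continuous U'.continuous (funext fun f => ?_)
    simp only [Function.comp_apply, Finsupp.linearCombination_apply, Finsupp.sum, map_sum, map_smul,
      h]
  exact LinearIsometryEquiv.ext fun x => congrFun this x

/-- The weighted permutation of the free vector space on zero mean loops. -/
def weightedPerm (σ : Equiv.Perm (ZeroMeanLoop E)) (w : ZeroMeanLoop E → ℂˣ) :
    (ZeroMeanLoop E →₀ ℂ) ≃ₗ[ℂ] (ZeroMeanLoop E →₀ ℂ) :=
  LinearEquiv.ofLinearMap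
    (Finsupp.linearCombination ℂ fun ξ => Finsupp.single (σ ξ) (w ξ : ℂ))
    (Finsupp.linearCombination ℂ fun ξ => Finsupp.single (σ.symm ξ) ((w (σ.symm ξ))⁻¹ : ℂ))
    (by ext ξ; simp) (by ext ξ; simp)

/-- The unitary operator with `e^ξ ↦ w(ξ) e^{σ ξ}`, for a weighted permutation of the coherent
vectors that preserves their inner products. -/
def unitary (σ : Equiv.Perm (ZeroMeanLoop E)) (w : ZeroMeanLoop E → ℂˣ)
    (h : ∀ κ ξ, (starRingEnd ℂ) (w κ) * w ξ * Complex.exp (herm (σ ξ).1 (σ κ).1) =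
      Complex.exp (herm ξ.1 κ.1)) : Fock E ≃ₗᵢ[ℂ] Fock E :=
  (weightedPerm σ w).extendOfIsometry (Finsupp.linearCombination ℂ coh)
    (Finsupp.linearCombination ℂ coh) dense_span_coh dense_span_coh (by
      intro f
      have e : Finsupp.linearCombination ℂ coh (weightedPerm σ w f) =
          f.sum fun ξ c => c • (w ξ : ℂ) • coh (σ ξ) := by
        change Finsupp.linearCombination ℂ coh (Finsupp.linearCombination ℂ
          (fun ξ => Finsupp.single (σ ξ) (w ξ : ℂ)) f) = _
        rw [Finsupp.linearCombination_apply ℂ f, Finsupp.sum, map_sum]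
        refine Finset.sum_congr rfl fun ξ _ => ?_
        rw [map_smul, Finsupp.linearCombination_single]
      rw [← sq_eq_sq₀ (norm_nonneg _) (norm_nonneg _), ← @inner_self_eq_norm_sq ℂ,
        ← @inner_self_eq_norm_sq ℂ, e, Finsupp.linearCombination_apply]
      congr 1
      simp only [Finsupp.sum]
      rw [sum_inner, sum_inner]
      refine Finset.sum_congr rfl fun κ _ => ?_
      rw [inner_sum, inner_sum]
      refine Finset.sum_congr rfl fun ξ _ => ?_
      simp only [inner_smul_left, inner_smul_right, inner_coh]
      rw [← h κ ξ]
      ring)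

lemma unitary_coh (σ : Equiv.Perm (ZeroMeanLoop E)) (w : ZeroMeanLoop E → ℂˣ) (h) (ξ) :
    unitary σ w h (coh ξ) = (w ξ : ℂ) • coh (σ ξ) := by
  have := LinearEquiv.extendOfIsometry_eq (weightedPerm σ w) (Finsupp.linearCombination ℂ coh)
    (Finsupp.linearCombination ℂ coh) dense_span_coh dense_span_coh (by
      intro f
      have := (unitary σ w h).norm_map (Finsupp.linearCombination ℂ coh f)
      rwa [unitary, LinearEquiv.extendOfIsometry_eq] at this) (Finsupp.single ξ 1)
  simpa [unitary, weightedPerm] using this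

/-- The Weyl operator `e^κ ↦ z exp (- ½ ⟨ξ, ξ⟩ - ⟨κ, ξ⟩) e^{κ + ξ}`. -/
def weyl (ξ : ZeroMeanLoop E) (z : Circle) : Fock E ≃ₗᵢ[ℂ] Fock E :=
  unitary (Equiv.addRight ξ)
    (fun κ => Units.mk0 (z * Complex.exp (-(1 / 2) * herm ξ.1 ξ.1 - herm κ.1 ξ.1))
      (mul_ne_zero (Circle.coe_ne_zero z) (Complex.exp_ne_zero _)))
    (fun κ η => by
      have : CompleteSpace E := FiniteDimensional.complete ℝ E
      simp only [Units.val_mk0, map_mul, ← Complex.exp_conj, map_sub, map_neg, map_div₀, map_one,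
        map_ofNat, herm_conj, Equiv.coe_addRight, herm_add_left, herm_add_right]
      have hz : (starRingEnd ℂ) (z : ℂ) * z = 1 := by
        rw [mul_comm, Complex.mul_conj]; simp
      calc _ = ((starRingEnd ℂ) (z : ℂ) * z) *
          (Complex.exp (-(1 / 2) * herm ξ.1 ξ.1 - herm ξ.1 κ.1) *
          Complex.exp (-(1 / 2) * herm ξ.1 ξ.1 - herm η.1 ξ.1) *
          Complex.exp (herm η.1 κ.1 + herm ξ.1 κ.1 + (herm η.1 ξ.1 + herm ξ.1 ξ.1))) := by ring
        _ = _ := by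
          rw [hz, ← Complex.exp_add, ← Complex.exp_add, one_mul]
          congr 1
          ring)

lemma weyl_coh (ξ : ZeroMeanLoop E) (z : Circle) (κ : ZeroMeanLoop E) :
    weyl ξ z (coh κ) =
      (z * Complex.exp (-(1 / 2) * herm ξ.1 ξ.1 - herm κ.1 ξ.1) : ℂ) • coh (κ + ξ) :=
  unitary_coh _ _ _ _

/-- The rotation operator `e^κ ↦ e^{Φ_θ^* κ}`. -/
def rotate (θ : ℝ) : Fock E ≃ₗᵢ[ℂ] Fock E :=
  have : CompleteSpace E := FiniteDimensional.complete ℝ E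
  unitary (rotEquiv θ) (fun _ => 1) (fun κ ξ => by
    simp only [rotEquiv, Equiv.coe_fn_mk, herm_rot]
    simp)

lemma rotate_coh [CompleteSpace E] (θ : ℝ) (κ : ZeroMeanLoop E) :
    rotate θ (coh κ) = coh (rot θ κ) := by
  rw [rotate, unitary_coh, Units.val_one, one_smul]
  rfl

/-- `exp (2πi x)` as an element of the unit circle. -/
def _root_.circleExp (x : ℝ) : Circle := Circle.exp (2 * Real.pi * x)

lemma weyl_mul (ξ η : ZeroMeanLoop E) (z w : Circle) :
    weyl ξ z * weyl η w = weyl (ξ + η) (z * w * circleExp (sympl ξ.1 η.1)) := by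
  have : CompleteSpace E := FiniteDimensional.complete ℝ E
  refine ext_coh fun κ => ?_
  change weyl ξ z (weyl η w (coh κ)) = _
  rw [weyl_coh, map_smul, weyl_coh, weyl_coh, smul_smul, add_assoc,
    add_comm η ξ]
  congr 1
  have hS := herm_sub_herm ξ η
  have e : ((circleExp (sympl ξ.1 η.1) : Circle) : ℂ) =
      Complex.exp ((1 / 2) * (herm ξ.1 η.1 - herm η.1 ξ.1)) := by
    rw [hS, circleExp, Circle.coe_exp]
    congr 1
    push_cast
    ring
  rw [Circle.coe_mul, Circle.coe_mul, e]
  simp only [herm_add_left, herm_add_right]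
  calc _ = (z * w : ℂ) * (Complex.exp (-(1 / 2) * herm η.1 η.1 - herm κ.1 η.1) *
        Complex.exp (-(1 / 2) * herm ξ.1 ξ.1 - (herm κ.1 ξ.1 + herm η.1 ξ.1))) := by ring
    _ = (z * w : ℂ) * (Complex.exp ((1 / 2) * (herm ξ.1 η.1 - herm η.1 ξ.1)) *
        Complex.exp (-(1 / 2) * (herm ξ.1 ξ.1 + herm ξ.1 η.1 + (herm η.1 ξ.1 + herm η.1 η.1)) -
          (herm κ.1 ξ.1 + herm κ.1 η.1))) := by
      rw [← Complex.exp_add, ← Complex.exp_add]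
      congr 2
      ring
    _ = _ := by ring_nf

lemma weyl_zero_one : weyl (0 : ZeroMeanLoop E) 1 = 1 := by
  have : CompleteSpace E := FiniteDimensional.complete ℝ E
  refine ext_coh fun κ => ?_
  have h0 : ∀ κ : ZeroMeanLoop E, herm κ.1 (0 : ZeroMeanLoop E).1 = 0 := fun κ => by
    have := herm_add_right κ 0 0
    rw [add_zero] at this
    simpa using this
  rw [weyl_coh, h0, h0]
  simp

lemma rotate_mul (θ θ' : ℝ) : rotate (E := E) θ * rotate θ' = rotate (θ + θ') := by
  have : CompleteSpace E := FiniteDimensional.complete ℝ E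
  refine ext_coh fun κ => ?_
  change rotate θ (rotate θ' (coh κ)) = _
  rw [rotate_coh, rotate_coh, rotate_coh, rot_rot]

lemma rotate_zero : rotate (E := E) 0 = 1 := by
  have : CompleteSpace E := FiniteDimensional.complete ℝ E
  refine ext_coh fun κ => ?_
  rw [rotate_coh, rot_zero]
  rfl

lemma rotate_one : rotate (E := E) 1 = 1 := by
  have : CompleteSpace E := FiniteDimensional.complete ℝ E
  refine ext_coh fun κ => ?_
  rw [rotate_coh]
  have : rot 1 κ = κ := by
    ext t
    have := κ.2.2.1 (t - 1)
    simp only [sub_add_cancel] at this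
    exact this.symm
  rw [this]
  rfl

lemma rotate_weyl (θ : ℝ) [CompleteSpace E] (ξ : ZeroMeanLoop E) (z : Circle) :
    rotate θ * weyl ξ z = weyl (rot θ ξ) z * rotate θ := by
  refine ext_coh fun κ => ?_
  change rotate θ (weyl ξ z (coh κ)) = weyl (rot θ ξ) z (rotate θ (coh κ))
  rw [weyl_coh, map_smul, rotate_coh,
    rotate_coh, weyl_coh, herm_rot, herm_rot, rot_add_loop]

end Fock
end

noncomputable section

open scoped RealInnerProductSpace ContDiff

/-! ### Smooth gluing -/

namespace SmoothGlue

variable {E : Type*} [NormedAddCommGroup E] [NormedSpace ℝ E]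

lemma contDiffOn_glue_nat {a c b : ℝ} (hac : a < c) (hcb : c < b) (n : ℕ) : ∀ {f g : ℝ → E},
    ContDiffOn ℝ ∞ f (Set.Icc a c) → ContDiffOn ℝ ∞ g (Set.Icc c b) →
    (∀ k, iteratedDerivWithin k f (Set.Icc a c) c = iteratedDerivWithin k g (Set.Icc c b) c) →
    ContDiffOn ℝ n (fun t => if t ≤ c then f t else g t) (Set.Icc a b) := by
  have hab := hac.trans hcb
  have key : ∀ {f g : ℝ → E}, f c = g c →
      (∀ t ∈ Set.Icc a c, (fun t => if t ≤ c then f t else g t) t = f t) ∧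
      (∀ t ∈ Set.Icc c b, (fun t => if t ≤ c then f t else g t) t = g t) := by
    intro f g hfg
    refine ⟨fun t ht => if_pos ht.2, fun t ht => ?_⟩
    rcases ht.1.eq_or_lt with rfl | h
    · simp [hfg]
    · exact if_neg (not_le.2 h)
  have hU : Set.Icc a c ∪ Set.Icc c b = Set.Icc a b := Set.Icc_union_Icc_eq_Icc hac.le hcb.le
  induction n with
  | zero =>
    intro f g hf hg h
    have h0 : f c = g c := by simpa using h 0
    obtain ⟨k1, k2⟩ := key h0
    rw [Nat.cast_zero, contDiffOn_zero, ← hU]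
    exact (hf.continuousOn.congr k1).union_of_isClosed (hg.continuousOn.congr k2) isClosed_Icc
      isClosed_Icc
  | succ n ih =>
    intro f g hf hg h
    have h0 : f c = g c := by simpa using h 0
    obtain ⟨k1, k2⟩ := key h0
    have hf' := (contDiffOn_infty_iff_derivWithin (uniqueDiffOn_Icc hac)).1 hf
    have hg' := (contDiffOn_infty_iff_derivWithin (uniqueDiffOn_Icc hcb)).1 hg
    have h' : ∀ k, iteratedDerivWithin k (derivWithin f (Set.Icc a c)) (Set.Icc a c) c =
        iteratedDerivWithin k (derivWithin g (Set.Icc c b)) (Set.Icc c b) c := by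
      intro k
      have := h (k + 1)
      rwa [iteratedDerivWithin_succ', iteratedDerivWithin_succ'] at this
    have ih' := ih hf'.2 hg'.2 h'
    have h1 : derivWithin f (Set.Icc a c) c = derivWithin g (Set.Icc c b) c := by simpa using h' 0
    have hd : ∀ t ∈ Set.Icc a b, HasDerivWithinAt (fun t => if t ≤ c then f t else g t)
        (if t ≤ c then derivWithin f (Set.Icc a c) t else derivWithin g (Set.Icc c b) t)
        (Set.Icc a b) t := by
      intro t ht
      rcases lt_trichotomy t c with htc | rfl | htc
      · rw [if_pos htc.le]
        have m : t ∈ Set.Icc a c := ⟨ht.1, htc.le⟩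
        have := ((hf'.1 t m).hasDerivWithinAt).congr k1 (k1 t m)
        refine this.mono_of_mem_nhdsWithin ?_
        rw [mem_nhdsWithin]
        exact ⟨Set.Iio c, isOpen_Iio, htc, fun s hs => ⟨hs.2.1, le_of_lt hs.1⟩⟩
      · rw [if_pos le_rfl, ← hU]
        have m1 : t ∈ Set.Icc a t := ⟨hac.le, le_rfl⟩
        have m2 : t ∈ Set.Icc t b := ⟨le_rfl, hcb.le⟩
        refine (((hf'.1 t m1).hasDerivWithinAt).congr k1 (k1 t m1)).union ?_
        rw [h1]
        exact ((hg'.1 t m2).hasDerivWithinAt).congr k2 (k2 t m2)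
      · rw [if_neg (not_le.2 htc)]
        have m : t ∈ Set.Icc c b := ⟨htc.le, ht.2⟩
        have := ((hg'.1 t m).hasDerivWithinAt).congr k2 (k2 t m)
        refine this.mono_of_mem_nhdsWithin ?_
        rw [mem_nhdsWithin]
        exact ⟨Set.Ioi c, isOpen_Ioi, htc, fun s hs => ⟨le_of_lt hs.1, hs.2.2⟩⟩
    rw [Nat.cast_succ, contDiffOn_succ_iff_derivWithin (uniqueDiffOn_Icc hab)]
    refine ⟨fun t ht => (hd t ht).differentiableWithinAt, fun h => by simp at h, ?_⟩
    exact ih'.congr fun t ht => (hd t ht).derivWithin (uniqueDiffOn_Icc hab t ht)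

lemma contDiffOn_glue {a c b : ℝ} (hac : a < c) (hcb : c < b) {f g : ℝ → E}
    (hf : ContDiffOn ℝ ∞ f (Set.Icc a c)) (hg : ContDiffOn ℝ ∞ g (Set.Icc c b))
    (h : ∀ k, iteratedDerivWithin k f (Set.Icc a c) c = iteratedDerivWithin k g (Set.Icc c b) c) :
    ContDiffOn ℝ ∞ (fun t => if t ≤ c then f t else g t) (Set.Icc a b) :=
  contDiffOn_infty.2 fun n => contDiffOn_glue_nat hac hcb n hf hg h

open scoped Pointwise in
/-- Two smooth arcs on `[0, 1/2]` and `[1/2, 1]` whose values match at `1/2`, whose values at `1`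
and `0` differ by `δ`, and whose higher derivatives match at both ends, are the restrictions of a
smooth quasi-periodic function on the line. -/
lemma exists_quasiPeriodic {f g : ℝ → E} {δ : E}
    (hf : ContDiffOn ℝ ∞ f (Set.Icc 0 (1 / 2))) (hg : ContDiffOn ℝ ∞ g (Set.Icc (1 / 2) 1))
    (h0 : f (1 / 2) = g (1 / 2)) (h1 : g 1 = f 0 + δ)
    (hp : ∀ k, 1 ≤ k → iteratedDerivWithin k g (Set.Icc (1 / 2) 1) (1 / 2) =
      iteratedDerivWithin k f (Set.Icc 0 (1 / 2)) (1 / 2))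
    (hq : ∀ k, 1 ≤ k → iteratedDerivWithin k g (Set.Icc (1 / 2) 1) 1 =
      iteratedDerivWithin k f (Set.Icc 0 (1 / 2)) 0) :
    ∃ Ξ : ℝ → E, ContDiff ℝ ∞ Ξ ∧ (∀ t, Ξ (t + 1) = Ξ t + δ) ∧
      (∀ t ∈ Set.Icc (0 : ℝ) (1 / 2), Ξ t = f t) ∧ (∀ t ∈ Set.Icc (1 / 2 : ℝ) 1, Ξ t = g t) := by
  let u : ℝ → E := fun t => if t ≤ 1 / 2 then f t else g t
  let Ξ : ℝ → E := fun t => u (Int.fract t) + ⌊t⌋ • δ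
  have hu : ContDiffOn ℝ ∞ u (Set.Icc 0 1) := by
    refine contDiffOn_glue (by norm_num) (by norm_num) hf hg fun k => ?_
    rcases Nat.eq_zero_or_pos k with rfl | hk
    · simpa using h0
    · exact (hp k hk).symm
  have qp : ∀ t, Ξ (t + 1) = Ξ t + δ := by
    intro t
    simp only [Ξ, Int.fract_add_one, Int.floor_add_one, add_smul, one_smul, add_assoc]
  have e1 : ∀ t ∈ Set.Ico (0 : ℝ) 1, Ξ t = u t := by
    intro t ht
    simp only [Ξ]
    rw [Int.fract_eq_self.2 ht, Int.floor_eq_zero_iff.2 ht, zero_smul, add_zero]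
  have e2 : ∀ t ∈ Set.Icc (0 : ℝ) (1 / 2), Ξ t = f t := by
    intro t ht
    rw [e1 t ⟨ht.1, ht.2.trans_lt (by norm_num)⟩]
    exact if_pos ht.2
  have e3 : ∀ t ∈ Set.Icc (1 / 2 : ℝ) 1, Ξ t = g t := by
    intro t ht
    rcases ht.2.eq_or_lt with rfl | h
    · have := qp 0
      rw [zero_add] at this
      rw [this, e2 0 (by norm_num), h1]
    · rw [e1 t ⟨by linarith [ht.1], h⟩]
      rcases ht.1.eq_or_lt with rfl | h'
      · simp only [u]
        rw [if_pos le_rfl, h0]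
      · exact if_neg (not_le.2 h')
  refine ⟨Ξ, ?_, qp, e2, e3⟩
  have at0 : ContDiffAt ℝ ∞ Ξ 0 := by
    have hset : (1 : ℝ) +ᵥ Set.Icc (-(1 / 2) : ℝ) 0 = Set.Icc (1 / 2) 1 := by
      ext x
      rw [Set.mem_vadd_set_iff_neg_vadd_mem]
      simp only [vadd_eq_add, Set.mem_Icc]
      constructor <;> rintro ⟨h, h'⟩ <;> constructor <;> linarith
    have hg' : ContDiffOn ℝ ∞ (fun t => g (t + 1) - δ) (Set.Icc (-(1 / 2)) 0) := by
      refine ContDiffOn.sub (hg.comp (contDiff_id.add contDiff_const).contDiffOn fun t ht => ?_)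
        contDiffOn_const
      simp only [Set.mem_Icc] at ht ⊢
      constructor <;> linarith [ht.1, ht.2]
    have := contDiffOn_glue (a := -(1 / 2)) (c := 0) (b := 1 / 2) (by norm_num) (by norm_num) hg' hf
      (fun k => by
        rcases Nat.eq_zero_or_pos k with rfl | hk
        · simp [h1]
        · have m : (0 : ℝ) ∈ Set.Icc (-(1 / 2) : ℝ) 0 := by norm_num
          have hshift := congrFun (iteratedDerivWithin_comp_add_const (n := k) (f := g)
            (s := Set.Icc (-(1 / 2) : ℝ) 0) 1) 0
          rw [hset, zero_add, hq k hk] at hshift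
          rw [← hshift]
          obtain ⟨j, rfl⟩ : ∃ j, k = j + 1 := ⟨k - 1, by omega⟩
          rw [iteratedDerivWithin_succ', iteratedDerivWithin_succ']
          refine iteratedDerivWithin_congr (fun t _ => ?_) m
          rw [derivWithin_sub_const])
    have at0' := this.contDiffAt (x := 0) (Icc_mem_nhds (by norm_num) (by norm_num))
    refine at0'.congr_of_eventuallyEq ?_
    filter_upwards [Ioo_mem_nhds (a := -(1 / 2 : ℝ)) (b := 1 / 2) (by norm_num) (by norm_num)]
      with t ht
    rcases le_or_gt t 0 with h | h
    · rw [if_pos h, eq_sub_iff_add_eq, ← qp, e3]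
      constructor <;> linarith [ht.1]
    · rw [if_neg (not_le.2 h), e2 t ⟨h.le, ht.2.le⟩]
  have atI : ∀ t ∈ Set.Ico (0 : ℝ) 1, ContDiffAt ℝ ∞ Ξ t := by
    intro t ht
    rcases ht.1.eq_or_lt with rfl | h
    · exact at0
    · refine (hu.contDiffAt (Icc_mem_nhds h ht.2)).congr_of_eventuallyEq ?_
      filter_upwards [Ioo_mem_nhds h ht.2] with s hs using e1 s ⟨hs.1.le, hs.2⟩
  rw [contDiff_iff_contDiffAt]
  intro t
  have hz : ∀ (n : ℤ) t, Ξ (t + n) = Ξ t + n • δ := by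
    intro n t
    simp only [Ξ, Int.fract_add_intCast, Int.floor_add_intCast, add_smul, add_assoc]
  have h1 : Ξ = fun s => Ξ (s - ⌊t⌋) + ⌊t⌋ • δ := by
    funext s
    rw [← hz, sub_add_cancel]
  rw [h1]
  refine ContDiffAt.add ?_ contDiffAt_const
  have h2 := atI (Int.fract t) ⟨Int.fract_nonneg t, Int.fract_lt_one t⟩
  have h3 : ContDiffAt ℝ ∞ (fun s : ℝ => s - ⌊t⌋) t := contDiffAt_id.sub contDiffAt_const
  exact ContDiffAt.comp (g := Ξ) (f := fun s : ℝ => s - ⌊t⌋) t h2 h3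

lemma iteratedDerivWithin_equiv {F : Type*} [NormedAddCommGroup F] [NormedSpace ℝ F]
    (L : F ≃ₗᵢ[ℝ] E) (f : ℝ → F) (k : ℕ) {s : Set ℝ} (hs : UniqueDiffOn ℝ s) {x : ℝ}
    (hx : x ∈ s) :
    iteratedDerivWithin k (fun t => L (f t)) s x = L (iteratedDerivWithin k f s x) := by
  have := L.toContinuousLinearEquiv.iteratedFDerivWithin_comp_left f hs hx k
  simp only [iteratedDerivWithin]
  exact congrArg (fun m => m fun _ => (1 : ℝ)) this

end SmoothGlue
end

noncomputable section

open scoped RealInnerProductSpace ContDiff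

/-! ### Spans of lattices -/

/-- A span `Λw ← Γ → Λb` of positive definite even lattices of the same rank. The lattices are
given inside their real spans `𝔱w = Λw ⊗ ℝ`, `𝔥 = Γ ⊗ ℝ`, `𝔱b = Λb ⊗ ℝ`, the form being the inner
product; the injective, form preserving homomorphisms are given by their real extensions, which are
linear isometries because of the equality of ranks. (`Γ` is even because `Λw` is.) -/
structure LatticeSpan (𝔱w 𝔥 𝔱b : Type*)
    [NormedAddCommGroup 𝔱w] [InnerProductSpace ℝ 𝔱w]
    [NormedAddCommGroup 𝔥] [InnerProductSpace ℝ 𝔥]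
    [NormedAddCommGroup 𝔱b] [InnerProductSpace ℝ 𝔱b] where
  Λw : Submodule ℤ 𝔱w
  Γ : Submodule ℤ 𝔥
  Λb : Submodule ℤ 𝔱b
  discrete_w : DiscreteTopology Λw
  discrete_Γ : DiscreteTopology Γ
  discrete_b : DiscreteTopology Λb
  span_w : Submodule.span ℝ (Λw : Set 𝔱w) = ⊤
  span_Γ : Submodule.span ℝ (Γ : Set 𝔥) = ⊤
  span_b : Submodule.span ℝ (Λb : Set 𝔱b) = ⊤
  even_w : ∀ x ∈ Λw, ∃ k : ℤ, ⟪x, x⟫ = 2 * k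
  even_b : ∀ x ∈ Λb, ∃ k : ℤ, ⟪x, x⟫ = 2 * k
  πw : 𝔥 ≃ₗᵢ[ℝ] 𝔱w
  πb : 𝔥 ≃ₗᵢ[ℝ] 𝔱b
  map_w : ∀ x ∈ Γ, πw x ∈ Λw
  map_b : ∀ x ∈ Γ, πb x ∈ Λb

namespace LatticeSpan

variable {𝔱w 𝔥 𝔱b : Type*}
  [NormedAddCommGroup 𝔱w] [InnerProductSpace ℝ 𝔱w]
  [NormedAddCommGroup 𝔥] [InnerProductSpace ℝ 𝔥]
  [NormedAddCommGroup 𝔱b] [InnerProductSpace ℝ 𝔱b]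
  (D : LatticeSpan 𝔱w 𝔥 𝔱b)

/-- The torus `T_w = Λw ⊗ 𝕋 = 𝔱w / Λw`. -/
abbrev Tw := 𝔱w ⧸ D.Λw.toAddSubgroup

/-- The torus `H = Γ ⊗ 𝕋 = 𝔥 / Γ`. -/
abbrev H := 𝔥 ⧸ D.Γ.toAddSubgroup

/-- The torus `T_b = Λb ⊗ 𝕋 = 𝔱b / Λb`. -/
abbrev Tb := 𝔱b ⧸ D.Λb.toAddSubgroup

/-- The exponential map of the torus `T_w`. -/
def expW : 𝔱w →+ D.Tw := QuotientAddGroup.mk' _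

/-- The exponential map of the torus `H`. -/
def expH : 𝔥 →+ D.H := QuotientAddGroup.mk' _

/-- The exponential map of the torus `T_b`. -/
def expB : 𝔱b →+ D.Tb := QuotientAddGroup.mk' _

/-- The homomorphism of tori `H → T_w` induced by `Γ → Λw`. -/
def torusMapW : D.H →+ D.Tw :=
  QuotientAddGroup.map _ _ (D.πw.toLinearEquiv.toLinearMap.toAddMonoidHom) D.map_w

/-- The homomorphism of tori `H → T_b` induced by `Γ → Λb`. -/
def torusMapB : D.H →+ D.Tb :=
  QuotientAddGroup.map _ _ (D.πb.toLinearEquiv.toLinearMap.toAddMonoidHom) D.map_b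

@[simp] lemma torusMapW_expH (x : 𝔥) : D.torusMapW (D.expH x) = D.expW (D.πw x) := rfl

@[simp] lemma torusMapB_expH (x : 𝔥) : D.torusMapB (D.expH x) = D.expB (D.πb x) := rfl

/-- `Λw` pulled back to `𝔥`. -/
def latW : AddSubgroup 𝔥 :=
  D.Λw.toAddSubgroup.comap D.πw.toLinearEquiv.toLinearMap.toAddMonoidHom

/-- `Λb` pulled back to `𝔥`. -/
def latB : AddSubgroup 𝔥 :=
  D.Λb.toAddSubgroup.comap D.πb.toLinearEquiv.toLinearMap.toAddMonoidHom

lemma mem_latW {x : 𝔥} : x ∈ D.latW ↔ D.πw x ∈ D.Λw := Iff.rfl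

lemma mem_latB {x : 𝔥} : x ∈ D.latB ↔ D.πb x ∈ D.Λb := Iff.rfl

/-- The intersection `Λw ∩ Λb` inside `𝔥`. -/
def inter : AddSubgroup 𝔥 := D.latW ⊓ D.latB

/-- The group `Λw - Λb` of differences inside `𝔥`. -/
def diff : AddSubgroup 𝔥 where
  carrier := {x | ∃ a ∈ D.latW, ∃ b ∈ D.latB, x = a - b}
  add_mem' := by
    rintro _ _ ⟨a, ha, b, hb, rfl⟩ ⟨a', ha', b', hb', rfl⟩
    exact ⟨a + a', add_mem ha ha', b + b', add_mem hb hb', by abel⟩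
  zero_mem' := ⟨0, zero_mem _, 0, zero_mem _, by simp⟩
  neg_mem' := by
    rintro _ ⟨a, ha, b, hb, rfl⟩
    exact ⟨-a, neg_mem ha, -b, neg_mem hb, by abel⟩

/-- The dual lattice `Γ^∨`; its element `l` is the character `exp_H x ↦ exp (2πi ⟨l, x⟩)` of
`H`. -/
def dual : AddSubgroup 𝔥 where
  carrier := {x | ∀ g ∈ D.Γ, ∃ k : ℤ, ⟪x, g⟫ = k}
  add_mem' := by
    intro x y hx hy g hg
    obtain ⟨k, hk⟩ := hx g hg
    obtain ⟨j, hj⟩ := hy g hg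
    exact ⟨k + j, by rw [inner_add_left, hk, hj]; push_cast; rfl⟩
  zero_mem' := fun g _ => ⟨0, by simp⟩
  neg_mem' := by
    intro x hx g hg
    obtain ⟨k, hk⟩ := hx g hg
    exact ⟨-k, by rw [inner_neg_left, hk]; push_cast; rfl⟩

lemma integral_of_even {V : Type*} [NormedAddCommGroup V] [InnerProductSpace ℝ V]
    {Λ : Submodule ℤ V} (h : ∀ x ∈ Λ, ∃ k : ℤ, ⟪x, x⟫ = 2 * k) {x y : V} (hx : x ∈ Λ)
    (hy : y ∈ Λ) : ∃ k : ℤ, ⟪x, y⟫ = k := by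
  obtain ⟨a, ha⟩ := h _ hx
  obtain ⟨b, hb⟩ := h _ hy
  obtain ⟨c, hc⟩ := h _ (Λ.add_mem hx hy)
  refine ⟨c - a - b, ?_⟩
  rw [real_inner_add_add_self, ha, hb] at hc
  push_cast
  linarith

lemma integral_latW {x y : 𝔥} (hx : x ∈ D.latW) (hy : y ∈ D.latW) : ∃ k : ℤ, ⟪x, y⟫ = k := by
  rw [← D.πw.inner_map_map]
  exact integral_of_even D.even_w hx hy

lemma integral_latB {x y : 𝔥} (hx : x ∈ D.latB) (hy : y ∈ D.latB) : ∃ k : ℤ, ⟪x, y⟫ = k := by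
  rw [← D.πb.inner_map_map]
  exact integral_of_even D.even_b hx hy

lemma even_latW {x : 𝔥} (hx : x ∈ D.latW) : ∃ k : ℤ, ⟪x, x⟫ = 2 * k := by
  rw [← D.πw.inner_map_map]
  exact D.even_w _ hx

lemma even_latB {x : 𝔥} (hx : x ∈ D.latB) : ∃ k : ℤ, ⟪x, x⟫ = 2 * k := by
  rw [← D.πb.inner_map_map]
  exact D.even_b _ hx

lemma diff_le_dual : D.diff ≤ D.dual := by
  rintro _ ⟨a, ha, b, hb, rfl⟩ g hg
  obtain ⟨k, hk⟩ := D.integral_latW ha (D.map_w g hg : g ∈ D.latW)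
  obtain ⟨j, hj⟩ := D.integral_latB hb (D.map_b g hg : g ∈ D.latB)
  exact ⟨k - j, by rw [inner_sub_left, hk, hj]; push_cast; rfl⟩

/-- The element `λ ∈ Λw - Λb` as a character of `H`. -/
def toDual : D.diff →+ D.dual := AddSubgroup.inclusion D.diff_le_dual

/-- The subgroup `(Λw ∩ Λb) / Γ` of `H`. -/
def interTorus : AddSubgroup D.H := D.inter.map D.expH

/-- The smallest positive integer `n` such that `n (Λw - Λb) ⊆ Γ`. -/
def torsionIndex : ℕ := sInf {n : ℕ | 0 < n ∧ ∀ x ∈ D.diff, n • x ∈ D.Γ}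

lemma nsmul_mem_of_torsionIndex_dvd {m : ℕ} (hm : 0 < m) (h : D.torsionIndex ∣ m) {x : 𝔥}
    (hx : x ∈ D.diff) : m • x ∈ D.Γ := by
  have hne : {n : ℕ | 0 < n ∧ ∀ x ∈ D.diff, n • x ∈ D.Γ}.Nonempty := by
    by_contra hcon
    rw [Set.not_nonempty_iff_eq_empty] at hcon
    rw [torsionIndex, hcon, Nat.sInf_empty, zero_dvd_iff] at h
    omega
  obtain ⟨k, rfl⟩ := h
  have h3 : D.torsionIndex • x ∈ D.Γ := (Nat.sInf_mem hne).2 x hx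
  rw [mul_comm, mul_smul]
  exact nsmul_mem h3 k

/-- If `m λ ∈ Γ` then `m ⟨λ, λ⟩` is even. -/
lemma even_of_nsmul_mem {m : ℕ} {x : 𝔥} (hx : x ∈ D.diff) (h : m • x ∈ D.Γ) :
    ∃ k : ℤ, m * ⟪x, x⟫ = 2 * k := by
  obtain ⟨a, ha, b, hb, rfl⟩ := hx
  obtain ⟨i, hi⟩ := D.even_latW ha
  obtain ⟨j, hj⟩ := D.even_latB hb
  obtain ⟨k, hk⟩ := D.integral_latB (D.map_b _ h : m • (a - b) ∈ D.latB) hb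
  refine ⟨m * i + m * j - (k + 2 * m * j), ?_⟩
  rw [← Nat.cast_smul_eq_nsmul ℝ, real_inner_smul_left, inner_sub_left, hj] at hk
  rw [inner_sub_left, inner_sub_right, inner_sub_right, hi, hj, real_inner_comm a b]
  rw [real_inner_comm] at hk
  push_cast
  rw [real_inner_comm] at hk
  linarith [real_inner_comm a b]

end LatticeSpan
end

noncomputable section

open scoped RealInnerProductSpace ContDiff

namespace LatticeSpan

variable {𝔱w 𝔥 𝔱b : Type*}
  [NormedAddCommGroup 𝔱w] [InnerProductSpace ℝ 𝔱w]
  [NormedAddCommGroup 𝔥] [InnerProductSpace ℝ 𝔥]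
  [NormedAddCommGroup 𝔱b] [InnerProductSpace ℝ 𝔱b]
  (D : LatticeSpan 𝔱w 𝔥 𝔱b)

/-! ### The bicoloured torus loop group

The circle is parametrised by `[0, 1]` with base point `q` at `0` and `1`; the black half is
`[0, 1/2]`, running from `q` to `p`, and the white half is `[1/2, 1]`, running from `p` to `q`. -/

/-- Triples `(γ_w, (γ_m(p), γ_m(q)), γ_b)` of maps from the white half, the two defects and the
black half of the circle to the tori. -/
abbrev Triples := (Set.Icc (1 / 2 : ℝ) 1 → D.Tw) × (D.H × D.H) × (Set.Icc (0 : ℝ) (1 / 2) → D.Tb)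

/-- The bicoloured loop group `L(T_w, H, T_b)`: triples with `γ_w`, `γ_b` smooth (that is,
projections of smooth paths `ξ_w`, `ξ_b` in `𝔱w`, `𝔱b`; such lifts are unique up to constants),
whose values match `γ_m` at `p` and `q`, and all of whose derivatives of order at least one, which
are those of `ξ_w`, `ξ_b`, match at `p` and at `q` as elements of `𝔥`. -/
def loopGroup : AddSubgroup D.Triples where
  carrier := {γ | ∃ (ξw : ℝ → 𝔱w) (ξb : ℝ → 𝔱b),
    ContDiffOn ℝ ∞ ξw (Set.Icc (1 / 2) 1) ∧ ContDiffOn ℝ ∞ ξb (Set.Icc 0 (1 / 2)) ∧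
    (∀ t, γ.1 t = D.expW (ξw t)) ∧ (∀ t, γ.2.2 t = D.expB (ξb t)) ∧
    D.torusMapW γ.2.1.1 = D.expW (ξw (1 / 2)) ∧ D.torusMapW γ.2.1.2 = D.expW (ξw 1) ∧
    D.torusMapB γ.2.1.1 = D.expB (ξb (1 / 2)) ∧ D.torusMapB γ.2.1.2 = D.expB (ξb 0) ∧
    (∀ k, 1 ≤ k →
      D.πw.symm (iteratedDerivWithin k ξw (Set.Icc (1 / 2) 1) (1 / 2)) =
      D.πb.symm (iteratedDerivWithin k ξb (Set.Icc 0 (1 / 2)) (1 / 2))) ∧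
    (∀ k, 1 ≤ k →
      D.πw.symm (iteratedDerivWithin k ξw (Set.Icc (1 / 2) 1) 1) =
      D.πb.symm (iteratedDerivWithin k ξb (Set.Icc 0 (1 / 2)) 0))}
  add_mem' := by
    rintro γ ρ ⟨ξw, ξb, h1, h2, h3, h4, h5, h6, h7, h8, h9, h10⟩
      ⟨ηw, ηb, k1, k2, k3, k4, k5, k6, k7, k8, k9, k10⟩
    have Uw : UniqueDiffOn ℝ (Set.Icc (1 / 2 : ℝ) 1) := uniqueDiffOn_Icc (by norm_num)
    have Ub : UniqueDiffOn ℝ (Set.Icc (0 : ℝ) (1 / 2)) := uniqueDiffOn_Icc (by norm_num)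
    have aw : ∀ (k : ℕ) t, t ∈ Set.Icc (1 / 2 : ℝ) 1 →
        iteratedDerivWithin k (ξw + ηw) (Set.Icc (1 / 2) 1) t =
        iteratedDerivWithin k ξw (Set.Icc (1 / 2) 1) t +
        iteratedDerivWithin k ηw (Set.Icc (1 / 2) 1) t := fun k t ht =>
      iteratedDerivWithin_add ht Uw ((h1.of_le (by exact_mod_cast le_top)) t ht)
        ((k1.of_le (by exact_mod_cast le_top)) t ht)
    have ab : ∀ (k : ℕ) t, t ∈ Set.Icc (0 : ℝ) (1 / 2) →
        iteratedDerivWithin k (ξb + ηb) (Set.Icc 0 (1 / 2)) t =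
        iteratedDerivWithin k ξb (Set.Icc 0 (1 / 2)) t +
        iteratedDerivWithin k ηb (Set.Icc 0 (1 / 2)) t := fun k t ht =>
      iteratedDerivWithin_add ht Ub ((h2.of_le (by exact_mod_cast le_top)) t ht)
        ((k2.of_le (by exact_mod_cast le_top)) t ht)
    refine ⟨ξw + ηw, ξb + ηb, h1.add k1, h2.add k2, fun t => ?_, fun t => ?_, ?_, ?_, ?_, ?_,
      fun k hk => ?_, fun k hk => ?_⟩
    · simp [h3, k3]
    · simp [h4, k4]
    · simp only [Prod.fst_add, Prod.snd_add, map_add, h5, k5, Pi.add_apply]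
    · simp only [Prod.fst_add, Prod.snd_add, map_add, h6, k6, Pi.add_apply]
    · simp only [Prod.fst_add, Prod.snd_add, map_add, h7, k7, Pi.add_apply]
    · simp only [Prod.fst_add, Prod.snd_add, map_add, h8, k8, Pi.add_apply]
    · rw [aw k _ (by norm_num), ab k _ (by norm_num), map_add, map_add, h9 k hk, k9 k hk]
    · rw [aw k _ (by norm_num), ab k _ (by norm_num), map_add, map_add, h10 k hk, k10 k hk]
  zero_mem' := by
    refine ⟨0, 0, contDiffOn_const, contDiffOn_const, fun _ => ?_, fun _ => ?_, ?_, ?_, ?_, ?_,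
      fun k hk => ?_, fun k hk => ?_⟩
    · simp
    · simp
    · simp
    · simp
    · simp
    · simp
    · simp [iteratedDerivWithin]
    · simp [iteratedDerivWithin]
  neg_mem' := by
    rintro γ ⟨ξw, ξb, h1, h2, h3, h4, h5, h6, h7, h8, h9, h10⟩
    refine ⟨-ξw, -ξb, h1.neg, h2.neg, fun t => ?_, fun t => ?_, ?_, ?_, ?_, ?_,
      fun k hk => ?_, fun k hk => ?_⟩
    · simp [h3]
    · simp [h4]
    · simp only [Prod.fst_neg, Prod.snd_neg, map_neg, h5, Pi.neg_apply]
    · simp only [Prod.fst_neg, Prod.snd_neg, map_neg, h6, Pi.neg_apply]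
    · simp only [Prod.fst_neg, Prod.snd_neg, map_neg, h7, Pi.neg_apply]
    · simp only [Prod.fst_neg, Prod.snd_neg, map_neg, h8, Pi.neg_apply]
    · rw [iteratedDerivWithin_neg, iteratedDerivWithin_neg, map_neg, map_neg, h9 k hk]
    · rw [iteratedDerivWithin_neg, iteratedDerivWithin_neg, map_neg, map_neg, h10 k hk]

/-- Smooth quasi-periodic functions `Ξ : ℝ → 𝔥`, with `Ξ (t + 1) = Ξ t + δ` for some
`δ ∈ Λw - Λb`. -/
def quasiPeriodic : AddSubgroup (ℝ → 𝔥) where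
  carrier := {Ξ | ContDiff ℝ ∞ Ξ ∧ ∃ δ ∈ D.diff, ∀ t, Ξ (t + 1) = Ξ t + δ}
  add_mem' := by
    rintro Ξ Η ⟨h, δ, hδ, e⟩ ⟨h', δ', hδ', e'⟩
    exact ⟨h.add h', δ + δ', add_mem hδ hδ', fun t => by simp only [Pi.add_apply, e, e']; abel⟩
  zero_mem' := ⟨contDiff_const, 0, zero_mem _, fun t => by simp⟩
  neg_mem' := by
    rintro Ξ ⟨h, δ, hδ, e⟩
    exact ⟨h.neg, -δ, neg_mem hδ, fun t => by simp only [Pi.neg_apply, e]; abel⟩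

/-- The winding `Ξ(1) - Ξ(0)`. -/
def winding (Ξ : ℝ → 𝔥) : 𝔥 := Ξ 1 - Ξ 0

variable {D}

lemma apply_add_one {Ξ : ℝ → 𝔥} (h : Ξ ∈ D.quasiPeriodic) (t : ℝ) :
    Ξ (t + 1) = Ξ t + winding Ξ := by
  obtain ⟨-, δ, -, e⟩ := h
  have := e 0
  rw [zero_add] at this
  rw [winding, this, add_sub_cancel_left, e]

lemma winding_mem {Ξ : ℝ → 𝔥} (h : Ξ ∈ D.quasiPeriodic) : winding Ξ ∈ D.diff := by
  obtain ⟨-, δ, hδ, e⟩ := h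
  have := e 0
  rw [zero_add] at this
  rwa [winding, this, add_sub_cancel_left]

lemma apply_add_nat {Ξ : ℝ → 𝔥} (h : Ξ ∈ D.quasiPeriodic) (n : ℕ) (t : ℝ) :
    Ξ (t + n) = Ξ t + n • winding Ξ := by
  induction n with
  | zero => simp
  | succ n ih => rw [Nat.cast_succ, ← add_assoc, apply_add_one h, ih, succ_nsmul, add_assoc]

lemma const_mem (x : 𝔥) : (fun _ => x) ∈ D.quasiPeriodic :=
  ⟨contDiff_const, 0, zero_mem _, fun _ => by simp⟩

/-- Rotation by `θ`: `(Φ_θ^* Ξ)(t) = Ξ (t - θ)`. -/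
lemma shift_mem {Ξ : ℝ → 𝔥} (h : Ξ ∈ D.quasiPeriodic) (θ : ℝ) :
    (fun t => Ξ (t - θ)) ∈ D.quasiPeriodic := by
  refine ⟨h.1.comp (contDiff_id.sub contDiff_const), winding Ξ, winding_mem h, fun t => ?_⟩
  change Ξ (t + 1 - θ) = _
  rw [show t + 1 - θ = t - θ + 1 by ring, apply_add_one h]

lemma winding_shift {Ξ : ℝ → 𝔥} (h : Ξ ∈ D.quasiPeriodic) (θ : ℝ) :
    winding (fun t => Ξ (t - θ)) = winding Ξ := by
  have := apply_add_one h (0 - θ)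
  rw [show 0 - θ + 1 = 1 - θ by ring] at this
  rw [winding, this, add_sub_cancel_left]

variable (D)

/-- `Ξ` is the (quasi-periodic extension of a) glued lift of the triple `γ`: it lifts the white half
and the black half, and it lifts the value `γ_m(p)`. So `exp_H ∘ Ξ`, which is the path in `H` that
is obtained by lifting `γ_w` and `γ_b` to `H` starting from `γ_m(p)`, represents `Pth γ`. -/
def IsGluedLift (γ : D.Triples) (Ξ : ℝ → 𝔥) : Prop :=
  Ξ ∈ D.quasiPeriodic ∧ (∀ t, γ.1 t = D.expW (D.πw (Ξ t))) ∧
    (∀ t, γ.2.2 t = D.expB (D.πb (Ξ t))) ∧ γ.2.1.1 = D.expH (Ξ (1 / 2))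

lemma expW_eq_zero {x : 𝔥} : D.expW (D.πw x) = 0 ↔ x ∈ D.latW :=
  QuotientAddGroup.eq_zero_iff _

lemma expB_eq_zero {x : 𝔥} : D.expB (D.πb x) = 0 ↔ x ∈ D.latB :=
  QuotientAddGroup.eq_zero_iff _

lemma expH_eq_zero {x : 𝔥} : D.expH x = 0 ↔ x ∈ D.Γ :=
  QuotientAddGroup.eq_zero_iff _

lemma exists_isGluedLift (γ : D.loopGroup) : ∃ Ξ, D.IsGluedLift γ.1 Ξ := by
  obtain ⟨γ, ξw, ξb, h1, h2, h3, h4, h5, h6, h7, h8, h9, h10⟩ := γ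
  obtain ⟨x, hx⟩ := QuotientAddGroup.mk'_surjective _ γ.2.1.1
  obtain ⟨y, hy⟩ := QuotientAddGroup.mk'_surjective _ γ.2.1.2
  change D.expH x = _ at hx
  change D.expH y = _ at hy
  let f : ℝ → 𝔥 := fun t => D.πb.symm (ξb t) - D.πb.symm (ξb (1 / 2)) + x
  let g : ℝ → 𝔥 := fun t => D.πw.symm (ξw t) - D.πw.symm (ξw (1 / 2)) + x
  have ew : ∀ t, D.expW (D.πw (g t)) = D.expW (ξw t) := fun t => by
    simp only [g, map_add, map_sub, LinearIsometryEquiv.apply_symm_apply]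
    rw [← h5, ← hx, torusMapW_expH, sub_add_cancel]
  have eb : ∀ t, D.expB (D.πb (f t)) = D.expB (ξb t) := fun t => by
    simp only [f, map_add, map_sub, LinearIsometryEquiv.apply_symm_apply]
    rw [← h7, ← hx, torusMapB_expH, sub_add_cancel]
  have dw : g 1 - y ∈ D.latW := by
    rw [← D.expW_eq_zero, map_sub, map_sub, ew, ← h6, ← hy, torusMapW_expH, sub_self]
  have db : f 0 - y ∈ D.latB := by
    rw [← D.expB_eq_zero, map_sub, map_sub, eb, ← h8, ← hy, torusMapB_expH, sub_self]
  have Uw : UniqueDiffOn ℝ (Set.Icc (1 / 2 : ℝ) 1) := uniqueDiffOn_Icc (by norm_num)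
  have Ub : UniqueDiffOn ℝ (Set.Icc (0 : ℝ) (1 / 2)) := uniqueDiffOn_Icc (by norm_num)
  have gd : ∀ k, 1 ≤ k → ∀ t ∈ Set.Icc (1 / 2 : ℝ) 1,
      iteratedDerivWithin k g (Set.Icc (1 / 2) 1) t =
      D.πw.symm (iteratedDerivWithin k ξw (Set.Icc (1 / 2) 1) t) := by
    intro k hk t ht
    rw [← SmoothGlue.iteratedDerivWithin_equiv _ _ _ Uw ht]
    obtain ⟨j, rfl⟩ : ∃ j, k = j + 1 := ⟨k - 1, by omega⟩
    rw [iteratedDerivWithin_succ', iteratedDerivWithin_succ']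
    refine iteratedDerivWithin_congr (fun s _ => ?_) ht
    rw [derivWithin_add_const, derivWithin_sub_const]
  have fd : ∀ k, 1 ≤ k → ∀ t ∈ Set.Icc (0 : ℝ) (1 / 2),
      iteratedDerivWithin k f (Set.Icc 0 (1 / 2)) t =
      D.πb.symm (iteratedDerivWithin k ξb (Set.Icc 0 (1 / 2)) t) := by
    intro k hk t ht
    rw [← SmoothGlue.iteratedDerivWithin_equiv _ _ _ Ub ht]
    obtain ⟨j, rfl⟩ : ∃ j, k = j + 1 := ⟨k - 1, by omega⟩
    rw [iteratedDerivWithin_succ', iteratedDerivWithin_succ']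
    refine iteratedDerivWithin_congr (fun s _ => ?_) ht
    rw [derivWithin_add_const, derivWithin_sub_const]
  obtain ⟨Ξ, hΞ, hq, hf, hg⟩ := SmoothGlue.exists_quasiPeriodic (f := f) (g := g)
    (δ := g 1 - f 0)
    (((D.πb.symm.toContinuousLinearEquiv.contDiff.comp_contDiffOn h2).sub
      contDiffOn_const).add contDiffOn_const)
    (((D.πw.symm.toContinuousLinearEquiv.contDiff.comp_contDiffOn h1).sub
      contDiffOn_const).add contDiffOn_const)
    (by simp [f, g]) (by abel)
    (fun k hk => by rw [gd k hk _ (by norm_num), fd k hk _ (by norm_num), h9 k hk])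
    (fun k hk => by rw [gd k hk _ (by norm_num), fd k hk _ (by norm_num), h10 k hk])
  refine ⟨Ξ, ⟨hΞ, g 1 - f 0, ⟨g 1 - y, dw, f 0 - y, db, by abel⟩, hq⟩, fun t => ?_, fun t => ?_, ?_⟩
  · rw [hg _ t.2, ew, h3]
  · rw [hf _ t.2, eb, h4]
  · rw [hf _ (by norm_num), ← hx]
    simp [f]

lemma const_of_discrete {V : Type*} [NormedAddCommGroup V] {Λ : AddSubgroup V}
    (hΛ : DiscreteTopology Λ) {f : ℝ → V} (hf : Continuous f) {a b : ℝ}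
    (h : ∀ t ∈ Set.Icc a b, f t ∈ Λ) {s t : ℝ} (hs : s ∈ Set.Icc a b) (ht : t ∈ Set.Icc a b) :
    f s = f t := by
  let F : Set.Icc a b → Λ := fun u => ⟨f u, h u u.2⟩
  have hF : Continuous F := (hf.comp continuous_subtype_val).subtype_mk _
  have : PreconnectedSpace (Set.Icc a b) := isPreconnected_iff_preconnectedSpace.1 isPreconnected_Icc
  exact congrArg Subtype.val (PreconnectedSpace.constant this hF (x := ⟨s, hs⟩) (y := ⟨t, ht⟩))

variable {D}

/-- Glued lifts are unique up to a constant in `Γ`. -/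
lemma IsGluedLift.unique {γ : D.Triples} {Ξ Η : ℝ → 𝔥} (h : D.IsGluedLift γ Ξ)
    (h' : D.IsGluedLift γ Η) : ∃ g ∈ D.Γ, Ξ = Η + fun _ => g := by
  obtain ⟨q, w, b, m⟩ := h
  obtain ⟨q', w', b', m'⟩ := h'
  have hd : Ξ - Η ∈ D.quasiPeriodic := sub_mem q q'
  have hw : ∀ t ∈ Set.Icc (1 / 2 : ℝ) 1, D.πw ((Ξ - Η) t) ∈ D.Λw.toAddSubgroup := fun t ht => by
    change (Ξ - Η) t ∈ D.latW
    rw [← D.expW_eq_zero, Pi.sub_apply, map_sub, map_sub, ← w ⟨t, ht⟩, ← w' ⟨t, ht⟩, sub_self]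
  have hb : ∀ t ∈ Set.Icc (0 : ℝ) (1 / 2), D.πb ((Ξ - Η) t) ∈ D.Λb.toAddSubgroup := fun t ht => by
    change (Ξ - Η) t ∈ D.latB
    rw [← D.expB_eq_zero, Pi.sub_apply, map_sub, map_sub, ← b ⟨t, ht⟩, ← b' ⟨t, ht⟩, sub_self]
  have hm : (Ξ - Η) (1 / 2) ∈ D.Γ := by
    rw [← D.expH_eq_zero, Pi.sub_apply, map_sub, ← m, ← m', sub_self]
  have hc := hd.1.continuous
  have cw : ∀ t ∈ Set.Icc (1 / 2 : ℝ) 1, (Ξ - Η) t = (Ξ - Η) (1 / 2) := fun t ht =>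
    D.πw.injective (const_of_discrete D.discrete_w (D.πw.continuous.comp hc) hw ht (by norm_num))
  have cb : ∀ t ∈ Set.Icc (0 : ℝ) (1 / 2), (Ξ - Η) t = (Ξ - Η) (1 / 2) := fun t ht =>
    D.πb.injective (const_of_discrete D.discrete_b (D.πb.continuous.comp hc) hb ht (by norm_num))
  have hw0 : winding (Ξ - Η) = 0 := by
    rw [winding, cw 1 (by norm_num), cb 0 (by norm_num), sub_self]
  have hp : Function.Periodic (Ξ - Η) 1 := fun t => by rw [apply_add_one hd, hw0, add_zero]
  refine ⟨_, hm, ?_⟩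
  funext t
  have : (Ξ - Η) t = (Ξ - Η) (1 / 2) := by
    have e : (Ξ - Η) t = (Ξ - Η) (Int.fract t) := by
      have := hp.sub_int_mul_eq (x := t) ⌊t⌋
      rw [mul_one] at this
      rw [← this]
      rfl
    rw [e]
    have h0 := Int.fract_nonneg t
    have h1 := Int.fract_lt_one t
    rcases le_total (Int.fract t) (1 / 2) with h | h
    · exact cb _ ⟨h0, h⟩
    · exact cw _ ⟨h, h1.le⟩
  rw [Pi.add_apply, ← this]
  simp

lemma IsGluedLift.add {γ ρ : D.Triples} {Ξ Η : ℝ → 𝔥} (h : D.IsGluedLift γ Ξ)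
    (h' : D.IsGluedLift ρ Η) : D.IsGluedLift (γ + ρ) (Ξ + Η) := by
  obtain ⟨q, w, b, m⟩ := h
  obtain ⟨q', w', b', m'⟩ := h'
  refine ⟨add_mem q q', fun t => ?_, fun t => ?_, ?_⟩
  · simp [w, w']
  · simp [b, b']
  · simp only [Prod.snd_add, Prod.fst_add, Pi.add_apply, map_add, m, m']

lemma isGluedLift_zero : D.IsGluedLift 0 0 :=
  ⟨zero_mem _, fun t => by simp, fun t => by simp, by simp⟩

/-- A chosen glued lift of an element of the loop group. -/
def gluedLift (γ : D.loopGroup) : ℝ → 𝔥 := (D.exists_isGluedLift γ).choose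

lemma isGluedLift (γ : D.loopGroup) : D.IsGluedLift γ.1 (gluedLift γ) :=
  (D.exists_isGluedLift γ).choose_spec

lemma gluedLift_mem (γ : D.loopGroup) : gluedLift γ ∈ D.quasiPeriodic := (isGluedLift γ).1

lemma gluedLift_add (γ ρ : D.loopGroup) :
    ∃ g ∈ D.Γ, gluedLift (γ + ρ) = gluedLift γ + gluedLift ρ + fun _ => g :=
  (isGluedLift (γ + ρ)).unique ((isGluedLift γ).add (isGluedLift ρ))

lemma gluedLift_zero : ∃ g ∈ D.Γ, gluedLift (0 : D.loopGroup) = fun _ => g := by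
  obtain ⟨g, hg, e⟩ := (isGluedLift (0 : D.loopGroup)).unique isGluedLift_zero
  exact ⟨g, hg, by rw [e, zero_add]⟩

/-- The path `Pth γ` in `H`, extended quasi-periodically to the line. -/
def pth (γ : D.loopGroup) (t : ℝ) : D.H := D.expH (gluedLift γ t)

lemma IsGluedLift.pth_eq {γ : D.loopGroup} {Ξ : ℝ → 𝔥} (h : D.IsGluedLift γ.1 Ξ) (t : ℝ) :
    pth γ t = D.expH (Ξ t) := by
  obtain ⟨g, hg, e⟩ := (isGluedLift γ).unique h
  rw [pth, e, Pi.add_apply, map_add, D.expH_eq_zero.2 hg, add_zero]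

lemma pth_add (γ ρ : D.loopGroup) (t : ℝ) : pth (γ + ρ) t = pth γ t + pth ρ t := by
  have h : D.IsGluedLift (γ + ρ).1 _ := (isGluedLift γ).add (isGluedLift ρ)
  rw [h.pth_eq, Pi.add_apply, map_add]
  rfl

/-- The homomorphism `Δ' ∘ Pth`, the winding of `Pth γ`. -/
def pathWinding : D.loopGroup →+ D.diff :=
  AddMonoidHom.mk' (fun γ => ⟨winding (gluedLift γ), winding_mem (gluedLift_mem γ)⟩) fun γ ρ => by
    obtain ⟨g, -, e⟩ := gluedLift_add γ ρ
    ext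
    simp only [e, winding, Pi.add_apply, AddSubgroup.coe_add]
    abel

lemma IsGluedLift.winding_eq {γ : D.loopGroup} {Ξ : ℝ → 𝔥} (h : D.IsGluedLift γ.1 Ξ) :
    (pathWinding γ : 𝔥) = winding Ξ := by
  obtain ⟨g, -, e⟩ := (isGluedLift γ).unique h
  simp only [pathWinding, AddMonoidHom.mk'_apply, e, winding, Pi.add_apply]
  abel

/-- Elements of the loop group are determined by a glued lift and the value at `q`. -/
lemma ext_of_isGluedLift {γ ρ : D.Triples} {Ξ : ℝ → 𝔥} (h : D.IsGluedLift γ Ξ)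
    (h' : D.IsGluedLift ρ Ξ) (hq : γ.2.1.2 = ρ.2.1.2) : γ = ρ := by
  obtain ⟨-, w, b, m⟩ := h
  obtain ⟨-, w', b', m'⟩ := h'
  refine Prod.ext (funext fun t => by rw [w, w']) (Prod.ext (Prod.ext (m.trans m'.symm) hq)
    (funext fun t => by rw [b, b']))

lemma isGluedLift_const {γ : D.Triples} {Ξ : ℝ → 𝔥} (h : D.IsGluedLift γ Ξ) {g : 𝔥}
    (hg : g ∈ D.Γ) : D.IsGluedLift γ (Ξ + fun _ => g) := by
  obtain ⟨q, w, b, m⟩ := h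
  refine ⟨add_mem q (const_mem g), fun t => ?_, fun t => ?_, ?_⟩
  · simp [w, D.expW_eq_zero.2 (D.map_w g hg : g ∈ D.latW)]
  · simp [b, D.expB_eq_zero.2 (D.map_b g hg : g ∈ D.latB)]
  · simp only [m, Pi.add_apply, map_add, D.expH_eq_zero.2 hg, add_zero]

lemma value_q_w (γ : D.loopGroup) :
    D.torusMapW γ.1.2.1.2 = D.expW (D.πw (gluedLift γ 1)) := by
  obtain ⟨ξw, ξb, -, -, h3, -, -, h6, -⟩ := γ.2
  have := (isGluedLift γ).2.1 ⟨1, by norm_num⟩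
  rw [h6, ← this, h3]

lemma value_q_b (γ : D.loopGroup) :
    D.torusMapB γ.1.2.1.2 = D.expB (D.πb (gluedLift γ 0)) := by
  obtain ⟨ξw, ξb, -, -, -, h4, -, -, -, h8, -⟩ := γ.2
  have := (isGluedLift γ).2.2.1 ⟨0, by norm_num⟩
  rw [h8, ← this, h4]

/-- The triple with given glued lift `Ξ` and value `h` at `q`. -/
def ofLift (Ξ : ℝ → 𝔥) (hΞ : Ξ ∈ D.quasiPeriodic) (h : D.H)
    (hw : D.torusMapW h = D.expW (D.πw (Ξ 1))) (hb : D.torusMapB h = D.expB (D.πb (Ξ 0))) :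
    D.loopGroup :=
  ⟨(fun t => D.expW (D.πw (Ξ t)), (D.expH (Ξ (1 / 2)), h), fun t => D.expB (D.πb (Ξ t))), by
    have Uw : UniqueDiffOn ℝ (Set.Icc (1 / 2 : ℝ) 1) := uniqueDiffOn_Icc (by norm_num)
    have Ub : UniqueDiffOn ℝ (Set.Icc (0 : ℝ) (1 / 2)) := uniqueDiffOn_Icc (by norm_num)
    have kw : ∀ (k : ℕ) t, t ∈ Set.Icc (1 / 2 : ℝ) 1 → D.πw.symm (iteratedDerivWithin k
        (fun t => D.πw (Ξ t)) (Set.Icc (1 / 2) 1) t) = iteratedDeriv k Ξ t := fun k t ht => by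
      rw [SmoothGlue.iteratedDerivWithin_equiv _ _ _ Uw ht, LinearIsometryEquiv.symm_apply_apply,
        iteratedDerivWithin_eq_iteratedDeriv Uw
          ((hΞ.1.of_le (by exact_mod_cast le_top)).contDiffAt) ht]
    have kb : ∀ (k : ℕ) t, t ∈ Set.Icc (0 : ℝ) (1 / 2) → D.πb.symm (iteratedDerivWithin k
        (fun t => D.πb (Ξ t)) (Set.Icc 0 (1 / 2)) t) = iteratedDeriv k Ξ t := fun k t ht => by
      rw [SmoothGlue.iteratedDerivWithin_equiv _ _ _ Ub ht, LinearIsometryEquiv.symm_apply_apply,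
        iteratedDerivWithin_eq_iteratedDeriv Ub
          ((hΞ.1.of_le (by exact_mod_cast le_top)).contDiffAt) ht]
    refine ⟨fun t => D.πw (Ξ t), fun t => D.πb (Ξ t),
      (D.πw.toContinuousLinearEquiv.contDiff.comp hΞ.1).contDiffOn,
      (D.πb.toContinuousLinearEquiv.contDiff.comp hΞ.1).contDiffOn, fun _ => rfl, fun _ => rfl,
      rfl, hw, rfl, hb, fun k _ => ?_, fun k hk => ?_⟩
    · rw [kw k _ (by norm_num), kb k _ (by norm_num)]
    · rw [kw k _ (by norm_num), kb k _ (by norm_num)]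
      obtain ⟨j, rfl⟩ : ∃ j, k = j + 1 := ⟨k - 1, by omega⟩
      have e : iteratedDeriv (j + 1) (fun t => Ξ (t + 1)) = iteratedDeriv (j + 1) Ξ := by
        rw [iteratedDeriv_succ', iteratedDeriv_succ']
        congr 1
        funext t
        rw [show (fun t => Ξ (t + 1)) = fun t => Ξ t + winding Ξ from
          funext fun t => apply_add_one hΞ t, deriv_add_const]
      have e2 := congrFun (iteratedDeriv_comp_add_const (j + 1) Ξ 1) 0
      rw [e, zero_add] at e2
      exact e2.symm⟩

lemma isGluedLift_ofLift (Ξ : ℝ → 𝔥) (hΞ : Ξ ∈ D.quasiPeriodic) (h : D.H) (hw) (hb) :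
    D.IsGluedLift (ofLift Ξ hΞ h hw hb).1 Ξ := ⟨hΞ, fun _ => rfl, fun _ => rfl, rfl⟩

end LatticeSpan
end

noncomputable section

open scoped RealInnerProductSpace ContDiff

lemma circleExp_add (x y : ℝ) : circleExp (x + y) = circleExp x * circleExp y := by
  rw [circleExp, mul_add, Circle.exp_add]; rfl

lemma circleExp_int {x : ℝ} (h : ∃ k : ℤ, x = k) : circleExp x = 1 := by
  obtain ⟨k, rfl⟩ := h
  rw [circleExp, Circle.exp_eq_one]
  exact ⟨k, by ring⟩

lemma circleExp_zero : circleExp 0 = 1 := circleExp_int ⟨0, by simp⟩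

lemma comm_aux₁ {G : Type*} [CommGroup G] {a b c d : G} (h : a * b = c * d) (x y z : G) :
    (a * x) * (b * (y * z)) = (c * z) * (d * (x * y)) := by
  rw [mul_mul_mul_comm, h, mul_mul_mul_comm c z, mul_comm z, mul_assoc x]

lemma comm_aux₂ {G : Type*} [CommGroup G] {a b c d : G} (h : a * b = c * d) (x y z : G) :
    (x * y * a) * z * b = x * (y * z * c) * d := by
  rw [mul_right_comm _ a z, mul_assoc _ a b, h]
  simp only [mul_assoc]

lemma comm_aux₃ {G : Type*} [CommGroup G] {r c s t d : G} (h : r * c = s * t * d) (x y : G) :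
    r * (x * y * c) = (s * x) * (t * y) * d := by
  rw [mul_left_comm, h, mul_mul_mul_comm s x t y, mul_comm (s * t) (x * y), mul_assoc (x * y)]

namespace LatticeSpan

open SmoothLoop

variable {𝔱w 𝔥 𝔱b : Type*}
  [NormedAddCommGroup 𝔱w] [InnerProductSpace ℝ 𝔱w]
  [NormedAddCommGroup 𝔥] [InnerProductSpace ℝ 𝔥]
  [NormedAddCommGroup 𝔱b] [InnerProductSpace ℝ 𝔱b]
  {D : LatticeSpan 𝔱w 𝔥 𝔱b}

/-! ### The central extension -/

/-- The bilinear form `½ ∫₀¹ ⟨Ξ', Η⟩ + ½ ⟨Ξ(1) - Ξ(0), Η(0)⟩` on quasi-periodic lifts. -/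
def area (Ξ Η : ℝ → 𝔥) : ℝ := sympl Ξ Η + (1 / 2) * ⟪winding Ξ, Η 0⟫

lemma contDiff_deriv {Ξ : ℝ → 𝔥} (h : ContDiff ℝ ∞ Ξ) : ContDiff ℝ ∞ (deriv Ξ) :=
  ((contDiff_infty_iff_deriv).1 h).2

lemma deriv_add' {Ξ Η : ℝ → 𝔥} (h : ContDiff ℝ ∞ Ξ) (h' : ContDiff ℝ ∞ Η) (t : ℝ) :
    deriv (Ξ + Η) t = deriv Ξ t + deriv Η t :=
  deriv_add (h.differentiable (by simp) t) (h'.differentiable (by simp) t)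

lemma sympl_add_left {Ξ Ξ' Η : ℝ → 𝔥} (h : ContDiff ℝ ∞ Ξ) (h' : ContDiff ℝ ∞ Ξ')
    (k : Continuous Η) : sympl (Ξ + Ξ') Η = sympl Ξ Η + sympl Ξ' Η := by
  have c1 := (contDiff_deriv h).continuous
  have c2 := (contDiff_deriv h').continuous
  simp only [sympl, deriv_add' h h', inner_add_left]
  rw [intervalIntegral.integral_add (Continuous.intervalIntegrable (by fun_prop) _ _)
    (Continuous.intervalIntegrable (by fun_prop) _ _)]
  ring

lemma sympl_add_right {Ξ Η Η' : ℝ → 𝔥} (h : ContDiff ℝ ∞ Ξ) (k : Continuous Η)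
    (k' : Continuous Η') : sympl Ξ (Η + Η') = sympl Ξ Η + sympl Ξ Η' := by
  have c1 := (contDiff_deriv h).continuous
  simp only [sympl, Pi.add_apply, inner_add_right]
  rw [intervalIntegral.integral_add (Continuous.intervalIntegrable (by fun_prop) _ _)
    (Continuous.intervalIntegrable (by fun_prop) _ _)]
  ring

lemma integral_inner_deriv {Ξ : ℝ → 𝔥} (h : ContDiff ℝ ∞ Ξ) (g : 𝔥) (a b : ℝ) :
    ∫ t in a..b, ⟪deriv Ξ t, g⟫ = ⟪Ξ b - Ξ a, g⟫ := by
  have c1 := (contDiff_deriv h).continuous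
  have : ∀ t, HasDerivAt (fun t => ⟪Ξ t, g⟫) ⟪deriv Ξ t, g⟫ t := fun t => by
    have := (h.differentiable (by simp) t).hasDerivAt.inner ℝ (hasDerivAt_const t g)
    simpa using this
  rw [intervalIntegral.integral_eq_sub_of_hasDerivAt (fun t _ => this t)
    (Continuous.intervalIntegrable (by fun_prop) _ _), inner_sub_left]

lemma sympl_const_right {Ξ : ℝ → 𝔥} (h : ContDiff ℝ ∞ Ξ) (g : 𝔥) :
    sympl Ξ (fun _ => g) = (1 / 2) * ⟪winding Ξ, g⟫ := by
  rw [sympl, integral_inner_deriv h, winding]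

lemma sympl_const_left (g : 𝔥) (Η : ℝ → 𝔥) : sympl (fun _ => g) Η = 0 := by
  simp [sympl]

lemma area_add_left {Ξ Ξ' Η : ℝ → 𝔥} (h : Ξ ∈ D.quasiPeriodic) (h' : Ξ' ∈ D.quasiPeriodic)
    (k : Η ∈ D.quasiPeriodic) : area (Ξ + Ξ') Η = area Ξ Η + area Ξ' Η := by
  rw [area, sympl_add_left h.1 h'.1 k.1.continuous, area, area]
  have : winding (Ξ + Ξ') = winding Ξ + winding Ξ' := by
    simp only [winding, Pi.add_apply]; abel
  rw [this, inner_add_left]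
  ring

lemma area_add_right {Ξ Η Η' : ℝ → 𝔥} (h : Ξ ∈ D.quasiPeriodic) (k : Η ∈ D.quasiPeriodic)
    (k' : Η' ∈ D.quasiPeriodic) : area Ξ (Η + Η') = area Ξ Η + area Ξ Η' := by
  rw [area, sympl_add_right h.1 k.1.continuous k'.1.continuous, area, area, Pi.add_apply,
    inner_add_right]
  ring

lemma area_const_left (g : 𝔥) (Η : ℝ → 𝔥) : area (fun _ => g) Η = 0 := by
  simp [area, sympl_const_left, winding]

lemma area_const_right {Ξ : ℝ → 𝔥} (h : Ξ ∈ D.quasiPeriodic) (g : 𝔥) :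
    area Ξ (fun _ => g) = ⟪winding Ξ, g⟫ := by
  rw [area, sympl_const_right h.1]
  ring

lemma circleExp_area_const {Ξ Η : ℝ → 𝔥} (h : Ξ ∈ D.quasiPeriodic) (k : Η ∈ D.quasiPeriodic)
    {g g' : 𝔥} (hg' : g' ∈ D.Γ) :
    circleExp (area (Ξ + fun _ => g) (Η + fun _ => g')) = circleExp (area Ξ Η) := by
  rw [area_add_left h (const_mem g) (add_mem k (const_mem g')), area_const_left, add_zero,
    area_add_right h k (const_mem g'), circleExp_add, area_const_right h,
    circleExp_int (D.diff_le_dual (winding_mem h) g' hg'), mul_one]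

lemma area_shift {Ξ Η : ℝ → 𝔥} (h : Ξ ∈ D.quasiPeriodic) (k : Η ∈ D.quasiPeriodic) (θ : ℝ) :
    area (fun t => Ξ (t - θ)) (fun t => Η (t - θ)) = area Ξ Η +
      (1 / 2) * ⟪winding Ξ, Η (-θ) - Η 0⟫ + (1 / 2) * ⟪Ξ (-θ) - Ξ 0, winding Η⟫ := by
  have c1 := (contDiff_deriv h.1).continuous
  have c2 := k.1.continuous
  have hd : ∀ t, deriv Ξ (t + 1) = deriv Ξ t := fun t => by
    rw [← deriv_comp_add_const, show (fun t => Ξ (t + 1)) = fun t => Ξ t + winding Ξ from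
      funext fun t => apply_add_one h t, deriv_add_const]
  let F : ℝ → ℝ := fun t => ⟪deriv Ξ t, Η t⟫
  have hF : Continuous F := by fun_prop
  have hi : ∀ a b, IntervalIntegrable F MeasureTheory.volume a b := fun a b =>
    hF.intervalIntegrable _ _
  have e1 : ∫ t in (0 : ℝ)..1, ⟪deriv (fun t => Ξ (t - θ)) t, Η (t - θ)⟫ =
      ∫ t in (-θ)..(1 - θ), F t := by
    have := intervalIntegral.integral_comp_sub_right (a := 0) (b := 1) F θ
    rw [zero_sub] at this
    rw [← this]
    refine intervalIntegral.integral_congr fun t _ => ?_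
    simp only [F]
    rw [deriv_comp_sub_const]
  have e2 : ∫ t in (1 - θ)..1, F t = (∫ t in (-θ)..0, F t) + ⟪Ξ 0 - Ξ (-θ), winding Η⟫ := by
    have := intervalIntegral.integral_comp_add_right (a := -θ) (b := 0) F 1
    rw [zero_add, show -θ + 1 = 1 - θ by ring] at this
    rw [← this, ← integral_inner_deriv h.1, ← intervalIntegral.integral_add (hi _ _)
      (Continuous.intervalIntegrable (by fun_prop) _ _)]
    refine intervalIntegral.integral_congr fun t _ => ?_
    simp only [F]
    rw [hd, apply_add_one k, inner_add_right]
  have e3 := intervalIntegral.integral_add_adjacent_intervals (hi (-θ) (1 - θ)) (hi (1 - θ) 1)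
  have e4 := intervalIntegral.integral_add_adjacent_intervals (hi (-θ) 0) (hi 0 1)
  have e5 : ⟪Ξ 0 - Ξ (-θ), winding Η⟫ = - ⟪Ξ (-θ) - Ξ 0, winding Η⟫ := by
    rw [← inner_neg_left, neg_sub]
  rw [area, area, winding_shift h, sympl, sympl, e1, zero_sub, inner_sub_right]
  change _ = 1 / 2 * (∫ t in (0 : ℝ)..1, F t) + _ + _ + _
  linarith

variable (D)

/-- A normalised `2`-cocycle `ε` on `Λw - Λb` with values in the unit circle such that
`ε(λ, μ) ε(μ, λ)⁻¹ = exp (2πi (½ ⟨μ, λ⟩ + ⟨μ, λ_b⟩))` for any decomposition `λ = λ_w - λ_b`. -/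
structure CommutatorCocycle where
  toFun : D.diff → D.diff → Circle
  cocycle : ∀ x y z, toFun x y * toFun (x + y) z = toFun y z * toFun x (y + z)
  map_zero_left : ∀ x, toFun 0 x = 1
  map_zero_right : ∀ x, toFun x 0 = 1
  commutator : ∀ x y : D.diff, ∀ a ∈ D.latW, ∀ b ∈ D.latB, (x : 𝔥) = a - b →
    toFun x y * (toFun y x)⁻¹ = circleExp ((1 / 2) * ⟪(y : 𝔥), (x : 𝔥)⟫ + ⟪(y : 𝔥), b⟫)

variable {D} (ε : D.CommutatorCocycle)

/-- The `2`-cocycle on the loop group. -/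
def loopCocycle (γ ρ : D.loopGroup) : Circle :=
  ε.toFun (pathWinding γ) (pathWinding ρ) * circleExp (area (gluedLift γ) (gluedLift ρ))

lemma loopCocycle_eq {γ ρ : D.loopGroup} {Ξ Η : ℝ → 𝔥} (h : D.IsGluedLift γ.1 Ξ)
    (k : D.IsGluedLift ρ.1 Η) : loopCocycle ε γ ρ =
      ε.toFun (pathWinding γ) (pathWinding ρ) * circleExp (area Ξ Η) := by
  obtain ⟨g, hg, e⟩ := (isGluedLift γ).unique h
  obtain ⟨g', hg', e'⟩ := (isGluedLift ρ).unique k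
  rw [loopCocycle, e, e', circleExp_area_const h.1 k.1 hg']

lemma loopCocycle_assoc (γ ρ τ : D.loopGroup) :
    loopCocycle ε γ ρ * loopCocycle ε (γ + ρ) τ = loopCocycle ε ρ τ * loopCocycle ε γ (ρ + τ) := by
  have h := isGluedLift γ
  have k := isGluedLift ρ
  have j := isGluedLift τ
  have hk : D.IsGluedLift (γ + ρ).1 _ := h.add k
  have kj : D.IsGluedLift (ρ + τ).1 _ := k.add j
  rw [loopCocycle_eq ε h k, loopCocycle_eq ε hk j, loopCocycle_eq ε k j, loopCocycle_eq ε h kj,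
    area_add_left h.1 k.1 j.1, area_add_right h.1 k.1 j.1, circleExp_add, circleExp_add,
    map_add, map_add]
  exact comm_aux₁ (ε.cocycle (pathWinding γ) (pathWinding ρ) (pathWinding τ)) _ _ _

lemma loopCocycle_zero_left (γ : D.loopGroup) : loopCocycle ε 0 γ = 1 := by
  rw [loopCocycle_eq ε (γ := 0) isGluedLift_zero (isGluedLift γ), map_zero, ε.map_zero_left, one_mul]
  have := area_const_left (0 : 𝔥) (gluedLift γ)
  exact (congrArg circleExp this).trans circleExp_zero

/-- The central extension of the loop group by the circle. -/
@[ext]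
structure ExtLoopGroup (ε : D.CommutatorCocycle) where
  pt : D.loopGroup
  phase : Circle

namespace ExtLoopGroup

variable {ε}

instance : Mul (ExtLoopGroup ε) :=
  ⟨fun x y => ⟨x.pt + y.pt, x.phase * y.phase * loopCocycle ε x.pt y.pt⟩⟩

instance : One (ExtLoopGroup ε) := ⟨⟨0, 1⟩⟩

instance : Inv (ExtLoopGroup ε) :=
  ⟨fun x => ⟨-x.pt, (x.phase * loopCocycle ε (-x.pt) x.pt)⁻¹⟩⟩

@[simp] lemma mul_pt (x y : ExtLoopGroup ε) : (x * y).pt = x.pt + y.pt := rfl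

@[simp] lemma mul_phase (x y : ExtLoopGroup ε) :
    (x * y).phase = x.phase * y.phase * loopCocycle ε x.pt y.pt := rfl

instance : Group (ExtLoopGroup ε) :=
  Group.ofLeftAxioms
    (fun x y z => by
      refine ExtLoopGroup.ext (add_assoc _ _ _) ?_
      exact comm_aux₂ (loopCocycle_assoc ε x.pt y.pt z.pt) _ _ _)
    (fun x => by
      refine ExtLoopGroup.ext (zero_add _) ?_
      change 1 * x.phase * loopCocycle ε 0 x.pt = _
      rw [loopCocycle_zero_left, mul_one, one_mul])
    (fun x => by
      refine ExtLoopGroup.ext (neg_add_cancel _) ?_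
      change (x.phase * loopCocycle ε (-x.pt) x.pt)⁻¹ * x.phase * loopCocycle ε (-x.pt) x.pt = 1
      rw [mul_assoc, inv_mul_cancel])

/-- The homomorphism `Δ' ∘ Pth` on the central extension. -/
def windingHom (ε : D.CommutatorCocycle) : ExtLoopGroup ε →* Multiplicative D.diff where
  toFun x := Multiplicative.ofAdd (pathWinding x.pt)
  map_one' := by
    change Multiplicative.ofAdd (pathWinding (0 : D.loopGroup)) = 1
    rw [map_zero]; rfl
  map_mul' x y := by rw [mul_pt, map_add]; rfl

end ExtLoopGroup

/-- The subgroup `ker (Δ' ∘ Pth)` of the central extension. -/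
def kerExt (ε : D.CommutatorCocycle) : Subgroup (ExtLoopGroup ε) :=
  (ExtLoopGroup.windingHom ε).ker

instance : (kerExt ε).Normal := MonoidHom.normal_ker _

lemma mem_kerExt {x : ExtLoopGroup ε} : x ∈ kerExt ε ↔ pathWinding x.pt = 0 := Iff.rfl

/-! ### The action of rotations -/

/-- The action of the rotation `Φ_θ` on the loop group, characterised by
`Pth (Φ γ) = Φ^* Pth γ` and `(Φ γ)_m(q) = γ_m(q) - (Pth γ)(0) + (Φ^* Pth γ)(0)`. -/
def rotLoop (θ : ℝ) (γ : D.loopGroup) : D.loopGroup :=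
  ofLift (fun t => gluedLift γ (t - θ)) (shift_mem (gluedLift_mem γ) θ)
    (γ.1.2.1.2 - pth γ 0 + pth γ (0 - θ))
    (by
      have h1 := apply_add_one (gluedLift_mem γ) 0
      have h2 := apply_add_one (gluedLift_mem γ) (0 - θ)
      rw [zero_add] at h1
      rw [show 0 - θ + 1 = 1 - θ by ring] at h2
      rw [map_add, map_sub, value_q_w, pth, pth, torusMapW_expH, torusMapW_expH, h1, h2]
      simp only [map_add]
      abel)
    (by
      rw [map_add, map_sub, value_q_b, pth, pth, torusMapB_expH, torusMapB_expH, sub_self,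
        zero_add])

lemma isGluedLift_rotLoop (θ : ℝ) {γ : D.loopGroup} {Ξ : ℝ → 𝔥} (h : D.IsGluedLift γ.1 Ξ) :
    D.IsGluedLift (rotLoop θ γ).1 (fun t => Ξ (t - θ)) := by
  obtain ⟨g, hg, e⟩ := h.unique (isGluedLift γ)
  rw [e]
  exact isGluedLift_const (isGluedLift_ofLift _ _ _ _ _) hg

lemma rotLoop_q (θ : ℝ) (γ : D.loopGroup) :
    (rotLoop θ γ).1.2.1.2 = γ.1.2.1.2 - pth γ 0 + pth γ (0 - θ) := rfl

lemma pth_rotLoop (θ : ℝ) (γ : D.loopGroup) (t : ℝ) : pth (rotLoop θ γ) t = pth γ (t - θ) :=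
  (isGluedLift_rotLoop θ (isGluedLift γ)).pth_eq t

lemma rotLoop_add (θ : ℝ) (γ ρ : D.loopGroup) :
    rotLoop θ (γ + ρ) = rotLoop θ γ + rotLoop θ ρ := by
  have h : D.IsGluedLift (γ + ρ).1 _ := (isGluedLift γ).add (isGluedLift ρ)
  refine Subtype.ext (ext_of_isGluedLift (isGluedLift_rotLoop θ h)
    ((isGluedLift_rotLoop θ (isGluedLift γ)).add (isGluedLift_rotLoop θ (isGluedLift ρ))) ?_)
  change γ.1.2.1.2 + ρ.1.2.1.2 - pth (γ + ρ) 0 + pth (γ + ρ) (0 - θ) =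
    (γ.1.2.1.2 - pth γ 0 + pth γ (0 - θ)) + (ρ.1.2.1.2 - pth ρ 0 + pth ρ (0 - θ))
  rw [pth_add, pth_add]
  abel

lemma rotLoop_rotLoop (θ θ' : ℝ) (γ : D.loopGroup) :
    rotLoop θ (rotLoop θ' γ) = rotLoop (θ + θ') γ := by
  have h := isGluedLift_rotLoop θ (isGluedLift_rotLoop θ' (isGluedLift γ))
  have h' := isGluedLift_rotLoop (θ + θ') (isGluedLift γ)
  have e : (fun t => gluedLift γ (t - (θ + θ'))) = fun t => gluedLift γ (t - θ - θ') := by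
    funext t; rw [sub_sub]
  rw [e] at h'
  refine Subtype.ext (ext_of_isGluedLift h h' ?_)
  rw [rotLoop_q, rotLoop_q, rotLoop_q, pth_rotLoop, pth_rotLoop, sub_sub]
  abel

lemma rotLoop_nat {m : ℕ} {γ : D.loopGroup} (h : m • (pathWinding γ : 𝔥) ∈ D.Γ) :
    rotLoop m γ = γ := by
  have hl := isGluedLift γ
  rw [hl.winding_eq] at h
  have e : (fun t => gluedLift γ (t - m)) = gluedLift γ + fun _ => -(m • winding (gluedLift γ)) := by
    funext t
    have := apply_add_nat hl.1 m (t - m)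
    rw [sub_add_cancel] at this
    rw [Pi.add_apply, this]
    abel
  have h1 := isGluedLift_rotLoop m hl
  rw [e] at h1
  refine Subtype.ext (ext_of_isGluedLift h1 (isGluedLift_const hl (neg_mem h)) ?_)
  have := congrFun e 0
  simp only [Pi.add_apply] at this
  rw [rotLoop_q, pth, pth, this, map_add, D.expH_eq_zero.2 (neg_mem h)]
  abel

lemma pathWinding_rotLoop (θ : ℝ) (γ : D.loopGroup) :
    pathWinding (rotLoop θ γ) = pathWinding γ := by
  ext
  rw [(isGluedLift_rotLoop θ (isGluedLift γ)).winding_eq, (isGluedLift γ).winding_eq,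
    winding_shift (gluedLift_mem γ)]

/-- The phase `exp (πi ⟨Ξ(-θ) - Ξ(0), Δ'_γ⟩)` by which `Φ_θ` acts on the central extension. -/
def rotPhase (θ : ℝ) (γ : D.loopGroup) : Circle :=
  circleExp ((1 / 2) * ⟪gluedLift γ (-θ) - gluedLift γ 0, (pathWinding γ : 𝔥)⟫)

lemma rotPhase_eq (θ : ℝ) {γ : D.loopGroup} {Ξ : ℝ → 𝔥} (h : D.IsGluedLift γ.1 Ξ) :
    rotPhase θ γ = circleExp ((1 / 2) * ⟪Ξ (-θ) - Ξ 0, winding Ξ⟫) := by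
  obtain ⟨g, -, e⟩ := (isGluedLift γ).unique h
  rw [rotPhase, h.winding_eq, e]
  simp

lemma rotPhase_mul (θ : ℝ) (γ ρ : D.loopGroup) :
    rotPhase θ (γ + ρ) * loopCocycle ε γ ρ =
      rotPhase θ γ * rotPhase θ ρ * loopCocycle ε (rotLoop θ γ) (rotLoop θ ρ) := by
  have h := isGluedLift γ
  have k := isGluedLift ρ
  have hk : D.IsGluedLift (γ + ρ).1 _ := h.add k
  rw [rotPhase_eq θ hk, rotPhase_eq θ h, rotPhase_eq θ k, loopCocycle_eq ε h k,
    loopCocycle_eq ε (isGluedLift_rotLoop θ h) (isGluedLift_rotLoop θ k), area_shift h.1 k.1,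
    pathWinding_rotLoop, pathWinding_rotLoop]
  generalize gluedLift γ = Ξ at *
  generalize gluedLift ρ = Η at *
  have e : winding (Ξ + Η) = winding Ξ + winding Η := by
    simp only [winding, Pi.add_apply]; abel
  rw [e, mul_left_comm, mul_left_comm _ (ε.toFun _ _), ← circleExp_add, ← circleExp_add,
    ← circleExp_add]
  congr 2
  simp only [Pi.add_apply]
  rw [show Ξ (-θ) + Η (-θ) - (Ξ 0 + Η 0) = (Ξ (-θ) - Ξ 0) + (Η (-θ) - Η 0) by abel,
    inner_add_left, inner_add_right, inner_add_right, real_inner_comm (winding Ξ) (Η (-θ) - Η 0)]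
  ring

lemma rotPhase_add (θ θ' : ℝ) (γ : D.loopGroup) :
    rotPhase (θ + θ') γ = rotPhase θ (rotLoop θ' γ) * rotPhase θ' γ := by
  rw [rotPhase_eq θ (isGluedLift_rotLoop θ' (isGluedLift γ)), winding_shift (gluedLift_mem γ),
    rotPhase_eq _ (isGluedLift γ), rotPhase_eq _ (isGluedLift γ), ← circleExp_add, ← mul_add,
    ← inner_add_left, zero_sub, show -(θ + θ') = -θ - θ' by ring]
  congr 3
  abel

lemma rotPhase_nat {m : ℕ} {γ : D.loopGroup} (h : m • (pathWinding γ : 𝔥) ∈ D.Γ) :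
    rotPhase m γ = 1 := by
  have hl := isGluedLift γ
  rw [rotPhase_eq _ hl]
  obtain ⟨k, hk⟩ := D.even_of_nsmul_mem (pathWinding γ).2 h
  rw [hl.winding_eq] at hk
  have := apply_add_nat hl.1 m (-m)
  rw [neg_add_cancel] at this
  refine circleExp_int ⟨-k, ?_⟩
  rw [this, sub_add_cancel_left, inner_neg_left, ← Nat.cast_smul_eq_nsmul ℝ, real_inner_smul_left, hk]
  push_cast
  ring

/-- The action of the rotation `Φ_θ` on the central extension by automorphisms, as a homomorphism
from the additive group of the `θ`. -/
def rotExtReal (ε : D.CommutatorCocycle) : Multiplicative ℝ →* MulAut (ExtLoopGroup ε) :=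
  let f : ℝ → ExtLoopGroup ε → ExtLoopGroup ε := fun θ x =>
    ⟨rotLoop θ x.pt, rotPhase θ x.pt * x.phase⟩
  have f_mul : ∀ θ x y, f θ (x * y) = f θ x * f θ y := fun θ x y => by
    refine ExtLoopGroup.ext (rotLoop_add θ _ _) ?_
    exact comm_aux₃ (rotPhase_mul ε θ x.pt y.pt) _ _
  have f_add : ∀ θ θ' x, f (θ + θ') x = f θ (f θ' x) := fun θ θ' x => by
    refine ExtLoopGroup.ext (rotLoop_rotLoop θ θ' _).symm ?_
    simp only [f, rotPhase_add, mul_assoc]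
  have f_zero : ∀ x, f 0 x = x := fun x => by
    have h : (0 : ℕ) • (pathWinding x.pt : 𝔥) ∈ D.Γ := by rw [zero_smul]; exact zero_mem _
    refine ExtLoopGroup.ext ?_ ?_
    · simpa using rotLoop_nat h
    · have := rotPhase_nat h
      rw [Nat.cast_zero] at this
      simp only [f, this, one_mul]
  { toFun := fun θ =>
      { toFun := f θ.toAdd
        invFun := f (-θ.toAdd)
        left_inv := fun x => by rw [← f_add, neg_add_cancel, f_zero]
        right_inv := fun x => by rw [← f_add, add_neg_cancel, f_zero]
        map_mul' := f_mul _ }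
    map_one' := MulEquiv.ext f_zero
    map_mul' := fun θ θ' => MulEquiv.ext fun x => f_add _ _ x }

lemma rotExtReal_apply (θ : ℝ) (x : ExtLoopGroup ε) :
    rotExtReal ε (Multiplicative.ofAdd θ) x = ⟨rotLoop θ x.pt, rotPhase θ x.pt * x.phase⟩ := rfl

/-- The action of the `m`-fold cover `ℝ / mℤ` of the rotation group on the central extension. -/
def rotExt (ε : D.CommutatorCocycle) (m : ℕ) (hm : 0 < m) (hn : D.torsionIndex ∣ m) :
    Multiplicative (AddCircle (m : ℝ)) →* MulAut (ExtLoopGroup ε) :=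
  AddMonoidHom.toMultiplicativeLeft (QuotientAddGroup.lift (AddSubgroup.zmultiples (m : ℝ))
    (MonoidHom.toAdditiveRight (rotExtReal ε)) (by
      rw [AddSubgroup.zmultiples_le]
      refine MulEquiv.ext fun x => ?_
      have h := D.nsmul_mem_of_torsionIndex_dvd hm hn (pathWinding x.pt).2
      refine ExtLoopGroup.ext (rotLoop_nat h) ?_
      change rotPhase m x.pt * x.phase = x.phase
      rw [rotPhase_nat h, one_mul]))

lemma rotExt_coe (m : ℕ) (hm : 0 < m) (hn : D.torsionIndex ∣ m) (θ : ℝ) :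
    rotExt ε m hm hn (Multiplicative.ofAdd (θ : AddCircle (m : ℝ))) =
      rotExtReal ε (Multiplicative.ofAdd θ) := rfl

end LatticeSpan
end

noncomputable section

open scoped RealInnerProductSpace ContDiff

/-- Multiplication by a unit complex number, as a unitary operator. -/
def phaseOp (K : Type*) [NormedAddCommGroup K] [InnerProductSpace ℂ K] :
    Circle →* (K ≃ₗᵢ[ℂ] K) where
  toFun z :=
    { LinearEquiv.smulOfNeZero ℂ K (z : ℂ) (Circle.coe_ne_zero z) with
      norm_map' := fun v => by
        change ‖(z : ℂ) • v‖ = ‖v‖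
        rw [norm_smul, Circle.norm_coe, one_mul] }
  map_one' := LinearIsometryEquiv.ext fun v => by
    change ((1 : Circle) : ℂ) • v = v
    rw [Circle.coe_one, one_smul]
  map_mul' z w := LinearIsometryEquiv.ext fun v => by
    change ((z * w : Circle) : ℂ) • v = (z : ℂ) • ((w : ℂ) • v)
    rw [Circle.coe_mul, mul_smul]

lemma phaseOp_apply {K : Type*} [NormedAddCommGroup K] [InnerProductSpace ℂ K] (z : Circle)
    (v : K) : phaseOp K z v = (z : ℂ) • v := rfl

lemma phaseOp_comm {K : Type*} [NormedAddCommGroup K] [InnerProductSpace ℂ K] (z : Circle)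
    (U : K ≃ₗᵢ[ℂ] K) : U * phaseOp K z = phaseOp K z * U :=
  LinearIsometryEquiv.ext fun v => by
    change U ((z : ℂ) • v) = (z : ℂ) • U v
    exact map_smul U (z : ℂ) v

namespace LatticeSpan

open SmoothLoop

variable {𝔱w 𝔥 𝔱b : Type*}
  [NormedAddCommGroup 𝔱w] [InnerProductSpace ℝ 𝔱w]
  [NormedAddCommGroup 𝔥] [InnerProductSpace ℝ 𝔥] [FiniteDimensional ℝ 𝔥]
  [NormedAddCommGroup 𝔱b] [InnerProductSpace ℝ 𝔱b]
  {D : LatticeSpan 𝔱w 𝔥 𝔱b} {ε : D.CommutatorCocycle}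

/-! ### The representations of the kernel -/

/-- The average `∫₀¹ Ξ`. -/
def avg (Ξ : ℝ → 𝔥) : 𝔥 := ∫ t in (0 : ℝ)..1, Ξ t

lemma avg_add {Ξ Η : ℝ → 𝔥} (h : Continuous Ξ) (k : Continuous Η) :
    avg (Ξ + Η) = avg Ξ + avg Η := by
  simp only [avg, Pi.add_apply]
  rw [intervalIntegral.integral_add (Continuous.intervalIntegrable (by fun_prop) _ _)
    (Continuous.intervalIntegrable (by fun_prop) _ _)]

lemma avg_const (g : 𝔥) : avg (fun _ => g) = g := by
  have : CompleteSpace 𝔥 := FiniteDimensional.complete ℝ 𝔥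
  simp [avg]

/-- The oscillating part `Ξ - avg Ξ` of a periodic function. -/
def osc (Ξ : ℝ → 𝔥) (h : ContDiff ℝ ∞ Ξ) (hp : Function.Periodic Ξ 1) : ZeroMeanLoop 𝔥 :=
  ⟨fun t => Ξ t - avg Ξ, h.sub contDiff_const, fun t => by simp only [hp t], by
    have : CompleteSpace 𝔥 := FiniteDimensional.complete ℝ 𝔥
    have := h.continuous
    rw [intervalIntegral.integral_sub (Continuous.intervalIntegrable (by fun_prop) _ _)
      (Continuous.intervalIntegrable (by fun_prop) _ _)]
    simp [avg]⟩

lemma periodic_of_winding {Ξ : ℝ → 𝔥} (h : Ξ ∈ D.quasiPeriodic) (h0 : winding Ξ = 0) :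
    Function.Periodic Ξ 1 := fun t => by rw [apply_add_one h, h0, add_zero]

lemma winding_of_ker {γ : D.loopGroup} (h : pathWinding γ = 0) : winding (gluedLift γ) = 0 :=
  congrArg Subtype.val h

/-- The element `γ_m(q) - (Pth γ)(1)` of `(Λw ∩ Λb) / Γ`. -/
def defect (γ : D.loopGroup) (h : pathWinding γ = 0) : D.interTorus :=
  ⟨γ.1.2.1.2 - pth γ 1, by
    obtain ⟨y, hy⟩ := QuotientAddGroup.mk'_surjective _ γ.1.2.1.2
    change D.expH y = _ at hy
    have hw := value_q_w γ
    have hb := value_q_b γ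
    have h0 := sub_eq_zero.1 (winding_of_ker h)
    rw [← h0] at hb
    rw [← hy, torusMapW_expH] at hw
    rw [← hy, torusMapB_expH] at hb
    refine ⟨y - gluedLift γ 1, ⟨?_, ?_⟩, ?_⟩
    · change y - gluedLift γ 1 ∈ D.latW
      rw [← D.expW_eq_zero, map_sub, map_sub, hw, sub_self]
    · change y - gluedLift γ 1 ∈ D.latB
      rw [← D.expB_eq_zero, map_sub, map_sub, hb, sub_self]
    · rw [map_sub, hy]
      rfl⟩

/-- The value at `exp_H (avg ξ)` of the character `l` of `H`, for a lift `ξ` of `Pth γ`. -/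
def avgPhase (l : D.dual) (γ : D.loopGroup) : Circle := circleExp ⟪(l : 𝔥), avg (gluedLift γ)⟫

lemma avgPhase_eq (l : D.dual) {γ : D.loopGroup} {Ξ : ℝ → 𝔥} (h : D.IsGluedLift γ.1 Ξ) :
    avgPhase l γ = circleExp ⟪(l : 𝔥), avg Ξ⟫ := by
  obtain ⟨g, hg, e⟩ := (isGluedLift γ).unique h
  rw [avgPhase, e, avg_add h.1.1.continuous continuous_const, avg_const, inner_add_right,
    circleExp_add, circleExp_int (l.2 g hg), mul_one]

/-- The loop `ξ - avg ξ`, for a lift `ξ` of `Pth γ`. -/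
def oscLoop (γ : D.loopGroup) (h : pathWinding γ = 0) : ZeroMeanLoop 𝔥 :=
  osc (gluedLift γ) (gluedLift_mem γ).1
    (periodic_of_winding (gluedLift_mem γ) (winding_of_ker h))

lemma oscLoop_eq {γ : D.loopGroup} (h0 : pathWinding γ = 0) {Ξ : ℝ → 𝔥}
    (h : D.IsGluedLift γ.1 Ξ) (t : ℝ) : (oscLoop γ h0).1 t = Ξ t - avg Ξ := by
  obtain ⟨g, hg, e⟩ := (isGluedLift γ).unique h
  change gluedLift γ t - avg (gluedLift γ) = _
  rw [e, avg_add h.1.1.continuous continuous_const, avg_const, Pi.add_apply]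
  abel

/-- The representation `W_{χ, l}` of the subgroup `ker (Δ' ∘ Pth)` on `ℂ_χ ⊗ ℂ_l ⊗ 𝒮 = 𝒮`,
`W_{χ, l}(γ, z) = χ(γ_m(q) - (Pth γ)(1)) · l(avg ξ) · W(ξ - avg ξ, z)`. -/
def weylRep (ε : D.CommutatorCocycle) (χ : AddChar D.interTorus Circle) (l : D.dual) :
    kerExt ε →* (Fock 𝔥 ≃ₗᵢ[ℂ] Fock 𝔥) where
  toFun x := phaseOp (Fock 𝔥) (χ (defect x.1.pt x.2)) * phaseOp (Fock 𝔥) (avgPhase l x.1.pt) *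
    Fock.weyl (oscLoop x.1.pt x.2) x.1.phase
  map_one' := by
    have h0 : D.IsGluedLift (0 : D.loopGroup).1 0 := isGluedLift_zero
    have hp : pathWinding (0 : D.loopGroup) = 0 := map_zero _
    change phaseOp (Fock 𝔥) (χ (defect 0 hp)) * phaseOp (Fock 𝔥) (avgPhase l (0 : D.loopGroup)) *
      Fock.weyl (oscLoop (0 : D.loopGroup) hp) 1 = 1
    have e0 : avg (0 : ℝ → 𝔥) = 0 := avg_const 0
    have e1 : defect (0 : D.loopGroup) hp = 0 := by
      ext
      change (0 : D.H) - pth 0 1 = 0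
      rw [h0.pth_eq]
      simp
    have e2 : oscLoop (0 : D.loopGroup) hp = 0 := by
      ext t
      rw [oscLoop_eq hp h0, e0]
      simp
    rw [e1, e2, avgPhase_eq l h0, e0, inner_zero_right, circleExp_zero, AddChar.map_zero_eq_one,
      map_one, Fock.weyl_zero_one]
    rfl
  map_mul' := by
    rintro ⟨x, hx⟩ ⟨y, hy⟩
    have hx' : pathWinding x.pt = 0 := hx
    have hy' : pathWinding y.pt = 0 := hy
    have hxy : pathWinding (x.pt + y.pt) = 0 := by rw [map_add, hx', hy', add_zero]
    have hl : D.IsGluedLift (x.pt + y.pt).1 _ := (isGluedLift x.pt).add (isGluedLift y.pt)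
    change phaseOp (Fock 𝔥) (χ (defect (x.pt + y.pt) hxy)) *
      phaseOp (Fock 𝔥) (avgPhase l (x.pt + y.pt)) * Fock.weyl (oscLoop (x.pt + y.pt) hxy)
        (x.phase * y.phase * loopCocycle ε x.pt y.pt) =
      (phaseOp (Fock 𝔥) (χ (defect x.pt hx')) * phaseOp (Fock 𝔥) (avgPhase l x.pt) *
        Fock.weyl (oscLoop x.pt hx') x.phase) *
      (phaseOp (Fock 𝔥) (χ (defect y.pt hy')) * phaseOp (Fock 𝔥) (avgPhase l y.pt) *
        Fock.weyl (oscLoop y.pt hy') y.phase)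
    have cx := (gluedLift_mem x.pt).1
    have cy := (gluedLift_mem y.pt).1
    have ea : avg (gluedLift x.pt + gluedLift y.pt) =
        avg (gluedLift x.pt) + avg (gluedLift y.pt) := avg_add cx.continuous cy.continuous
    have e1 : defect (x.pt + y.pt) hxy = defect x.pt hx' + defect y.pt hy' := by
      ext
      change x.pt.1.2.1.2 + y.pt.1.2.1.2 - pth (x.pt + y.pt) 1 =
        (x.pt.1.2.1.2 - pth x.pt 1) + (y.pt.1.2.1.2 - pth y.pt 1)
      rw [pth_add]
      abel
    have e2 : oscLoop (x.pt + y.pt) hxy = oscLoop x.pt hx' + oscLoop y.pt hy' := by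
      ext t
      rw [oscLoop_eq hxy hl, ea]
      change _ = (gluedLift x.pt t - avg (gluedLift x.pt)) + (gluedLift y.pt t - avg (gluedLift y.pt))
      rw [Pi.add_apply]
      abel
    have e3 : avgPhase l (x.pt + y.pt) = avgPhase l x.pt * avgPhase l y.pt := by
      rw [avgPhase_eq l hl, ea, inner_add_right, circleExp_add]
      rfl
    have e4 : loopCocycle ε x.pt y.pt =
        circleExp (sympl (oscLoop x.pt hx').1 (oscLoop y.pt hy').1) := by
      have a1 : ContDiff ℝ ∞ (fun _ : ℝ => -avg (gluedLift y.pt)) := contDiff_const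
      have : sympl (oscLoop x.pt hx').1 (oscLoop y.pt hy').1 =
          area (gluedLift x.pt) (gluedLift y.pt) := by
        have d1 : sympl (oscLoop x.pt hx').1 (oscLoop y.pt hy').1 =
            sympl (gluedLift x.pt) (gluedLift y.pt + fun _ => -avg (gluedLift y.pt)) := by
          simp only [sympl]
          congr 1
          refine intervalIntegral.integral_congr fun t _ => ?_
          change ⟪deriv (fun t => gluedLift x.pt t - avg (gluedLift x.pt)) t,
            gluedLift y.pt t - avg (gluedLift y.pt)⟫ = ⟪deriv (gluedLift x.pt) t,
            gluedLift y.pt t + -avg (gluedLift y.pt)⟫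
          rw [deriv_sub_const, sub_eq_add_neg]
        rw [d1, sympl_add_right cx cy.continuous a1.continuous, sympl_const_right cx, area,
          winding_of_ker hx']
        simp
      rw [this, loopCocycle, hx', ε.map_zero_left, one_mul]
    rw [e1, e2, e3, e4, ← Fock.weyl_mul, AddChar.map_add_eq_mul, map_mul, map_mul]
    generalize Fock.weyl (oscLoop x.pt hx') x.phase = U
    generalize Fock.weyl (oscLoop y.pt hy') y.phase = V
    generalize χ (defect x.pt hx') = a
    generalize χ (defect y.pt hy') = b
    generalize avgPhase l x.pt = c
    generalize avgPhase l y.pt = d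
    simp only [← map_mul, ← mul_assoc]
    rw [mul_assoc _ U (phaseOp (Fock 𝔥) (b * d)), phaseOp_comm, ← mul_assoc, ← map_mul]
    congr 3
    rw [mul_mul_mul_comm]
    simp only [mul_assoc]

/-! ### The action of rotations on the representation spaces -/

variable (D) in
/-- The positive integers `m`, divisible by `n`, such that `m ⟨l, l⟩` is even; for these the `m`-fold
cover of the rotation group acts. -/
def rotDegrees (l : D.dual) : Set ℕ :=
  {m | 0 < m ∧ D.torsionIndex ∣ m ∧ ∃ k : ℤ, m * ⟪(l : 𝔥), (l : 𝔥)⟫ = 2 * k}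

/-- The representation `R_{χ, l}` of the `m`-fold cover `ℝ / mℤ` of the rotation group on
`ℂ_χ ⊗ ℂ_l ⊗ 𝒮 = 𝒮`, `[Φ_θ] ↦ exp (πi ⟨l, l⟩ θ) R(θ)`. -/
def rotRep (l : D.dual) (m : ℕ) (hm : m ∈ D.rotDegrees l) :
    Multiplicative (AddCircle (m : ℝ)) →* (Fock 𝔥 ≃ₗᵢ[ℂ] Fock 𝔥) :=
  let F : ℝ →+ Additive (Fock 𝔥 ≃ₗᵢ[ℂ] Fock 𝔥) := AddMonoidHom.mk' (fun θ => Additive.ofMul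
      (phaseOp (Fock 𝔥) (circleExp ((1 / 2) * ⟪(l : 𝔥), (l : 𝔥)⟫ * θ)) * Fock.rotate θ))
    fun θ θ' => by
      change phaseOp (Fock 𝔥) (circleExp ((1 / 2) * ⟪(l : 𝔥), (l : 𝔥)⟫ * (θ + θ'))) *
        Fock.rotate (θ + θ') =
        (phaseOp (Fock 𝔥) (circleExp ((1 / 2) * ⟪(l : 𝔥), (l : 𝔥)⟫ * θ)) * Fock.rotate θ) *
        (phaseOp (Fock 𝔥) (circleExp ((1 / 2) * ⟪(l : 𝔥), (l : 𝔥)⟫ * θ')) * Fock.rotate θ')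
      rw [mul_add, circleExp_add, map_mul, ← Fock.rotate_mul]
      simp only [mul_assoc]
      rw [← mul_assoc (Fock.rotate θ) (phaseOp _ _), phaseOp_comm]
      simp only [mul_assoc]
  AddMonoidHom.toMultiplicativeLeft (QuotientAddGroup.lift (AddSubgroup.zmultiples (m : ℝ)) F (by
    rw [AddSubgroup.zmultiples_le]
    change phaseOp (Fock 𝔥) (circleExp ((1 / 2) * ⟪(l : 𝔥), (l : 𝔥)⟫ * m)) *
      Fock.rotate (m : ℝ) = 1
    obtain ⟨-, -, k, hk⟩ := hm
    have h1 : ∀ n : ℕ, Fock.rotate (E := 𝔥) (n : ℝ) = 1 := by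
      intro n
      induction n with
      | zero => rw [Nat.cast_zero, Fock.rotate_zero]
      | succ n ih => rw [Nat.cast_succ, ← Fock.rotate_mul, ih, Fock.rotate_one, mul_one]
    rw [h1, circleExp_int ⟨k, by linarith⟩, map_one, mul_one]))

lemma rotRep_coe (l : D.dual) (m : ℕ) (hm : m ∈ D.rotDegrees l) (θ : ℝ) :
    rotRep l m hm (Multiplicative.ofAdd (θ : AddCircle (m : ℝ))) =
      phaseOp (Fock 𝔥) (circleExp ((1 / 2) * ⟪(l : 𝔥), (l : 𝔥)⟫ * θ)) * Fock.rotate θ := rfl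

/-- Rotations preserve the kernel of the winding. -/
lemma rotExt_mem {l : D.dual} {m : ℕ} (hm : m ∈ D.rotDegrees l)
    (φ : Multiplicative (AddCircle (m : ℝ))) {x : ExtLoopGroup ε} :
    rotExt ε m hm.1 hm.2.1 φ x ∈ kerExt ε ↔ x ∈ kerExt ε := by
  obtain ⟨θ, rfl⟩ : ∃ θ : ℝ, φ = Multiplicative.ofAdd (θ : AddCircle (m : ℝ)) :=
    (QuotientAddGroup.mk'_surjective _ φ.toAdd).imp fun _ h => h.symm
  rw [rotExt_coe, rotExtReal_apply, mem_kerExt, mem_kerExt, pathWinding_rotLoop]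

/-- The operators `R_{χ, l}` intertwine `W_{χ, l}` with its composition with the rotations. -/
lemma rotRep_weylRep (χ : AddChar D.interTorus Circle) {l : D.dual} {m : ℕ}
    (hm : m ∈ D.rotDegrees l) (φ : Multiplicative (AddCircle (m : ℝ))) (x : kerExt ε) :
    rotRep l m hm φ * weylRep ε χ l x =
      weylRep ε χ l ⟨rotExt ε m hm.1 hm.2.1 φ x.1, (rotExt_mem hm φ).2 x.2⟩ * rotRep l m hm φ := by
  obtain ⟨θ, rfl⟩ : ∃ θ : ℝ, φ = Multiplicative.ofAdd (θ : AddCircle (m : ℝ)) :=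
    (QuotientAddGroup.mk'_surjective _ φ.toAdd).imp fun _ h => h.symm
  have : CompleteSpace 𝔥 := FiniteDimensional.complete ℝ 𝔥
  obtain ⟨x, hx⟩ := x
  have hx' : pathWinding x.pt = 0 := hx
  have hr : pathWinding (rotLoop θ x.pt) = 0 := by rw [pathWinding_rotLoop, hx']
  have hl := isGluedLift_rotLoop θ (isGluedLift x.pt)
  have hper := periodic_of_winding (gluedLift_mem x.pt) (winding_of_ker hx')
  rw [rotRep_coe]
  change (phaseOp (Fock 𝔥) _ * Fock.rotate θ) *
    (phaseOp (Fock 𝔥) (χ (defect x.pt hx')) * phaseOp (Fock 𝔥) (avgPhase l x.pt) *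
      Fock.weyl (oscLoop x.pt hx') x.phase) =
    (phaseOp (Fock 𝔥) (χ (defect (rotLoop θ x.pt) hr)) *
      phaseOp (Fock 𝔥) (avgPhase l (rotLoop θ x.pt)) *
      Fock.weyl (oscLoop (rotLoop θ x.pt) hr) (rotPhase θ x.pt * x.phase)) *
    (phaseOp (Fock 𝔥) _ * Fock.rotate θ)
  have ea : avg (fun t => gluedLift x.pt (t - θ)) = avg (gluedLift x.pt) := integral_shift hper θ
  have e1 : defect (rotLoop θ x.pt) hr = defect x.pt hx' := by
    ext
    change x.pt.1.2.1.2 - pth x.pt 0 + pth x.pt (0 - θ) - pth (rotLoop θ x.pt) 1 =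
      x.pt.1.2.1.2 - pth x.pt 1
    have p1 : pth x.pt 1 = pth x.pt 0 := by
      have := hper 0
      rw [zero_add] at this
      rw [pth, pth, this]
    have p2 : pth x.pt (1 - θ) = pth x.pt (0 - θ) := by
      have := hper (0 - θ)
      rw [show 0 - θ + 1 = 1 - θ by ring] at this
      rw [pth, pth, this]
    rw [pth_rotLoop, p1, p2]
    abel
  have e2 : oscLoop (rotLoop θ x.pt) hr = ZeroMeanLoop.rot θ (oscLoop x.pt hx') := by
    ext t
    rw [oscLoop_eq hr hl, ea]
    rfl
  have e3 : avgPhase l (rotLoop θ x.pt) = avgPhase l x.pt := by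
    rw [avgPhase_eq l hl, ea]
    rfl
  have e4 : rotPhase θ x.pt = 1 := by
    rw [rotPhase, hx']
    simp [circleExp_zero]
  rw [e1, e2, e3, e4, one_mul, ← map_mul]
  generalize χ (defect x.pt hx') * avgPhase l x.pt = c
  have := Fock.rotate_weyl θ (oscLoop x.pt hx') x.phase
  generalize circleExp (1 / 2 * ⟪(l : 𝔥), (l : 𝔥)⟫ * θ) = d
  calc _ = phaseOp (Fock 𝔥) d * ((Fock.rotate θ * phaseOp (Fock 𝔥) c) *
        Fock.weyl (oscLoop x.pt hx') x.phase) := by simp only [mul_assoc]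
    _ = phaseOp (Fock 𝔥) d * (phaseOp (Fock 𝔥) c *
        (Fock.rotate θ * Fock.weyl (oscLoop x.pt hx') x.phase)) := by
      rw [phaseOp_comm]; simp only [mul_assoc]
    _ = ((phaseOp (Fock 𝔥) c * phaseOp (Fock 𝔥) d) *
        Fock.weyl (ZeroMeanLoop.rot θ (oscLoop x.pt hx')) x.phase) * Fock.rotate θ := by
      rw [this, ← map_mul, mul_comm c d, map_mul]; simp only [mul_assoc]
    _ = _ := by
      rw [mul_assoc (phaseOp (Fock 𝔥) c), ← phaseOp_comm d]
      simp only [mul_assoc]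

end LatticeSpan
end

noncomputable section

open scoped RealInnerProductSpace ContDiff

/-! ### Hilbert direct sums -/

section DirectSum

open scoped ENNReal

variable {ι κ : Type*} {A : ι → Type*} {B : κ → Type*}
  [∀ i, NormedAddCommGroup (A i)] [∀ i, InnerProductSpace ℂ (A i)]
  [∀ j, NormedAddCommGroup (B j)] [∀ j, InnerProductSpace ℂ (B j)]

lemma memℓp_piCongr (e : ι ≃ κ) (u : ∀ i, A i ≃ₗᵢ[ℂ] B (e i)) {f : ∀ i, A i}
    {g : ∀ j, B j} (h : ∀ i, g (e i) = u i (f i)) : Memℓp g 2 ↔ Memℓp f 2 := by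
  rw [memℓp_gen_iff (by norm_num), memℓp_gen_iff (by norm_num), ← e.summable_iff]
  refine summable_congr fun i => ?_
  simp only [Function.comp, h, LinearIsometryEquiv.norm_map]

/-- The unitary operator between Hilbert direct sums given by a bijection of the index sets and
unitary operators between corresponding summands. -/
def lpCongr (e : ι ≃ κ) (u : ∀ i, A i ≃ₗᵢ[ℂ] B (e i)) : lp A 2 ≃ₗᵢ[ℂ] lp B 2 :=
  let F := Equiv.piCongr e fun i => (u i).toEquiv
  have hF : ∀ f i, F f (e i) = u i (f i) := fun f i =>
    Equiv.piCongr_apply_apply e (fun i => (u i).toEquiv) f i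
  { toFun := fun f => ⟨F f.1, (memℓp_piCongr e u (hF f.1)).2 f.2⟩
    invFun := fun g => ⟨F.symm g.1, (memℓp_piCongr e u (hF (F.symm g.1))).1
      ((F.apply_symm_apply g.1).symm ▸ g.2)⟩
    left_inv := fun f => Subtype.ext (F.symm_apply_apply _)
    right_inv := fun f => Subtype.ext (F.apply_symm_apply _)
    map_add' := fun f g => by
      refine Subtype.ext (funext fun j => ?_)
      obtain ⟨i, rfl⟩ := e.surjective j
      change F (f + g : lp A 2) (e i) = F f (e i) + F g (e i)
      simp only [hF]
      exact map_add (u i) (f i) (g i)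
    map_smul' := fun c f => by
      refine Subtype.ext (funext fun j => ?_)
      obtain ⟨i, rfl⟩ := e.surjective j
      change F (c • f : lp A 2) (e i) = c • F f (e i)
      simp only [hF]
      exact map_smul (u i) c (f i)
    norm_map' := fun f => by
      rw [lp.norm_eq_tsum_rpow (by norm_num), lp.norm_eq_tsum_rpow (by norm_num), ← e.tsum_eq]
      congr 1
      refine tsum_congr fun i => ?_
      change ‖F f (e i)‖ ^ _ = _
      rw [hF, LinearIsometryEquiv.norm_map] }

lemma lpCongr_apply (e : ι ≃ κ) (u : ∀ i, A i ≃ₗᵢ[ℂ] B (e i)) (f : lp A 2) (i : ι) :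
    lpCongr e u f (e i) = u i (f i) :=
  Equiv.piCongr_apply_apply e (fun i => (u i).toEquiv) f.1 i

/-- The element `a` of the `i`-th summand of a Hilbert direct sum. -/
def lpSingle (i : ι) (a : A i) : lp A 2 :=
  letI := Classical.decEq ι
  lp.single 2 i a

lemma lpSingle_self (i : ι) (a : A i) : lpSingle i a i = a := by
  classical
  simp [lpSingle]

lemma lpSingle_ne {i j : ι} (h : j ≠ i) (a : A i) : lpSingle i a j = 0 := by
  classical
  simp [lpSingle, h]

lemma lpCongr_single (e : ι ≃ κ) (u : ∀ i, A i ≃ₗᵢ[ℂ] B (e i)) (i : ι) (a : A i) :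
    lpCongr e u (lpSingle i a) = lpSingle (e i) (u i a) := by
  refine lp.ext (funext fun j => ?_)
  obtain ⟨k, rfl⟩ := e.surjective j
  rw [lpCongr_apply]
  by_cases h : k = i
  · subst h
    rw [lpSingle_self, lpSingle_self]
  · rw [lpSingle_ne h, lpSingle_ne (e.injective.ne h), map_zero]

lemma lp_ext_single {L : Type*} [NormedAddCommGroup L] [InnerProductSpace ℂ L]
    {U V : lp A 2 ≃ₗᵢ[ℂ] L} (h : ∀ i a, U (lpSingle i a) = V (lpSingle i a)) : U = V := by
  letI := Classical.decEq ι
  refine LinearIsometryEquiv.ext fun f => ?_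
  have hs := lp.hasSum_single (p := 2) (by norm_num) f
  have h1 := hs.map U.toLinearEquiv.toLinearMap.toAddMonoidHom U.continuous
  have h2 := hs.map V.toLinearEquiv.toLinearMap.toAddMonoidHom V.continuous
  have e : (U.toLinearEquiv.toLinearMap.toAddMonoidHom ∘ fun i => lp.single 2 i (f i)) =
      V.toLinearEquiv.toLinearMap.toAddMonoidHom ∘ fun i => lp.single 2 i (f i) :=
    funext fun i => h i (f i)
  rw [e] at h1
  exact h1.unique h2

/-- A direct sum of unitary operators. -/
def lpMap {A' : ι → Type*} [∀ i, NormedAddCommGroup (A' i)] [∀ i, InnerProductSpace ℂ (A' i)]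
    (u : ∀ i, A i ≃ₗᵢ[ℂ] A' i) : lp A 2 ≃ₗᵢ[ℂ] lp A' 2 :=
  lpCongr (Equiv.refl ι) u

lemma lpMap_single {A' : ι → Type*} [∀ i, NormedAddCommGroup (A' i)]
    [∀ i, InnerProductSpace ℂ (A' i)] (u : ∀ i, A i ≃ₗᵢ[ℂ] A' i) (i : ι) (a : A i) :
    lpMap u (lpSingle i a) = lpSingle i (u i a) :=
  lpCongr_single (Equiv.refl ι) u i a

/-- The Hilbert direct sum of unitary representations. -/
def directSumRep {G : Type*} [Group G] (ρ : ∀ i, G →* (A i ≃ₗᵢ[ℂ] A i)) :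
    G →* (lp A 2 ≃ₗᵢ[ℂ] lp A 2) where
  toFun g := lpMap fun i => ρ i g
  map_one' := lp_ext_single fun i a => by
    rw [lpMap_single, map_one]; rfl
  map_mul' g h := lp_ext_single fun i a => by
    rw [lpMap_single, map_mul]
    change _ = lpMap (fun i => ρ i g) (lpMap (fun i => ρ i h) (lpSingle i a))
    rw [lpMap_single, lpMap_single]
    rfl

end DirectSum

/-! ### Induced representations -/

section Induced

variable {G : Type*} [Group G] {N : Subgroup G} {K : Type*} [NormedAddCommGroup K]
  [InnerProductSpace ℂ K] (Q : N →* (K ≃ₗᵢ[ℂ] K))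

/-- The equivalence relation on pairs `(x, v)`, where `x` is in a given left coset `σ` of `N`,
generated by `(x h, v) ∼ (x, Q(h) v)` for `h ∈ N`. -/
def indSetoid (σ : G ⧸ N) : Setoid ({x : G // (x : G ⧸ N) = σ} × K) where
  r p q := ∃ h : N, (q.1 : G) = p.1 * h ∧ p.2 = Q h q.2
  iseqv :=
    { refl := fun p => ⟨1, by simp, by rw [map_one]; rfl⟩
      symm := by
        rintro ⟨⟨x, hx⟩, v⟩ ⟨⟨y, hy⟩, w⟩ ⟨h, h1, h2⟩
        refine ⟨h⁻¹, ?_, ?_⟩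
        · dsimp only at h1 ⊢
          rw [h1]; simp
        · dsimp only at h2 ⊢
          rw [h2, map_inv]
          exact ((Q h).symm_apply_apply w).symm
      trans := by
        rintro ⟨⟨x, hx⟩, v⟩ ⟨⟨y, hy⟩, w⟩ ⟨⟨z, hz⟩, u⟩ ⟨h, h1, h2⟩ ⟨k, k1, k2⟩
        refine ⟨h * k, ?_, ?_⟩
        · dsimp only at h1 k1 ⊢
          rw [k1, h1, Subgroup.coe_mul, mul_assoc]
        · dsimp only at h2 k2 ⊢
          rw [h2, k2, map_mul]
          rfl }

/-- The fibre over the coset `σ` of the homogeneous Hilbert bundle `G ×_N K`. -/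
def IndFiber (σ : G ⧸ N) : Type _ := Quotient (indSetoid Q σ)

namespace IndFiber

variable {Q} {σ : G ⧸ N}

lemma inv_mul_mem {x y : G} (hx : (x : G ⧸ N) = σ) (hy : (y : G ⧸ N) = σ) : x⁻¹ * y ∈ N :=
  QuotientGroup.eq.1 (hx.trans hy.symm)

/-- The element `[x, v]` of the fibre over `x N`. -/
def mk (x : G) (hx : (x : G ⧸ N) = σ) (v : K) : IndFiber Q σ :=
  Quotient.mk (indSetoid Q σ) (⟨x, hx⟩, v)

lemma mk_eq {x y : G} (hx : (x : G ⧸ N) = σ) (hy : (y : G ⧸ N) = σ) (v : K) :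
    (mk y hy v : IndFiber Q σ) = mk x hx (Q ⟨x⁻¹ * y, inv_mul_mem hx hy⟩ v) :=
  (Quotient.sound (s := indSetoid Q σ)
    ⟨⟨x⁻¹ * y, inv_mul_mem hx hy⟩, by simp, rfl⟩ : mk x hx _ = mk y hy v).symm

/-- `v ↦ [x, v]` is a bijection. -/
def mkEquiv (x : G) (hx : (x : G ⧸ N) = σ) : K ≃ IndFiber Q σ where
  toFun := mk x hx
  invFun := Quotient.lift (fun p => Q ⟨x⁻¹ * p.1.1, inv_mul_mem hx p.1.2⟩ p.2) (by
    rintro ⟨⟨y, hy⟩, v⟩ ⟨⟨z, hz⟩, w⟩ ⟨h, h1, h2⟩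
    dsimp only at h1 h2 ⊢
    rw [h2]
    change (Q _ * Q h) w = _
    rw [← map_mul]
    congr 2
    ext
    change x⁻¹ * y * h = x⁻¹ * z
    rw [h1, mul_assoc])
  left_inv v := by
    change Q ⟨x⁻¹ * x, _⟩ v = v
    have : (⟨x⁻¹ * x, inv_mul_mem hx hx⟩ : N) = 1 := by ext; simp
    rw [this, map_one]
    rfl
  right_inv := by
    rintro ⟨⟨y, hy⟩, v⟩
    exact (mk_eq hx hy v).symm

variable (Q σ) in
/-- The bijection used to transport the structure; it does not matter which one, by `mkIso`. -/
def out : IndFiber Q σ ≃ K := (mkEquiv σ.out (QuotientGroup.out_eq' σ)).symm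

instance : AddCommGroup (IndFiber Q σ) := (out Q σ).addCommGroup

instance : Module ℂ (IndFiber Q σ) := (out Q σ).module ℂ

variable (Q σ) in
/-- The bijection used to transport the structure, as a linear equivalence. -/
def outLin : IndFiber Q σ ≃ₗ[ℂ] K := (out Q σ).linearEquiv ℂ

instance : NormedAddCommGroup (IndFiber Q σ) :=
  NormedAddCommGroup.induced _ _ (outLin Q σ) (outLin Q σ).injective

instance : InnerProductSpace ℂ (IndFiber Q σ) where
  norm_smul_le c v := by
    change ‖outLin Q σ (c • v)‖ ≤ ‖c‖ * ‖outLin Q σ v‖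
    rw [map_smul, norm_smul]
  inner v w := inner ℂ (outLin Q σ v) (outLin Q σ w)
  norm_sq_eq_re_inner v := norm_sq_eq_re_inner (𝕜 := ℂ) (outLin Q σ v)
  conj_inner_symm v w := inner_conj_symm (outLin Q σ v) (outLin Q σ w)
  add_left u v w := by
    rw [map_add, inner_add_left]
  smul_left v w c := by
    rw [map_smul, inner_smul_left]

/-- The map `v ↦ [x, v]`, which is unitary for every representative `x` of the coset. -/
def mkIso (x : G) (hx : (x : G ⧸ N) = σ) : K ≃ₗᵢ[ℂ] IndFiber Q σ :=
  (Q ⟨σ.out⁻¹ * x, inv_mul_mem (QuotientGroup.out_eq' σ) hx⟩).trans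
    { (outLin Q σ).symm with
      norm_map' := fun v => congrArg norm ((outLin Q σ).apply_symm_apply v) }

lemma mkIso_apply (x : G) (hx : (x : G ⧸ N) = σ) (v : K) :
    (mkIso x hx v : IndFiber Q σ) = mk x hx v :=
  (mk_eq (QuotientGroup.out_eq' σ) hx v).symm

end IndFiber

/-- The space of the induced representation: the Hilbert direct sum of the fibres, that is the
square-summable sections of `G ×_N K → G / N`. -/
abbrev IndSpace := lp (fun σ : G ⧸ N => IndFiber Q σ) 2

variable {Q}

/-- The section supported at the coset of `x` with value `[x, v]` there. -/
def indDelta (x : G) (v : K) : IndSpace Q := lpSingle (x : G ⧸ N) (IndFiber.mk x rfl v)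

lemma ext_indDelta {L : Type*} [NormedAddCommGroup L] [InnerProductSpace ℂ L]
    {U V : IndSpace Q ≃ₗᵢ[ℂ] L} (h : ∀ x v, U (indDelta x v) = V (indDelta x v)) : U = V := by
  refine lp_ext_single fun σ a => ?_
  obtain ⟨x, rfl⟩ := QuotientGroup.mk_surjective σ
  obtain ⟨v, rfl⟩ := (IndFiber.mkEquiv x rfl).surjective a
  exact h x v

/-- The bijection of cosets induced by a bijection of the group. -/
def cosetEquiv (s : G ≃ G) (hs : ∀ x y, x⁻¹ * y ∈ N ↔ (s x)⁻¹ * s y ∈ N) : G ⧸ N ≃ G ⧸ N :=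
  Quotient.congr s fun x y => by
    rw [QuotientGroup.leftRel_apply, QuotientGroup.leftRel_apply, hs]

/-- The map `[x, v] ↦ [s x, R v]` from the fibre at `σ` to the fibre at `s σ`. -/
def indOpFiber (s : G ≃ G) (hs : ∀ x y, x⁻¹ * y ∈ N ↔ (s x)⁻¹ * s y ∈ N) (R : K ≃ₗᵢ[ℂ] K)
    (σ : G ⧸ N) : IndFiber Q σ ≃ₗᵢ[ℂ] IndFiber Q (cosetEquiv s hs σ) :=
  ((IndFiber.mkIso σ.out (QuotientGroup.out_eq' σ)).symm.trans R).trans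
    (IndFiber.mkIso (s σ.out)
      (congrArg (cosetEquiv s hs) (QuotientGroup.out_eq' σ) : cosetEquiv s hs (σ.out : G ⧸ N) = _))

/-- The operator `[x, v] ↦ [s x, R v]` on the space of the induced representation. -/
def indOp (s : G ≃ G) (hs : ∀ x y, x⁻¹ * y ∈ N ↔ (s x)⁻¹ * s y ∈ N) (R : K ≃ₗᵢ[ℂ] K) :
    IndSpace Q ≃ₗᵢ[ℂ] IndSpace Q :=
  lpCongr (cosetEquiv s hs) (indOpFiber s hs R)

lemma indOp_indDelta (s : G ≃ G) (hs : ∀ x y, x⁻¹ * y ∈ N ↔ (s x)⁻¹ * s y ∈ N) (R : K ≃ₗᵢ[ℂ] K)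
    (hR : ∀ x y (h : x⁻¹ * y ∈ N), R * Q ⟨x⁻¹ * y, h⟩ = Q ⟨(s x)⁻¹ * s y, (hs x y).1 h⟩ * R)
    (x : G) (v : K) : indOp s hs R (indDelta x v : IndSpace Q) = indDelta (s x) (R v) := by
  have h1 := QuotientGroup.out_eq' (x : G ⧸ N)
  have h2 : ((s (x : G ⧸ N).out : G) : G ⧸ N) = (s x : G) :=
    congrArg (cosetEquiv s hs) h1
  have e1 : (IndFiber.mkIso _ h1).symm (IndFiber.mk x rfl v : IndFiber Q (x : G ⧸ N)) =
      Q ⟨((x : G ⧸ N).out)⁻¹ * x, IndFiber.inv_mul_mem h1 rfl⟩ v := by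
    rw [LinearIsometryEquiv.symm_apply_eq, IndFiber.mkIso_apply]
    exact IndFiber.mk_eq _ _ _
  have e2 : R (Q ⟨((x : G ⧸ N).out)⁻¹ * x, IndFiber.inv_mul_mem h1 rfl⟩ v) = Q _ (R v) :=
    LinearIsometryEquiv.congr_fun (hR _ x (IndFiber.inv_mul_mem h1 rfl)) v
  refine (lpCongr_single (cosetEquiv s hs) (indOpFiber s hs R) (x : G ⧸ N) _).trans ?_
  refine congrArg (lpSingle (A := fun σ : G ⧸ N => IndFiber Q σ) ((s x : G) : G ⧸ N)) ?_
  change IndFiber.mkIso (s (x : G ⧸ N).out) h2 (R ((IndFiber.mkIso _ h1).symm _)) = _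
  rw [e1, IndFiber.mkIso_apply, e2]
  exact (IndFiber.mk_eq _ _ _).symm

/-- The induced representation, `g [x, v] = [g x, v]`. -/
def indRep (Q : N →* (K ≃ₗᵢ[ℂ] K)) : G →* (IndSpace Q ≃ₗᵢ[ℂ] IndSpace Q) :=
  have hs : ∀ g x y : G, x⁻¹ * y ∈ N ↔ (Equiv.mulLeft g x)⁻¹ * Equiv.mulLeft g y ∈ N :=
    fun g x y => by
      rw [Equiv.coe_mulLeft, mul_inv_rev, mul_assoc, inv_mul_cancel_left]
  have h : ∀ g x v, indOp (Equiv.mulLeft g) (hs g) 1 (indDelta x v : IndSpace Q) =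
      indDelta (g * x) v := fun g x v => by
    refine indOp_indDelta _ (hs g) _ (fun x y h => ?_) x v
    rw [one_mul, mul_one]
    congr 2
    rw [Equiv.coe_mulLeft, mul_inv_rev, mul_assoc, inv_mul_cancel_left]
  { toFun := fun g => indOp (Equiv.mulLeft g) (hs g) 1
    map_one' := ext_indDelta fun x v => by rw [h, one_mul]; rfl
    map_mul' := fun g g' => ext_indDelta fun x v => by
      rw [h, mul_assoc, ← h, ← h]; rfl }

lemma indRep_indDelta (g x : G) (v : K) :
    indRep Q g (indDelta x v) = indDelta (g * x) v := by
  refine indOp_indDelta _ _ _ (fun x y h => ?_) x v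
  rw [one_mul, mul_one]
  congr 2
  rw [Equiv.coe_mulLeft, mul_inv_rev, mul_assoc, inv_mul_cancel_left]

/-- An action `s` of a group on `G` by automorphisms that preserve `N`, together with operators `R`
on `K` that intertwine it with `Q`, acts on the space of the induced representation by
`φ [x, v] = [s(φ) x, R(φ) v]`. -/
def indAction {P : Type*} [Group P] (s : P →* MulAut G) (hs : ∀ φ x, s φ x ∈ N ↔ x ∈ N)
    (R : P →* (K ≃ₗᵢ[ℂ] K))
    (hR : ∀ φ (x : N), R φ * Q x = Q ⟨s φ x.1, (hs φ x.1).2 x.2⟩ * R φ) :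
    P →* (IndSpace Q ≃ₗᵢ[ℂ] IndSpace Q) :=
  have hs' : ∀ φ x y, x⁻¹ * y ∈ N ↔ ((s φ).toEquiv x)⁻¹ * (s φ).toEquiv y ∈ N := fun φ x y => by
    change _ ↔ (s φ x)⁻¹ * s φ y ∈ N
    rw [← map_inv, ← map_mul, hs]
  have h : ∀ φ x v, indOp (s φ).toEquiv (hs' φ) (R φ) (indDelta x v : IndSpace Q) =
      indDelta (s φ x) (R φ v) := fun φ x v => by
    refine indOp_indDelta _ (hs' φ) _ (fun x y h => ?_) x v
    rw [hR]
    congr 3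
    change s φ (x⁻¹ * y) = (s φ x)⁻¹ * s φ y
    rw [map_mul, map_inv]
  { toFun := fun φ => indOp (s φ).toEquiv (hs' φ) (R φ)
    map_one' := ext_indDelta fun x v => by rw [h, map_one, map_one]; rfl
    map_mul' := fun φ ψ => ext_indDelta fun x v => by
      rw [h, map_mul, map_mul]
      change indDelta (s φ (s ψ x)) (R φ (R ψ v)) = _
      rw [← h, ← h]; rfl }

lemma indAction_indDelta {P : Type*} [Group P] (s : P →* MulAut G) (hs : ∀ φ x, s φ x ∈ N ↔ x ∈ N)
    (R : P →* (K ≃ₗᵢ[ℂ] K))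
    (hR : ∀ φ (x : N), R φ * Q x = Q ⟨s φ x.1, (hs φ x.1).2 x.2⟩ * R φ) (φ : P) (x : G) (v : K) :
    indAction s hs R hR φ (indDelta x v) = indDelta (s φ x) (R φ v) := by
  refine indOp_indDelta _ _ _ (fun x y h => ?_) x v
  rw [hR]
  congr 3
  change s φ (x⁻¹ * y) = (s φ x)⁻¹ * s φ y
  rw [map_mul, map_inv]

end Induced
end

noncomputable section

open scoped RealInnerProductSpace ContDiff

/-! ### Semidirect products -/

section Semidirect

variable {G : Type*} [Group G] {N : Subgroup G} {P : Type*} [Group P]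

/-- The restriction of an action by automorphisms to an invariant subgroup. -/
def restrictAut (s : P →* MulAut G) (hs : ∀ φ x, s φ x ∈ N ↔ x ∈ N) : P →* MulAut N where
  toFun φ :=
    { toFun := fun x => ⟨s φ x, (hs φ x).2 x.2⟩
      invFun := fun x => ⟨s φ⁻¹ x, (hs φ⁻¹ x).2 x.2⟩
      left_inv := fun x => Subtype.ext (by
        change s φ⁻¹ (s φ x.1) = x.1
        rw [map_inv]; exact (s φ).symm_apply_apply x.1)
      right_inv := fun x => Subtype.ext (by
        change s φ (s φ⁻¹ x.1) = x.1
        rw [map_inv]; exact (s φ).apply_symm_apply x.1)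
      map_mul' := fun x y => Subtype.ext (map_mul (s φ) x.1 y.1) }
  map_one' := MulEquiv.ext fun x => Subtype.ext (by
    change s 1 x.1 = x.1
    rw [map_one]; rfl)
  map_mul' φ ψ := MulEquiv.ext fun x => Subtype.ext (by
    change s (φ * ψ) x.1 = s φ (s ψ x.1)
    rw [map_mul]; rfl)

/-- The representation of a semidirect product that is given by representations `Q`, `R` of its
factors on the same space such that `R(φ) Q(x) = Q(φ · x) R(φ)`. -/
def semidirectRep {K : Type*} [NormedAddCommGroup K] [InnerProductSpace ℂ K] {M : Type*} [Group M]
    {s : P →* MulAut M} (Q : M →* (K ≃ₗᵢ[ℂ] K)) (R : P →* (K ≃ₗᵢ[ℂ] K))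
    (h : ∀ φ x, R φ * Q x = Q (s φ x) * R φ) : M ⋊[s] P →* (K ≃ₗᵢ[ℂ] K) :=
  SemidirectProduct.lift Q R fun φ => MonoidHom.ext fun x => by
    change Q (s φ x) = R φ * Q x * (R φ)⁻¹
    rw [h, mul_inv_cancel_right]

lemma semidirectRep_apply {K : Type*} [NormedAddCommGroup K] [InnerProductSpace ℂ K] {M : Type*}
    [Group M] {s : P →* MulAut M} (Q : M →* (K ≃ₗᵢ[ℂ] K)) (R : P →* (K ≃ₗᵢ[ℂ] K))
    (h : ∀ φ x, R φ * Q x = Q (s φ x) * R φ) (g : M ⋊[s] P) :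
    semidirectRep Q R h g = Q g.left * R g.right := rfl

lemma indAction_comm {K : Type*} [NormedAddCommGroup K] [InnerProductSpace ℂ K]
    {Q : N →* (K ≃ₗᵢ[ℂ] K)} (s : P →* MulAut G) (hs : ∀ φ x, s φ x ∈ N ↔ x ∈ N)
    (R : P →* (K ≃ₗᵢ[ℂ] K))
    (hR : ∀ φ (x : N), R φ * Q x = Q ⟨s φ x.1, (hs φ x.1).2 x.2⟩ * R φ) (φ : P) (x : N) :
    indAction s hs R hR φ * (indRep Q).comp N.subtype x =
      (indRep Q).comp N.subtype (restrictAut s hs φ x) * indAction s hs R hR φ := by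
  refine ext_indDelta fun y v => ?_
  rw [LinearIsometryEquiv.coe_mul, LinearIsometryEquiv.coe_mul, Function.comp_apply,
    Function.comp_apply, MonoidHom.comp_apply, MonoidHom.comp_apply, indRep_indDelta,
    indAction_indDelta, indAction_indDelta, indRep_indDelta, Subgroup.subtype_apply,
    Subgroup.subtype_apply, map_mul]
  rfl

end Semidirect

namespace LatticeSpan

variable {𝔱w 𝔥 𝔱b : Type*}
  [NormedAddCommGroup 𝔱w] [InnerProductSpace ℝ 𝔱w]
  [NormedAddCommGroup 𝔥] [InnerProductSpace ℝ 𝔥]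
  [NormedAddCommGroup 𝔱b] [InnerProductSpace ℝ 𝔱b]

/-! ### Winding elements and cosets -/

variable (D : LatticeSpan 𝔱w 𝔥 𝔱b)

/-- The homomorphism `(λ_w, λ_b) ↦ πw⁻¹ λ_w - πb⁻¹ λ_b` from `Λw ⊕ Λb` onto `Λw - Λb`. -/
def latDiff : D.Λw × D.Λb →+ D.diff :=
  AddMonoidHom.mk' (fun p => ⟨D.πw.symm p.1 - D.πb.symm p.2,
    D.πw.symm p.1, by rw [mem_latW, D.πw.apply_symm_apply]; exact p.1.2,
    D.πb.symm p.2, by rw [mem_latB, D.πb.apply_symm_apply]; exact p.2.2, rfl⟩) fun p p' => by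
    ext
    simp only [Prod.fst_add, Prod.snd_add, Submodule.coe_add, map_add, AddSubgroup.coe_add]
    abel

lemma latDiff_surjective : Function.Surjective D.latDiff := by
  rintro ⟨_, a, ha, b, hb, rfl⟩
  refine ⟨(⟨D.πw a, ha⟩, ⟨D.πb b, hb⟩), Subtype.ext ?_⟩
  change D.πw.symm (D.πw a) - D.πb.symm (D.πb b) = a - b
  simp

/-- The lift `t ↦ πb⁻¹ λ_b + t (πw⁻¹ λ_w - πb⁻¹ λ_b)` of the loop `γ_[λ_w, λ_b]`. -/
def windingLift (p : D.Λw × D.Λb) (t : ℝ) : 𝔥 := D.πb.symm p.2 + t • (D.latDiff p : 𝔥)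

variable {D}

lemma windingLift_mem (p : D.Λw × D.Λb) : D.windingLift p ∈ D.quasiPeriodic :=
  ⟨contDiff_const.add (contDiff_id.smul contDiff_const), D.latDiff p, (D.latDiff p).2, fun t => by
    rw [windingLift, windingLift, add_smul, one_smul, add_assoc]⟩

/-- The loop `γ_[λ_w, λ_b]`, with value `0` at `q`. -/
def windingElt (p : D.Λw × D.Λb) : D.loopGroup :=
  ofLift (D.windingLift p) (windingLift_mem p) 0
    (by
      have : D.windingLift p 1 = D.πw.symm p.1 := by
        rw [windingLift, one_smul]
        change D.πb.symm p.2 + (D.πw.symm p.1 - D.πb.symm p.2) = _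
        abel
      rw [this, map_zero, D.πw.apply_symm_apply]
      exact ((QuotientAddGroup.eq_zero_iff _).2 p.1.2).symm)
    (by
      have : D.windingLift p 0 = D.πb.symm p.2 := by
        rw [windingLift, zero_smul, add_zero]
      rw [this, map_zero, D.πb.apply_symm_apply]
      exact ((QuotientAddGroup.eq_zero_iff _).2 p.2.2).symm)

lemma pathWinding_windingElt (p : D.Λw × D.Λb) : pathWinding (windingElt p) = D.latDiff p := by
  ext
  have h : D.IsGluedLift (windingElt p).1 (D.windingLift p) :=
    isGluedLift_ofLift _ (windingLift_mem p) _ _ _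
  rw [h.winding_eq, winding, windingLift, windingLift]
  simp

lemma windingHom_surjective (ε : D.CommutatorCocycle) :
    Function.Surjective (ExtLoopGroup.windingHom ε) := fun δ => by
  obtain ⟨p, hp⟩ := D.latDiff_surjective δ.toAdd
  exact ⟨⟨windingElt p, 1⟩, (pathWinding_windingElt p).trans hp⟩

/-- The coset of `ker (Δ' ∘ Pth)` that consists of all `(γ, z)` with `Δ' (Pth γ) = δ`; that is, the
inverse of the isomorphism onto `Λw - Λb` induced by `Δ' ∘ Pth`. -/
def coset (ε : D.CommutatorCocycle) (δ : D.diff) : ExtLoopGroup ε ⧸ kerExt ε :=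
  (QuotientGroup.quotientKerEquivOfSurjective _ (windingHom_surjective ε)).symm
    (Multiplicative.ofAdd δ)

lemma mk_eq_coset {ε : D.CommutatorCocycle} {δ : D.diff} {x : ExtLoopGroup ε} :
    (x : ExtLoopGroup ε ⧸ kerExt ε) = coset ε δ ↔ pathWinding x.pt = δ :=
  (QuotientGroup.quotientKerEquivOfSurjective _ (windingHom_surjective ε)).eq_symm_apply

/-- The element `(γ_[λ_w, λ_b], 1)` is a representative of the coset of `πw⁻¹ λ_w - πb⁻¹ λ_b`. -/
lemma windingElt_coset (ε : D.CommutatorCocycle) {δ : D.diff} {p : D.Λw × D.Λb}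
    (hp : D.latDiff p = δ) :
    ((⟨windingElt p, 1⟩ : ExtLoopGroup ε) : ExtLoopGroup ε ⧸ kerExt ε) = coset ε δ :=
  mk_eq_coset.2 ((pathWinding_windingElt p).trans hp)

/-! ### The restriction of the induced representation -/

variable [FiniteDimensional ℝ 𝔥]

/-- The action of the `m`-fold cover of the rotation group on `ker (Δ' ∘ Pth)`. -/
def rotKer (ε : D.CommutatorCocycle) (m : ℕ) (hm : 0 < m) (hn : D.torsionIndex ∣ m) :
    Multiplicative (AddCircle (m : ℝ)) →* MulAut (kerExt ε) :=
  restrictAut (rotExt ε m hm hn) fun φ _ =>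
    rotExt_mem (l := 0) ⟨hm, hn, 0, by simp⟩ φ

/-- The semidirect product of `ker (Δ' ∘ Pth)` with the `m`-fold cover of the rotation group. -/
abbrev KerRot (ε : D.CommutatorCocycle) (m : ℕ) (hm : 0 < m) (hn : D.torsionIndex ∣ m) :=
  kerExt ε ⋊[rotKer ε m hm hn] Multiplicative (AddCircle (m : ℝ))

/-- `W_{χ, l}` and `R_{χ, l}` together, as a representation of the semidirect product. -/
def weylRotRep (ε : D.CommutatorCocycle) (χ : AddChar D.interTorus Circle) (l : D.dual) (m : ℕ)
    (hm : m ∈ D.rotDegrees l) : KerRot ε m hm.1 hm.2.1 →* (Fock 𝔥 ≃ₗᵢ[ℂ] Fock 𝔥) :=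
  semidirectRep (weylRep ε χ l) (rotRep l m hm) (rotRep_weylRep χ hm)

/-- The operators `Ind R_{χ, l}` on the space of `Ind W_{χ, l}`, `[Φ] [x, v] = [[Φ] · x, R[Φ] v]`. -/
def indRotRep (ε : D.CommutatorCocycle) (χ : AddChar D.interTorus Circle) (l : D.dual) (m : ℕ)
    (hm : m ∈ D.rotDegrees l) : Multiplicative (AddCircle (m : ℝ)) →*
      (IndSpace (weylRep ε χ l) ≃ₗᵢ[ℂ] IndSpace (weylRep ε χ l)) :=
  indAction (rotExt ε m hm.1 hm.2.1) (fun φ _ => rotExt_mem hm φ) (rotRep l m hm)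
    (rotRep_weylRep χ hm)

/-- The restriction of `Ind W_{χ, l}` to `ker (Δ' ∘ Pth)`, together with `Ind R_{χ, l}`, as a
representation of the semidirect product. -/
def resIndRep (ε : D.CommutatorCocycle) (χ : AddChar D.interTorus Circle) (l : D.dual) (m : ℕ)
    (hm : m ∈ D.rotDegrees l) : KerRot ε m hm.1 hm.2.1 →*
      (IndSpace (weylRep ε χ l) ≃ₗᵢ[ℂ] IndSpace (weylRep ε χ l)) :=
  semidirectRep ((indRep (weylRep ε χ l)).comp (kerExt ε).subtype) (indRotRep ε χ l m hm)
    (indAction_comm (rotExt ε m hm.1 hm.2.1) (fun φ _ => rotExt_mem hm φ) (rotRep l m hm)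
      (rotRep_weylRep χ hm))

/-- The unitary map `[(γ_[λ_w, λ_b], 1), v] ↦ v` from the summand at the coset of
`δ = πw⁻¹ λ_w - πb⁻¹ λ_b` to `ℂ_χ ⊗ ℂ_{l - δ} ⊗ 𝒮 = 𝒮`. -/
def fiberIso (ε : D.CommutatorCocycle) (χ : AddChar D.interTorus Circle) (l : D.dual)
    {δ : D.diff} (p : D.Λw × D.Λb) (hp : D.latDiff p = δ) :
    IndFiber (weylRep ε χ l) (coset ε δ) ≃ₗᵢ[ℂ] Fock 𝔥 :=
  (IndFiber.mkIso ⟨windingElt p, 1⟩ (windingElt_coset ε hp)).symm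

lemma fiberIso_mk (ε : D.CommutatorCocycle) (χ : AddChar D.interTorus Circle) (l : D.dual)
    {δ : D.diff} (p : D.Λw × D.Λb) (hp : D.latDiff p = δ) (v : Fock 𝔥) :
    fiberIso ε χ l p hp (IndFiber.mk ⟨windingElt p, 1⟩ (windingElt_coset ε hp) v) = v := by
  rw [fiberIso, LinearIsometryEquiv.symm_apply_eq, IndFiber.mkIso_apply]

end LatticeSpan
end

noncomputable section

open scoped RealInnerProductSpace ContDiff

/-! Write `λ` for an element of `Λw - Λb`, choose a pre-image `p` of it, and let `x = (γ_p, 1)` be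
the corresponding winding element. The kernel of the winding map is normal, so it preserves each
summand of the induced representation. The vectors of the summand at the coset of `λ` are the
classes `[x, v]`. The theorem therefore comes down to moving kernel elements and rotations past `x`,
and two relations in the central extension do this.

The first relation is `h x = x h'` for `h = (ρ, z)` in the kernel, where `h'` is `h` with its phase
multiplied by `exp (-2πi ⟨λ, avg Η⟩)` and `Η` is a lift of `ρ` (`mul_windingElt`). The loop group is
abelian, so only cocycles are compared. The factor `ε` is `1` because `ρ` has winding zero, and an
integration by parts computes the difference of the two area terms (`area_windingLift_left`,
`area_windingLift_right`). Hence `h [x, v] = [x, W_{χ,l}(h') v]`. The extra phase is the inverse of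
the character `λ` evaluated at the average, so it turns `l` into `l - λ` while the `χ` factor and
the Weyl operator stay as they are: `W_{χ,l}(h') = W_{χ,l-λ}(h)` (`weylRep_phase_mul`).

The second relation is `Φ_θ · x = x c`, where `c` is the constant loop at `exp_H (-θ λ)` with phase
`exp (πi ⟨λ, λ⟩ θ)` (`rotExtReal_windingElt`). It holds because the lift of `γ_p` is affine in `t`.
The representation `W_{χ,l}` sends `c` to a scalar (`weylRep_constLoop`). Together with the factor
`exp (πi ⟨l, l⟩ θ)` of `R_{χ,l}` it completes the square to `exp (πi ⟨l - λ, l - λ⟩ θ)`, which is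
the factor of `R_{χ,l-λ}`.

For both sides to carry an action of the same cover `ℝ / mℤ`, the admissible degrees for `l` and `l
- λ` have to coincide. If `n` divides `m` then `m λ` lies in `Γ`, so `m ⟨l, λ⟩` is an integer and `m
⟨λ, λ⟩` is even. Consequently `m ⟨l, l⟩` and `m ⟨l - λ, l - λ⟩` have the same parity class
(`rotDegrees_sub`). Some degree exists because `Γ^∨ / Γ` is killed by the determinant of a Gram
matrix of `Γ` (`exists_nsmul_dual_mem`).

The global statement follows because the cosets are indexed by `Λw - Λb` and an isometry on a
Hilbert direct sum is determined by its values on the summands (`sumIso_resIndRep`). -/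

lemma Fock.weyl_mul_phase {E : Type*} [NormedAddCommGroup E] [InnerProductSpace ℝ E]
    [FiniteDimensional ℝ E] (ξ : ZeroMeanLoop E) (z w : Circle) :
    Fock.weyl ξ (z * w) = phaseOp (Fock E) z * Fock.weyl ξ w := by
  -- The coherent vectors span a dense subspace, and on each of them the central phase is a plain
  -- scalar factor.
  refine Fock.ext_coh fun κ => ?_
  rw [LinearIsometryEquiv.coe_mul, Function.comp_apply, phaseOp_apply, Fock.weyl_coh,
    Fock.weyl_coh, smul_smul, Circle.coe_mul, mul_assoc]

lemma directSumRep_single {ι : Type*} {A : ι → Type*} [∀ i, NormedAddCommGroup (A i)]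
    [∀ i, InnerProductSpace ℂ (A i)] {G : Type*} [Group G] (ρ : ∀ i, G →* (A i ≃ₗᵢ[ℂ] A i))
    (g : G) (i : ι) (a : A i) :
    directSumRep ρ g (lpSingle i a) = lpSingle i (ρ i g a) :=
  lpMap_single (fun i => ρ i g) i a

/-! ### Induced operators that preserve a single fibre -/

section Induced

variable {G : Type*} [Group G] {N : Subgroup G} {K : Type*} [NormedAddCommGroup K]
  [InnerProductSpace ℂ K] {Q : N →* (K ≃ₗᵢ[ℂ] K)}

/-- If `g x = x k` with `k ∈ N`, then `g [x, v] = [x, Q(k) v]`. -/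
lemma indRep_lpSingle {σ : G ⧸ N} {g x : G} (hx : (x : G ⧸ N) = σ) (k : N)
    (hk : g * x = x * k) (v : K) :
    indRep Q g (lpSingle σ (IndFiber.mk x hx v : IndFiber Q σ)) =
      lpSingle σ (IndFiber.mk x hx (Q k v) : IndFiber Q σ) := by
  subst hx
  -- Right multiplication by an element of `N` does not change a left coset, so `g` maps the fibre
  -- at `x N` to itself.
  have hgx : ((g * x : G) : G ⧸ N) = x := by
    rw [hk]
    exact QuotientGroup.mk_mul_of_mem x k.2
  refine (indRep_indDelta g x v).trans ?_
  -- By construction `[g x, v]` sits at the coset of `g x`, which is equal to that of `x` but not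
  -- the same expression. With the coset generalised to `τ`, the summand can be renamed by
  -- substitution.
  have key : ∀ (τ : G ⧸ N) (h : ((g * x : G) : G ⧸ N) = τ),
      indDelta (g * x) v = lpSingle τ (IndFiber.mk (g * x) h v : IndFiber Q τ) := by
    rintro _ rfl
    rfl
  -- Passing from the representative `g x` to `x` costs the operator `Q (x⁻¹ (g x))`, and `x⁻¹ (g x)
  -- = k` by hypothesis.
  rw [key _ hgx, IndFiber.mk_eq rfl hgx]
  congr 4
  exact Subtype.ext (inv_mul_eq_of_eq_mul hk)

/-- If `s(φ) x = x k` with `k ∈ N`, then `φ [x, v] = [x, Q(k) R(φ) v]`. -/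
lemma indAction_lpSingle {P : Type*} [Group P] (s : P →* MulAut G)
    (hs : ∀ φ x, s φ x ∈ N ↔ x ∈ N) (R : P →* (K ≃ₗᵢ[ℂ] K))
    (hR : ∀ φ (x : N), R φ * Q x = Q ⟨s φ x.1, (hs φ x.1).2 x.2⟩ * R φ) {φ : P}
    {σ : G ⧸ N} {x : G} (hx : (x : G ⧸ N) = σ) (k : N) (hk : s φ x = x * k) (v : K) :
    indAction s hs R hR φ (lpSingle σ (IndFiber.mk x hx v : IndFiber Q σ)) =
      lpSingle σ (IndFiber.mk x hx (Q k (R φ v)) : IndFiber Q σ) := by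
  subst hx
  have hsx : ((s φ x : G) : G ⧸ N) = x := by
    rw [hk]
    exact QuotientGroup.mk_mul_of_mem x k.2
  refine (indAction_indDelta s hs R hR φ x v).trans ?_
  have key : ∀ (τ : G ⧸ N) (h : ((s φ x : G) : G ⧸ N) = τ),
      indDelta (s φ x) (R φ v) = lpSingle τ (IndFiber.mk (s φ x) h (R φ v) : IndFiber Q τ) := by
    rintro _ rfl
    rfl
  -- `R φ` has already been applied to `v` when the representative changes from `s φ x` to `x`; this
  -- explains the order `Q k (R φ v)`.
  rw [key _ hsx, IndFiber.mk_eq rfl hsx]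
  congr 4
  exact Subtype.ext (inv_mul_eq_of_eq_mul hk)

end Induced

namespace LatticeSpan

open SmoothLoop

variable {𝔱w 𝔥 𝔱b : Type*}
  [NormedAddCommGroup 𝔱w] [InnerProductSpace ℝ 𝔱w]
  [NormedAddCommGroup 𝔥] [InnerProductSpace ℝ 𝔥]
  [NormedAddCommGroup 𝔱b] [InnerProductSpace ℝ 𝔱b]

/-! ### The degree of the cover of the rotation group -/

section Degree

variable (D : LatticeSpan 𝔱w 𝔥 𝔱b)

/-- An even lattice is integral by polarisation, and `Γ` embeds isometrically into the even lattice
`Λw`. This makes the Gram matrix of `Γ` integral. -/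
lemma Γ_le_dual {x : 𝔥} (hx : x ∈ D.Γ) : x ∈ D.dual := fun _ hg =>
  D.integral_latW (D.map_w x hx) (D.map_w _ hg)

/-- The determinant of a Gram matrix of `Γ` annihilates `Γ^∨ / Γ`. -/
lemma exists_nsmul_dual_mem [FiniteDimensional ℝ 𝔥] :
    ∃ N : ℕ, 0 < N ∧ ∀ x ∈ D.dual, N • x ∈ D.Γ := by
  classical
  have := D.discrete_Γ
  have : IsZLattice ℝ D.Γ := ⟨D.span_Γ⟩
  have : Module.Free ℤ D.Γ := ZLattice.module_free ℝ D.Γ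
  have : Module.Finite ℤ D.Γ := ZLattice.module_finite ℝ D.Γ
  -- Since `Γ` is discrete and spans `𝔥`, a `ℤ`-basis of `Γ` is also an `ℝ`-basis of `𝔥`; `e` is
  -- this basis seen in `𝔥`.
  let b := Module.Free.chooseBasis ℤ D.Γ
  let e := b.ofZLatticeBasis ℝ D.Γ
  have he : ∀ i, e i = b i := fun i => b.ofZLatticeBasis_apply ℝ D.Γ i
  have hΓ : ∀ i, e i ∈ D.Γ := fun i => by rw [he]; exact (b i).2
  choose g hg using fun i j => D.Γ_le_dual (hΓ i) (e j) (hΓ j)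
  -- The Gram matrix `⟨e i, e j⟩`, with integer entries.
  let A : Matrix _ _ ℤ := Matrix.of g
  have hdet : A.det ≠ 0 := by
    intro h0
    have h1 : (A.map (Int.castRingHom ℝ)).det = 0 := by
      rw [← RingHom.mapMatrix_apply, ← RingHom.map_det, h0, map_zero]
    -- A real vector `v` in the kernel of the Gram matrix gives a combination of the `e j`
    -- orthogonal to every `e i`. It vanishes by definiteness of the form, contradicting linear
    -- independence.
    obtain ⟨v, hv, hv0⟩ := Matrix.exists_mulVec_eq_zero_iff.2 h1
    have h2 : ∑ j, v j • e j = 0 := by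
      refine InnerProductSpace.ext_inner_left_basis e fun i => ?_
      rw [inner_sum, inner_zero_right, ← Pi.zero_apply (M := fun _ => ℝ) i, ← hv0]
      refine Finset.sum_congr rfl fun j _ => ?_
      rw [inner_smul_right, hg, mul_comm]
      rfl
    exact hv (funext fun i => Fintype.linearIndependent_iff.1 e.linearIndependent v h2 i)
  refine ⟨A.det.natAbs, Int.natAbs_pos.2 hdet, fun x hx => ?_⟩
  choose k hk using fun i => hx (e i) (hΓ i)
  -- Cramer's rule: the coordinates of `x` solve the linear system with matrix `A` and integral
  -- right-hand side `k i = ⟨x, e i⟩`. Multiplying by the determinant replaces the inverse of `A` by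
  -- its integral adjugate. The identity is tested by pairing with each `e i`.
  have hx' : A.det • x = ∑ j, (A.adjugate.mulVec k) j • e j := by
    refine InnerProductSpace.ext_inner_left_basis e fun i => ?_
    have h1 := congrFun (congrArg (fun M : Matrix _ _ ℤ => M.mulVec k) A.mul_adjugate) i
    simp only [← Matrix.mulVec_mulVec, Matrix.smul_mulVec, Matrix.one_mulVec, Pi.smul_apply,
      smul_eq_mul] at h1
    rw [← Int.cast_smul_eq_zsmul ℝ, inner_smul_right, real_inner_comm, hk, inner_sum,
      ← Int.cast_mul, ← h1]
    rw [Matrix.mulVec, dotProduct, Int.cast_sum]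
    refine Finset.sum_congr rfl fun j _ => ?_
    rw [← Int.cast_smul_eq_zsmul ℝ, inner_smul_right, hg, Int.cast_mul, mul_comm]
    rfl
  have hm : A.det • x ∈ D.Γ := by
    rw [hx']
    exact sum_mem fun j _ => D.Γ.smul_mem _ (hΓ j)
  -- The annihilator has to be a natural number; its sign does not affect membership in `Γ`.
  rcases Int.natAbs_eq A.det with h | h
  · rw [← natCast_zsmul, ← h]
    exact hm
  · rw [← neg_mem_iff, ← natCast_zsmul, ← neg_smul, ← h]
    exact hm

/-- The infimum of an empty set of natural numbers is `0`, so the point is that some positive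
multiple carries `Λw - Λb` into `Γ`. Any annihilator of `Γ^∨ / Γ` does, since `Λw - Λb ⊆ Γ^∨`. -/
lemma torsionIndex_pos [FiniteDimensional ℝ 𝔥] : 0 < D.torsionIndex := by
  obtain ⟨N, hN, h⟩ := D.exists_nsmul_dual_mem
  exact (Nat.sInf_mem (s := {n : ℕ | 0 < n ∧ ∀ x ∈ D.diff, n • x ∈ D.Γ})
    ⟨N, hN, fun x hx => h x (D.diff_le_dual hx)⟩).1

lemma rotDegrees_nonempty [FiniteDimensional ℝ 𝔥] (l : D.dual) : (D.rotDegrees l).Nonempty := by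
  obtain ⟨N, hN, h⟩ := D.exists_nsmul_dual_mem
  obtain ⟨k, hk⟩ := l.2 _ (h l l.2)
  -- The first factor gives divisibility by `n`. The factor `N` makes `N ⟨l, l⟩ = ⟨l, N l⟩` an
  -- integer, because `N l` is in `Γ` and `l` is in its dual. The `2` then makes the product even.
  refine ⟨D.torsionIndex * (2 * N), Nat.mul_pos D.torsionIndex_pos (by omega), dvd_mul_right _ _,
    D.torsionIndex * k, ?_⟩
  rw [← Nat.cast_smul_eq_nsmul ℝ, inner_smul_right] at hk
  push_cast
  rw [← hk]
  ring

/-- Divisibility by `n` puts `m δ` into `Γ`. Then `m ⟨l, δ⟩` is integral because `l` is in the dual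
of `Γ`, and `m ⟨δ, δ⟩` is even by `even_of_nsmul_mem`. Expanding the square of `l - δ` changes `m
⟨l, l⟩` only by even integers. -/
lemma rotDegrees_sub_le (l : D.dual) (δ : D.diff) :
    D.rotDegrees l ⊆ D.rotDegrees (l - D.toDual δ) := by
  rintro m ⟨hm, hn, k, hk⟩
  have hδ := D.nsmul_mem_of_torsionIndex_dvd hm hn δ.2
  obtain ⟨i, hi⟩ := D.even_of_nsmul_mem δ.2 hδ
  obtain ⟨j, hj⟩ := l.2 _ hδ
  rw [← Nat.cast_smul_eq_nsmul ℝ, inner_smul_right] at hj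
  -- Half of `2k - 2j + 2i`, where `2k`, `j` and `2i` are the values of `m ⟨l, l⟩`, `m ⟨l, δ⟩` and
  -- `m ⟨δ, δ⟩`.
  refine ⟨hm, hn, k - j + i, ?_⟩
  change (m : ℝ) * ⟪(l : 𝔥) - δ, (l : 𝔥) - δ⟫ = _
  rw [real_inner_sub_sub_self]
  push_cast
  linarith

/-- The inclusion for `δ` is undone by the inclusion for `-δ`. Equality of the whole sets gives
equality of their least elements, so that one cover of the rotation group serves all summands. -/
lemma rotDegrees_sub (l : D.dual) (δ : D.diff) :
    D.rotDegrees (l - D.toDual δ) = D.rotDegrees l := by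
  refine (D.rotDegrees_sub_le l δ).antisymm' ?_
  have := D.rotDegrees_sub_le (l - D.toDual δ) (-δ)
  rwa [map_neg, sub_neg_eq_add, sub_add_cancel] at this

end Degree

variable {D : LatticeSpan 𝔱w 𝔥 𝔱b}

/-! ### Winding elements and the kernel -/

lemma winding_windingLift (p : D.Λw × D.Λb) : winding (D.windingLift p) = D.latDiff p := by
  simp [winding, windingLift]

lemma isGluedLift_windingElt (p : D.Λw × D.Λb) :
    D.IsGluedLift (windingElt p).1 (D.windingLift p) :=
  isGluedLift_ofLift _ (windingLift_mem p) _ _ _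

/-- An affine path has constant derivative, equal to its winding, so the integral only sees the
average of `Η`. -/
lemma area_windingLift_left [FiniteDimensional ℝ 𝔥] (p : D.Λw × D.Λb) {Η : ℝ → 𝔥}
    (h : Continuous Η) : area (D.windingLift p) Η =
      (1 / 2) * ⟪(D.latDiff p : 𝔥), avg Η⟫ + (1 / 2) * ⟪(D.latDiff p : 𝔥), Η 0⟫ := by
  have : CompleteSpace 𝔥 := FiniteDimensional.complete ℝ 𝔥
  have hd : ∀ t, deriv (D.windingLift p) t = D.latDiff p := fun t => by
    have := ((hasDerivAt_id t).smul_const (D.latDiff p : 𝔥)).const_add (D.πb.symm p.2)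
    rw [one_smul] at this
    exact this.deriv
  have hc := (innerSL ℝ (D.latDiff p : 𝔥)).intervalIntegral_comp_comm
    (μ := MeasureTheory.volume) (a := 0) (b := 1) (f := Η) (h.intervalIntegrable _ _)
  simp only [innerSL_apply_apply] at hc
  simp only [area, sympl, hd, hc, winding_windingLift, avg]

/-- Integration by parts moves the derivative onto the affine path. Compared with
`area_windingLift_left`, the term at `0` is the same and the average changes sign; the difference of
the two areas is therefore the full pairing with the average. -/
lemma area_windingLift_right [FiniteDimensional ℝ 𝔥] (p : D.Λw × D.Λb) {Η : ℝ → 𝔥}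
    (h : Η ∈ D.quasiPeriodic) (h0 : winding Η = 0) : area Η (D.windingLift p) =
      (1 / 2) * ⟪(D.latDiff p : 𝔥), Η 0⟫ - (1 / 2) * ⟪(D.latDiff p : 𝔥), avg Η⟫ := by
  have : CompleteSpace 𝔥 := FiniteDimensional.complete ℝ 𝔥
  set δ : 𝔥 := (D.latDiff p : 𝔥) with hδ
  have hη := h.1.continuous
  have hη' := (contDiff_deriv h.1).continuous
  have hc := (innerSL ℝ δ).intervalIntegral_comp_comm
    (μ := MeasureTheory.volume) (a := 0) (b := 1) (f := Η) (hη.intervalIntegrable _ _)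
  simp only [innerSL_apply_apply] at hc
  -- The product rule behind the integration by parts; the affine path contributes its constant
  -- slope `δ`.
  have hderiv : ∀ t, HasDerivAt (fun t => ⟪D.windingLift p t, Η t⟫)
      (⟪deriv Η t, D.windingLift p t⟫ + ⟪δ, Η t⟫) t := fun t => by
    have h1 : HasDerivAt (D.windingLift p) δ t := by
      have := ((hasDerivAt_id t).smul_const δ).const_add (D.πb.symm p.2)
      rwa [one_smul] at this
    have h2 := (h.1.differentiable (by simp) t).hasDerivAt
    have := h1.inner ℝ h2
    rwa [real_inner_comm] at this
  have hw : Continuous (D.windingLift p) := (windingLift_mem p).1.continuous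
  have hI := intervalIntegral.integral_eq_sub_of_hasDerivAt (a := 0) (b := 1)
    (fun t _ => hderiv t) (Continuous.intervalIntegrable (by fun_prop) _ _)
  rw [intervalIntegral.integral_add (Continuous.intervalIntegrable (by fun_prop) _ _)
    (Continuous.intervalIntegrable (by fun_prop) _ _), hc] at hI
  have h1 : Η 1 = Η 0 := sub_eq_zero.1 h0
  -- The boundary term: `Η` has equal values at both ends, so only the winding of the affine path
  -- remains.
  have h2 : ⟪D.windingLift p 1, Η 0⟫ - ⟪D.windingLift p 0, Η 0⟫ = ⟪δ, Η 0⟫ := by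
    rw [← inner_sub_left]
    congr 1
    exact winding_windingLift p
  rw [h1, h2] at hI
  rw [area, h0, inner_zero_left, mul_zero, add_zero, sympl, avg]
  linarith

/-! ### Moving the kernel past a winding element shifts the character -/

variable [FiniteDimensional ℝ 𝔥] {ε : D.CommutatorCocycle}

/-- The commutation relation of `(ρ, z) ∈ ker (Δ' ∘ Pth)` with a winding element. -/
lemma mul_windingElt (p : D.Λw × D.Λb) {ρ : D.loopGroup} (hρ : pathWinding ρ = 0) (z : Circle) :
    (⟨ρ, z⟩ * ⟨windingElt p, 1⟩ : ExtLoopGroup ε) = ⟨windingElt p, 1⟩ *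
      ⟨ρ, circleExp (-⟪(D.latDiff p : 𝔥), avg (gluedLift ρ)⟫) * z⟩ := by
  -- The loop group is abelian, so the two products can differ only in their phases.
  refine ExtLoopGroup.ext (add_comm _ _) ?_
  change z * 1 * loopCocycle ε ρ (windingElt p) = 1 * (_ * z) * loopCocycle ε (windingElt p) ρ
  -- Normalisation of `ε` makes its factor `1` on both sides, as one argument is the zero winding of
  -- `ρ`. What remains is that `area Η w = -⟨δ, avg Η⟩ + area w Η`, for `w` the lift of the winding
  -- element and `δ` its winding.
  rw [loopCocycle_eq ε (isGluedLift ρ) (isGluedLift_windingElt p),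
    loopCocycle_eq ε (isGluedLift_windingElt p) (isGluedLift ρ), hρ, ε.map_zero_left,
    ε.map_zero_right, area_windingLift_left p (gluedLift_mem ρ).1.continuous,
    area_windingLift_right p (gluedLift_mem ρ) (winding_of_ker hρ), one_mul, one_mul, one_mul,
    mul_one, mul_comm _ z, mul_assoc, ← circleExp_add]
  congr 2
  ring

/-- The phase in `mul_windingElt` shifts the character `l` of `W_{χ, l}` by `δ`. -/
lemma weylRep_phase_mul (χ : AddChar D.interTorus Circle) (l : D.dual) (δ : D.diff)
    (h : kerExt ε) :
    weylRep ε χ l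
        ⟨⟨h.1.pt, circleExp (-⟪(δ : 𝔥), avg (gluedLift h.1.pt)⟫) * h.1.phase⟩, h.2⟩ =
      weylRep ε χ (l - D.toDual δ) h := by
  -- Membership in the kernel, the defect and the oscillating loop depend on the loop alone, not on
  -- the phase. The two sides thus share these factors.
  change phaseOp (Fock 𝔥) (χ (defect h.1.pt h.2)) * phaseOp (Fock 𝔥) (avgPhase l h.1.pt) *
      Fock.weyl (oscLoop h.1.pt h.2) (_ * h.1.phase) =
    phaseOp (Fock 𝔥) (χ (defect h.1.pt h.2)) *
      phaseOp (Fock 𝔥) (avgPhase (l - D.toDual δ) h.1.pt) *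
      Fock.weyl (oscLoop h.1.pt h.2) h.1.phase
  -- The commutator phase is the value of the character `-δ` at the average, so it is absorbed into
  -- the character `l`.
  have e : avgPhase (l - D.toDual δ) h.1.pt =
      avgPhase l h.1.pt * circleExp (-⟪(δ : 𝔥), avg (gluedLift h.1.pt)⟫) := by
    rw [avgPhase, avgPhase, ← circleExp_add]
    congr 1
    change ⟪(l : 𝔥) - δ, _⟫ = _
    rw [inner_sub_left, sub_eq_add_neg]
  rw [Fock.weyl_mul_phase, e, map_mul]
  simp only [mul_assoc]

lemma fiberIso_symm_apply (χ : AddChar D.interTorus Circle) (l : D.dual) {δ : D.diff}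
    (p : D.Λw × D.Λb) (hp : D.latDiff p = δ) (v : Fock 𝔥) :
    (fiberIso ε χ l p hp).symm v = IndFiber.mk ⟨windingElt p, 1⟩ (windingElt_coset ε hp) v :=
  IndFiber.mkIso_apply _ _ _

/-- Every vector of the fibre is `[x, v]` with `x` the winding element of `p`. From `h x = x h'` one
gets `h [x, v] = [x, W_{χ,l}(h') v]`, and `W_{χ,l}(h')` is `W_{χ,l-δ}(h)`. The relation involves `p`
only through `δ`, so any pre-image works. That the summand is preserved is contained in the form of
the right-hand side. -/
lemma indRep_fiberIso (χ : AddChar D.interTorus Circle) (l : D.dual) {δ : D.diff}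
    (p : D.Λw × D.Λb) (hp : D.latDiff p = δ) (h : kerExt ε)
    (u : IndFiber (weylRep ε χ l) (coset ε δ)) :
    indRep (weylRep ε χ l) h (lpSingle (coset ε δ) u) =
      lpSingle (coset ε δ) ((fiberIso ε χ l p hp).symm
        (weylRep ε χ (l - D.toDual δ) h (fiberIso ε χ l p hp u))) := by
  obtain ⟨v, rfl⟩ := (fiberIso ε χ l p hp).symm.surjective u
  rw [LinearIsometryEquiv.apply_symm_apply, fiberIso_symm_apply, fiberIso_symm_apply,
    ← weylRep_phase_mul χ l δ h]
  subst hp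
  exact indRep_lpSingle (windingElt_coset ε rfl) _ (mul_windingElt p h.2 h.1.phase) v

/-! ### Constant loops and the rotation of winding elements -/

/-- The constant loop at `exp_H x`. -/
def constLoop (x : 𝔥) : D.loopGroup :=
  ofLift (fun _ => x) (const_mem x) (D.expH x) rfl rfl

omit [FiniteDimensional ℝ 𝔥] in
lemma isGluedLift_constLoop (x : 𝔥) : D.IsGluedLift (constLoop (D := D) x).1 fun _ => x :=
  isGluedLift_ofLift _ _ _ _ _

omit [FiniteDimensional ℝ 𝔥] in
lemma pathWinding_constLoop (x : 𝔥) : pathWinding (constLoop (D := D) x) = 0 := by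
  ext
  rw [(isGluedLift_constLoop x).winding_eq]
  simp [winding]

/-- A constant loop has no defect and no oscillating part, so neither `χ` nor a nontrivial Weyl
operator enters. The scalar left over is what a rotation contributes on a fibre through its effect
on the representative. -/
lemma weylRep_constLoop (χ : AddChar D.interTorus Circle) (l : D.dual) (x : 𝔥) (z : Circle) :
    weylRep ε χ l ⟨⟨constLoop x, z⟩, pathWinding_constLoop x⟩ =
      phaseOp (Fock 𝔥) (circleExp ⟪(l : 𝔥), x⟫ * z) := by
  have hl := isGluedLift_constLoop (D := D) x
  have h0 := pathWinding_constLoop (D := D) x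
  change phaseOp (Fock 𝔥) (χ (defect (constLoop x) h0)) *
    phaseOp (Fock 𝔥) (avgPhase l (constLoop x)) * Fock.weyl (oscLoop (constLoop x) h0) z = _
  have e1 : defect (constLoop (D := D) x) h0 = 0 := by
    ext
    change D.expH x - pth (constLoop x) 1 = 0
    rw [hl.pth_eq, sub_self]
  have e2 : oscLoop (constLoop (D := D) x) h0 = 0 := by
    ext t
    rw [oscLoop_eq h0 hl, avg_const, sub_self]
    rfl
  rw [e1, e2, avgPhase_eq l hl, avg_const, AddChar.map_zero_eq_one, map_one, one_mul, map_mul,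
    ← mul_one z, Fock.weyl_mul_phase, Fock.weyl_zero_one, mul_one, mul_one]

omit [FiniteDimensional ℝ 𝔥] in
/-- Rotation of a winding element is multiplication by a constant loop. -/
lemma rotExtReal_windingElt (p : D.Λw × D.Λb) (θ : ℝ) :
    rotExtReal ε (Multiplicative.ofAdd θ) ⟨windingElt p, 1⟩ = ⟨windingElt p, 1⟩ *
      ⟨constLoop (-(θ • (D.latDiff p : 𝔥))),
        circleExp ((1 / 2) * ⟪(D.latDiff p : 𝔥), (D.latDiff p : 𝔥)⟫ * θ)⟩ := by
  have hl := isGluedLift_windingElt p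
  have hc := isGluedLift_constLoop (D := D) (-(θ • (D.latDiff p : 𝔥)))
  rw [rotExtReal_apply]
  refine ExtLoopGroup.ext (Subtype.ext ?_) ?_
  · have h1 := isGluedLift_rotLoop θ hl
    -- The lift is affine, so rotating it amounts to adding the constant `-θ δ`, with `δ` its slope.
    have e : (fun t => D.windingLift p (t - θ)) =
        D.windingLift p + fun _ => -(θ • (D.latDiff p : 𝔥)) := by
      funext t
      simp only [windingLift, Pi.add_apply, sub_smul]
      abel
    rw [e] at h1
    refine ext_of_isGluedLift h1 (hl.add hc) ?_
    -- A lift does not determine the value at `q`. Both values at `q` are `exp_H (-θ δ)`: on the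
    -- left by the rule for rotating a value at `q`, on the right because the winding element
    -- vanishes there.
    change 0 - pth (windingElt p) 0 + pth (windingElt p) (0 - θ) = 0 + D.expH _
    rw [hl.pth_eq, hl.pth_eq, congrFun e 0, Pi.add_apply, map_add]
    abel
  · change rotPhase θ (windingElt p) * 1 = 1 * _ * loopCocycle ε (windingElt p) (constLoop _)
    rw [rotPhase_eq θ hl, loopCocycle_eq ε hl hc, pathWinding_constLoop, ε.map_zero_right,
      area_const_right (windingLift_mem p), winding_windingLift, one_mul, one_mul, mul_one,
      ← circleExp_add]
    congr 1
    have : D.windingLift p (-θ) - D.windingLift p 0 = -(θ • (D.latDiff p : 𝔥)) := by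
      simp [windingLift]
    rw [this, inner_neg_left, inner_neg_right, real_inner_smul_left, real_inner_smul_right]
    ring

/-- Rotating `[x, v]` rotates the representative as well as the vector. Writing the rotated
representative as `x` times a constant loop turns the first effect into a scalar, which corrects the
weight `½ ⟨l, l⟩` of the rotations to `½ ⟨l - δ, l - δ⟩`. -/
lemma indRotRep_fiberIso (χ : AddChar D.interTorus Circle) (l : D.dual) {m : ℕ}
    (hm : m ∈ D.rotDegrees l) {δ : D.diff} (hm' : m ∈ D.rotDegrees (l - D.toDual δ))
    (p : D.Λw × D.Λb) (hp : D.latDiff p = δ) (φ : Multiplicative (AddCircle (m : ℝ)))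
    (u : IndFiber (weylRep ε χ l) (coset ε δ)) :
    indRotRep ε χ l m hm φ (lpSingle (coset ε δ) u) =
      lpSingle (coset ε δ) ((fiberIso ε χ l p hp).symm
        (rotRep (l - D.toDual δ) m hm' φ (fiberIso ε χ l p hp u))) := by
  obtain ⟨v, rfl⟩ := (fiberIso ε χ l p hp).symm.surjective u
  obtain ⟨θ, rfl⟩ : ∃ θ : ℝ, φ = Multiplicative.ofAdd (θ : AddCircle (m : ℝ)) :=
    (QuotientAddGroup.mk'_surjective _ φ.toAdd).imp fun _ h => h.symm
  rw [LinearIsometryEquiv.apply_symm_apply, fiberIso_symm_apply, fiberIso_symm_apply]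
  subst hp
  -- The constant loop and its phase are those of `rotExtReal_windingElt`; it applies because the
  -- class of `θ` acts on the central extension exactly as `θ` does.
  refine (indAction_lpSingle _ _ _ _ _ ⟨⟨constLoop _, _⟩, pathWinding_constLoop _⟩
    (rotExtReal_windingElt p θ) v).trans ?_
  rw [weylRep_constLoop, rotRep_coe, rotRep_coe, ← Function.comp_apply (f := phaseOp (Fock 𝔥) _),
    ← LinearIsometryEquiv.coe_mul, ← mul_assoc, ← map_mul, ← circleExp_add, ← circleExp_add]
  congr 6
  -- Completing the square: `-θ ⟨l, δ⟩` from the character at the constant loop, `½ θ ⟨δ, δ⟩` from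
  -- its phase and `½ θ ⟨l, l⟩` from `R_{χ,l}`, where `δ` is the winding of `p`.
  change _ = 1 / 2 * ⟪(l : 𝔥) - D.latDiff p, (l : 𝔥) - D.latDiff p⟫ * θ
  rw [real_inner_sub_sub_self, inner_neg_right, real_inner_smul_right]
  ring

/-! ### Assembling the Hilbert direct sum -/

/-- The bijection `coset` from `Λw - Λb` to the cosets of `ker (Δ' ∘ Pth)`. -/
def diffEquivCoset (ε : D.CommutatorCocycle) : D.diff ≃ ExtLoopGroup ε ⧸ kerExt ε :=
  Multiplicative.ofAdd.trans
    (QuotientGroup.quotientKerEquivOfSurjective _ (windingHom_surjective ε)).symm.toEquiv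

/-- The direct sum of the maps `fiberIso` for a choice of pre-images. -/
def sumIso (ε : D.CommutatorCocycle) (χ : AddChar D.interTorus Circle) (l : D.dual)
    (p : D.diff → D.Λw × D.Λb) (hp : ∀ δ, D.latDiff (p δ) = δ) :
    IndSpace (weylRep ε χ l) ≃ₗᵢ[ℂ] lp (fun _ : D.diff => Fock 𝔥) 2 :=
  -- The map is built from right to left and then inverted: indexed by `δ`, the target fibre is
  -- literally the one at `coset ε δ`, where `fiberIso` is available.
  (lpCongr (A := fun _ : D.diff => Fock 𝔥) (B := IndFiber (weylRep ε χ l)) (diffEquivCoset ε)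
    fun δ => (fiberIso ε χ l (p δ) (hp δ)).symm).symm

/-- This characterises the direct sum map by its components and allows the intertwining property to
be checked one summand at a time. -/
lemma sumIso_single (χ : AddChar D.interTorus Circle) (l : D.dual)
    (p : D.diff → D.Λw × D.Λb) (hp : ∀ δ, D.latDiff (p δ) = δ) (δ : D.diff)
    (u : IndFiber (weylRep ε χ l) (coset ε δ)) :
    sumIso ε χ l p hp (lpSingle (coset ε δ) u) =
      lpSingle δ (fiberIso ε χ l (p δ) (hp δ) u) := by
  rw [sumIso, LinearIsometryEquiv.symm_apply_eq]
  refine Eq.trans ?_ (lpCongr_single (A := fun _ : D.diff => Fock 𝔥)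
    (B := IndFiber (weylRep ε χ l)) (diffEquivCoset ε)
    (fun δ => (fiberIso ε χ l (p δ) (hp δ)).symm) δ _).symm
  exact congrArg (lpSingle (coset ε δ)) ((fiberIso ε χ l (p δ) (hp δ)).symm_apply_apply u).symm

lemma resIndRep_apply (χ : AddChar D.interTorus Circle) {l : D.dual} {m : ℕ}
    (hm : m ∈ D.rotDegrees l) (g : KerRot ε m hm.1 hm.2.1) :
    resIndRep ε χ l m hm g =
      indRep (weylRep ε χ l) g.left * indRotRep ε χ l m hm g.right := rfl

lemma weylRotRep_apply (χ : AddChar D.interTorus Circle) {l : D.dual} {m : ℕ}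
    (hm : m ∈ D.rotDegrees l) (g : KerRot ε m hm.1 hm.2.1) :
    weylRotRep ε χ l m hm g = weylRep ε χ l g.left * rotRep l m hm g.right := rfl

/-- Both sides are isometries in `v`, so it suffices to compare them on single summands. There an
element of the semidirect product acts by a rotation followed by a kernel element, and each of the
two is already intertwined by `fiberIso`. -/
lemma sumIso_resIndRep (χ : AddChar D.interTorus Circle) (l : D.dual) {m : ℕ}
    (hm : m ∈ D.rotDegrees l) (hm' : ∀ δ, m ∈ D.rotDegrees (l - D.toDual δ))
    (p : D.diff → D.Λw × D.Λb) (hp : ∀ δ, D.latDiff (p δ) = δ) (g : KerRot ε m hm.1 hm.2.1)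
    (v : IndSpace (weylRep ε χ l)) :
    sumIso ε χ l p hp (resIndRep ε χ l m hm g v) =
      directSumRep (fun δ : D.diff => weylRotRep ε χ (l - D.toDual δ) m (hm' δ)) g
        (sumIso ε χ l p hp v) := by
  have key : (resIndRep ε χ l m hm g).trans (sumIso ε χ l p hp) = (sumIso ε χ l p hp).trans
      (directSumRep (fun δ : D.diff => weylRotRep ε χ (l - D.toDual δ) m (hm' δ)) g) := by
    refine lp_ext_single fun σ u => ?_
    -- Every coset is the one of some winding `δ`, so the chosen pre-image `p δ` trivialises its
    -- fibre.
    obtain ⟨δ, rfl⟩ : ∃ δ, coset ε δ = σ := (diffEquivCoset ε).surjective σ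
    have e1 := LinearIsometryEquiv.congr_fun (resIndRep_apply (ε := ε) χ hm g)
      (lpSingle (coset ε δ) u)
    have e2 := LinearIsometryEquiv.congr_fun (weylRotRep_apply (ε := ε) χ (hm' δ) g)
      (fiberIso ε χ l (p δ) (hp δ) u)
    have e3 := directSumRep_single
      (fun δ : D.diff => weylRotRep ε χ (l - D.toDual δ) m (hm' δ)) g δ
      (fiberIso ε χ l (p δ) (hp δ) u)
    rw [LinearIsometryEquiv.coe_mul, Function.comp_apply] at e1 e2
    -- The rotation acts first. Between the two conjugated operators `fiberIso` cancels its inverse,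
    -- leaving the conjugate of `W_{χ,l-δ} R_{χ,l-δ}`, the action of `g` on the summand `l - δ`.
    rw [indRotRep_fiberIso χ l hm (hm' δ) (p δ) (hp δ), indRep_fiberIso χ l (p δ) (hp δ),
      LinearIsometryEquiv.apply_symm_apply, ← e2] at e1
    rw [LinearIsometryEquiv.trans_apply, LinearIsometryEquiv.trans_apply, e1, sumIso_single,
      sumIso_single, LinearIsometryEquiv.apply_symm_apply, e3]
  exact LinearIsometryEquiv.congr_fun key v

end LatticeSpan

end

/-- The operators `R_{χ,l-δ}` on the `m`-fold cover make sense only once `m` is known to be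
admissible for `l - δ`. For this reason the equality of least degrees is an existentially bound
proof `hm'` to which the remaining clauses refer. -/
theorem mainTheorem6 {𝔱w 𝔥 𝔱b : Type*}
    [NormedAddCommGroup 𝔱w] [InnerProductSpace ℝ 𝔱w]
    [NormedAddCommGroup 𝔥] [InnerProductSpace ℝ 𝔥] [FiniteDimensional ℝ 𝔥]
    [NormedAddCommGroup 𝔱b] [InnerProductSpace ℝ 𝔱b]
    (D : LatticeSpan 𝔱w 𝔥 𝔱b) (ε : D.CommutatorCocycle)
    (χ : AddChar D.interTorus Circle) (l : D.dual) :
    -- the degree `m` of the cover of the rotation group exists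
    (∃ m, IsLeast (D.rotDegrees l) m) ∧
    ∀ (m : ℕ) (hm : IsLeast (D.rotDegrees l) m),
      -- it is the same for `l` and for `l - δ`
      ∃ hm' : ∀ δ : D.diff, IsLeast (D.rotDegrees (l - D.toDual δ)) m,
        -- on the summand at the coset of `δ`, for every pre-image `p = (λ_w, λ_b)` of `δ`
        (∀ (δ : D.diff) (p : D.Λw × D.Λb) (hp : D.latDiff p = δ),
          (∀ v : Fock 𝔥, LatticeSpan.fiberIso ε χ l p hp
            (IndFiber.mk ⟨LatticeSpan.windingElt p, 1⟩
              (LatticeSpan.windingElt_coset ε hp) v) = v) ∧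
          (∀ (h : LatticeSpan.kerExt ε) (u : IndFiber (LatticeSpan.weylRep ε χ l)
              (LatticeSpan.coset ε δ)),
            indRep (LatticeSpan.weylRep ε χ l) h (lpSingle (LatticeSpan.coset ε δ) u) =
              lpSingle (LatticeSpan.coset ε δ) ((LatticeSpan.fiberIso ε χ l p hp).symm
                (LatticeSpan.weylRep ε χ (l - D.toDual δ) h (LatticeSpan.fiberIso ε χ l p hp u)))) ∧
          (∀ (φ : Multiplicative (AddCircle (m : ℝ))) (u : IndFiber (LatticeSpan.weylRep ε χ l)
              (LatticeSpan.coset ε δ)),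
            LatticeSpan.indRotRep ε χ l m hm.1 φ (lpSingle (LatticeSpan.coset ε δ) u) =
              lpSingle (LatticeSpan.coset ε δ) ((LatticeSpan.fiberIso ε χ l p hp).symm
                (LatticeSpan.rotRep (l - D.toDual δ) m (hm' δ).1 φ
                  (LatticeSpan.fiberIso ε χ l p hp u))))) ∧
        -- the direct sum of these maps, for every choice of pre-images
        (∀ (p : D.diff → D.Λw × D.Λb) (hp : ∀ δ, D.latDiff (p δ) = δ),
          ∃ F : IndSpace (LatticeSpan.weylRep ε χ l) ≃ₗᵢ[ℂ] lp (fun _ : D.diff => Fock 𝔥) 2,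
            (∀ (δ : D.diff) (u : IndFiber (LatticeSpan.weylRep ε χ l) (LatticeSpan.coset ε δ)),
              F (lpSingle (LatticeSpan.coset ε δ) u) =
                lpSingle δ (LatticeSpan.fiberIso ε χ l (p δ) (hp δ) u)) ∧
            (∀ (g : LatticeSpan.KerRot ε m hm.1.1 hm.1.2.1)
              (v : IndSpace (LatticeSpan.weylRep ε χ l)),
              F (LatticeSpan.resIndRep ε χ l m hm.1 g v) =
                directSumRep (fun δ : D.diff =>
                  LatticeSpan.weylRotRep ε χ (l - D.toDual δ) m (hm' δ).1) g (F v))) := by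
  -- The least degree is the infimum of a nonempty set of natural numbers; minimality passes to `l -
  -- δ` because the two sets of degrees are equal.
  refine ⟨⟨_, Nat.sInf_mem (D.rotDegrees_nonempty l), fun _ h => Nat.sInf_le h⟩, fun m hm =>
    ⟨fun δ => by rwa [D.rotDegrees_sub], fun δ p hp => ⟨fun v => ?_, fun h u => ?_, fun φ u => ?_⟩,
      fun p hp => ⟨LatticeSpan.sumIso ε χ l p hp, fun δ u => ?_, fun g v => ?_⟩⟩⟩
  · exact LatticeSpan.fiberIso_mk ε χ l p hp v
  · exact LatticeSpan.indRep_fiberIso χ l p hp h u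
  · exact LatticeSpan.indRotRep_fiberIso χ l hm.1 _ p hp φ u
  · exact LatticeSpan.sumIso_single χ l p hp δ u
  · exact LatticeSpan.sumIso_resIndRep χ l hm.1 _ p hp g v
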